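/- **Setting.** Let $X$ be a complex quasi-projective scheme with an action of a torus $\mathbb T=(\mathbb C^*)^d$, and let $n\ge 1$. "Sheaf on $X^n$" means coherent, $\mathbb T$-equivariant, $\mathbb Z/2$-graded sheaf ($\mathbb T$ acting diagonally); homomorphisms are $\mathbb T$-equivariant and preserve the grading, and $E[k]_i=E_{i+k}$. The group $S_n$ acts on $X^n$ by $\sigma(x_1,\dots,x_n)=(x_{\sigma^{-1}(1)},\dots,x_{\sigma^{-1}(n)})$. Set partitions of $[n]$ are ordered by $\mathfrak A\le\mathfrak B$ iff $\mathfrak A$ is finer than $\mathfrak B$, and $\mathfrak A\cap\mathfrak B$ is the partition into the non-empty intersections of parts. Let $(X^n)_{\mathfrak A}$ be the set of points with $x_a=x_b$ iff $a,b$ lie in the same part of $\mathfrak A$, let $U_{\mathfrak A}=\bigcup_{\mathfrak B\le\mathfrak A}(X^n)_{\mathfrak B}$, and let $U_{\mathfrak B,\mathfrak C}=\bigcup U_{\mathfrak A}$ over all $\mathfrak A$ with $\mathfrak B\cap\mathfrak A=\mathfrak C\cap\mathfrak A$. **Systems.** A *strict system* on $X^n$ consists of sheaves $F_{\mathfrak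 A}$ on $X^n$, for all set partitions $\mathfrak A$ of $[n]$, and homomorphisms $\phi_{\mathfrak A,\mathfrak B}\colon F_{\mathfrak A}\to F_{\mathfrak B}$ for $\mathfrak A\le\mathfrak B$, with $\phi_{\mathfrak A,\mathfrak A}=\mathrm{id}$, $\phi_{\mathfrak B,\mathfrak C}\circ\phi_{\mathfrak A,\mathfrak B}=\phi_{\mathfrak A,\mathfrak C}$, and $\phi_{\mathfrak A,\mathfrak B}|_{U_{\mathfrak A,\mathfrak B}}$ an isomorphism. It is *$S_n$-equivariant* if it is equipped with isomorphisms $\rho_{\sigma,\mathfrak A}\colon(\sigma^{-1})^*F_{\mathfrak A}\to F_{\sigma\mathfrak A}$ of sheaves on $X^n$, for $\sigma\in S_n$, which commute with the $\phi$'s and satisfy $\rho_{\sigma\tau,\mathfrak A}=\rho_{\sigma,\tau\mathfrak A}\circ(\sigma^{-1})^*\rho_{\tau,\mathfrak A}$. **Index trees.** An *index tree* $T$ of order $n$ is a rooted tree in which every node is a leaf or has at least two children, with leaves labelled bijectively by the parts of a set partition $\mathfrak A(T)$ of $[n]$. For a node $v$ let $L_v$ be the union of the labels of the leaves below $v$,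 and let $P(T)$ be the set of the $L_v$ with $v$ a non-leaf node. Let $\mathcal T_{n,k}$ be the set of index trees of order $n$ with $k$ non-leaf nodes. Order subsets of $[n]$ by $A<B$ iff $\sum_{i\in A}2^i<\sum_{i\in B}2^i$, and for a non-leaf node $v$ put $s(v)=(-1)^l$, where $l=|\{L\in P(T): L<L_v\}|$. For a non-leaf, non-root node $v$, let $O(T,v)$ be the tree obtained by deleting $v$ and attaching its children to its parent. If $v$ is *exceptional* (a non-leaf node all of whose children are leaves), let $E(T,v)$ be the tree obtained by deleting the children of $v$, so that $v$ becomes a leaf with label $L_v$. For $\sigma\in S_n$, the tree $\sigma T$ is $T$ with all labels replaced by their images under $\sigma$. **The complex.** Let $(F_{\mathfrak A},\phi,\rho)$ be an $S_n$-equivariant strict system on $X^n$. Put $F_T=F_{\mathfrak A(T)}$, $$G_{n,k}=\bigoplus_{T\in\mathcal T_{n,k}}F_T,\qquad G_n=\bigoplus_{k=0}^{n-1}G_{n,k}[k],$$ $$o(T,v)=s(v)\,\mathrm{id}\colon F_T\to F_{O(T,v)},\qquad e(T,v)=-s(v)\,\phi_{\mathfrak A(T),\mathfrak A(E(T,v))}\colon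 F_T\to F_{E(T,v)}.$$ Let $d_{n,k}\colon G_{n,k}\to G_{n,k-1}$ be the sum of all $o(T,v)$ ($v$ a non-leaf, non-root node of $T$) and all $e(T,v)$ ($v$ an exceptional node of $T$) with $T\in\mathcal T_{n,k}$, and let $d_n=\sum_{k=1}^{n-1}d_{n,k}\colon G_n\to G_n[1]$. The $S_n$-equivariant structure of $G_n$ is the sum of the maps $(-1)^{l}\rho_{\sigma,\mathfrak A(T)}\colon(\sigma^{-1})^*F_T\to F_{\sigma T}$, where $l$ is the number of pairs $A<B$ in $P(T)$ with $\sigma(A)>\sigma(B)$. **Proposition.** The homomorphism $d_n$ commutes with the $S_n$-equivariant structure of $G_n$ and satisfies $d_n\circ d_n=0$, and the cohomology sheaf $$H^*(G_n)=\ker d_n/\operatorname{im}d_n$$ is supported set-theoretically on the small diagonal $\Delta=\{(x,\dots,x)\}\subseteq X^n$. -/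

import Mathlib

open CategoryTheory Limits AlgebraicGeometry MonoidalCategory CartesianMonoidalCategory

noncomputable section

namespace TreeComplex

/-- The base `Spec ℂ`. -/
abbrev SpecC : Scheme.{0} := Spec (.of ℂ)

/-- The torus `𝕋 = (ℂ^*)^d`, i.e. the spectrum of the group algebra `ℂ[ℤ^d]`. -/
def torus (d : ℕ) : Over SpecC := (Spec (.of (AddMonoidAlgebra ℂ (Fin d → ℤ)))).asOver SpecC

instance (d : ℕ) : GrpObj (torus d) :=
  inferInstanceAs (GrpObj ((Spec (.of (AddMonoidAlgebra ℂ (Fin d → ℤ)))).asOver SpecC))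

attribute [local instance] MvPolynomial.gradedAlgebra

/-- Projective space over `ℂ`. -/
def projectiveSpace (m : ℕ) : Over SpecC :=
  Over.mk (Proj.toSpecZero (MvPolynomial.homogeneousSubmodule (Fin (m + 1)) ℂ) ≫
    Spec.map (CommRingCat.ofHom
      (algebraMap ℂ (MvPolynomial.homogeneousSubmodule (Fin (m + 1)) ℂ 0))))

/-- `X` is quasi-projective over `ℂ`: it admits a locally closed immersion into some `ℙ^m`. -/
class IsQuasiProjective (X : Over SpecC) : Prop where
  exists_immersion : ∃ (m : ℕ) (i : X ⟶ projectiveSpace m), IsImmersion i.left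

instance (X : Over SpecC) [IsQuasiProjective X] : IsSeparated X.hom := by
  obtain ⟨m, i, hi⟩ := IsQuasiProjective.exists_immersion (X := X)
  have h : IsSeparated (projectiveSpace m).hom := by
    dsimp [projectiveSpace]; infer_instance
  rw [← Over.w i]
  infer_instance


/-! ### Equivariant objects -/

/-- Two functors `A, P : C ⥤ D` (to be thought of as pullback along an action morphism and along
a projection) and three functors `D ⥤ E`, with the identifications that are needed to formulate
the cocycle condition for an isomorphism `A.obj M ≅ P.obj M`. -/
structure CocycleDatum (C D E : Type*) [Category C] [Category D] [Category E] where
  /-- pullback along the action -/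
  A : C ⥤ D
  /-- pullback along the projection -/
  P : C ⥤ D
  /-- pullback along `μ × 1` -/
  Q₁ : D ⥤ E
  /-- pullback along `1 × a` -/
  Q₂ : D ⥤ E
  /-- pullback along `p₂₃` -/
  Q₃ : D ⥤ E
  /-- `a ∘ (μ × 1) = a ∘ (1 × a)` -/
  s₁₂ : A ⋙ Q₁ ≅ A ⋙ Q₂
  /-- `p ∘ (1 × a) = a ∘ p₂₃` -/
  s₂₃ : P ⋙ Q₂ ≅ A ⋙ Q₃
  /-- `p ∘ p₂₃ = p ∘ (μ × 1)` -/
  s₃₁ : P ⋙ Q₃ ≅ P ⋙ Q₁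

/-- An object `M` with an isomorphism `θ : A M ≅ P M` satisfying the cocycle condition. -/
structure EquivariantObject {C D E : Type*} [Category C] [Category D] [Category E]
    (K : CocycleDatum C D E) where
  /-- the underlying object -/
  obj : C
  /-- the equivariant structure -/
  θ : K.A.obj obj ≅ K.P.obj obj
  cocycle : K.Q₁.map θ.hom = K.s₁₂.hom.app obj ≫ K.Q₂.map θ.hom ≫ K.s₂₃.hom.app obj ≫
    K.Q₃.map θ.hom ≫ K.s₃₁.hom.app obj

namespace EquivariantObject

variable {C D E : Type*} [Category C] [Category D] [Category E] {K : CocycleDatum C D E}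

/-- A morphism of equivariant objects is a morphism of objects commuting with `θ`. -/
@[ext]
structure Hom (M N : EquivariantObject K) where
  /-- the underlying morphism -/
  hom : M.obj ⟶ N.obj
  comm : K.A.map hom ≫ N.θ.hom = M.θ.hom ≫ K.P.map hom

instance : Category (EquivariantObject K) where
  Hom := Hom
  id M := ⟨𝟙 _, by simp⟩
  comp f g := ⟨f.hom ≫ g.hom, by
    rw [Functor.map_comp, Category.assoc, g.comm, ← Category.assoc, f.comm, Category.assoc,
      Functor.map_comp]⟩
  id_comp f := Hom.ext (Category.id_comp _)
  comp_id f := Hom.ext (Category.comp_id _)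
  assoc f g h := Hom.ext (Category.assoc _ _ _)

@[ext]
lemma hom_ext {M N : EquivariantObject K} {f g : M ⟶ N} (h : f.hom = g.hom) : f = g :=
  Hom.ext h

@[simp] lemma id_hom (M : EquivariantObject K) : Hom.hom (𝟙 M) = 𝟙 M.obj := rfl
@[simp] lemma comp_hom {M N L : EquivariantObject K} (f : M ⟶ N) (g : N ⟶ L) :
    (f ≫ g).hom = f.hom ≫ g.hom := rfl

section Additive

variable [Preadditive C] [Preadditive D] [K.A.Additive] [K.P.Additive]

section

variable (M N : EquivariantObject K)

instance : Zero (M ⟶ N) := ⟨⟨0, by simp⟩⟩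
instance : Add (M ⟶ N) := ⟨fun f g => ⟨f.hom + g.hom, by
  rw [Functor.map_add, Functor.map_add, Preadditive.add_comp, Preadditive.comp_add,
    f.comm, g.comm]⟩⟩
instance : Neg (M ⟶ N) := ⟨fun f => ⟨-f.hom, by
  rw [Functor.map_neg, Functor.map_neg, Preadditive.neg_comp, Preadditive.comp_neg, f.comm]⟩⟩
instance : Sub (M ⟶ N) := ⟨fun f g => ⟨f.hom - g.hom, by
  rw [Functor.map_sub, Functor.map_sub, Preadditive.sub_comp, Preadditive.comp_sub,
    f.comm, g.comm]⟩⟩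
instance : SMul ℕ (M ⟶ N) := ⟨fun n f => ⟨n • f.hom, by
  rw [Functor.map_nsmul, Functor.map_nsmul, Preadditive.nsmul_comp, Preadditive.comp_nsmul,
    f.comm]⟩⟩
instance : SMul ℤ (M ⟶ N) := ⟨fun n f => ⟨n • f.hom, by
  rw [Functor.map_zsmul, Functor.map_zsmul, Preadditive.zsmul_comp, Preadditive.comp_zsmul,
    f.comm]⟩⟩

instance : AddCommGroup (M ⟶ N) :=
  Function.Injective.addCommGroup (fun f : M ⟶ N => f.hom) (fun _ _ h => hom_ext h)
    rfl (fun _ _ => rfl) (fun _ => rfl) (fun _ _ => rfl) (fun _ _ => rfl) (fun _ _ => rfl)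

end

instance : Preadditive (EquivariantObject K) where
  add_comp _ _ _ _ _ _ := hom_ext (Preadditive.add_comp _ _ _ _ _ _)
  comp_add _ _ _ _ _ _ := hom_ext (Preadditive.comp_add _ _ _ _ _ _)

variable (K) in
/-- The functor forgetting the equivariant structure. -/
@[simps]
def forget : EquivariantObject K ⥤ C where
  obj M := M.obj
  map f := f.hom

instance : (forget K).Additive where

section Biproduct

/-- Two morphisms out of `A (⨁ f)`, with `A` additive, agree if they agree on summands. -/
lemma additive_biproduct_hom_ext {C D : Type*} [Category C] [Category D] [Preadditive C]
    [Preadditive D] (A : C ⥤ D) [A.Additive] {n : ℕ} (f : Fin n → C) [HasBiproduct f] {Z : D}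
    {u v : A.obj (⨁ f) ⟶ Z}
    (h : ∀ j, A.map (biproduct.ι f j) ≫ u = A.map (biproduct.ι f j) ≫ v) : u = v := by
  have e : (𝟙 (A.obj (⨁ f))) = ∑ j, A.map (biproduct.π f j) ≫ A.map (biproduct.ι f j) := by
    rw [← A.map_id, ← biproduct.total, Functor.map_sum]
    simp
  rw [← Category.id_comp u, ← Category.id_comp v, e, Preadditive.sum_comp, Preadditive.sum_comp]
  exact Finset.sum_congr rfl fun j _ => by rw [Category.assoc, Category.assoc, h]

/-- The restriction of a diagonal morphism to a summand. -/
lemma map_ι_sum {C D : Type*} [Category C] [Category D] [Preadditive C]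
    [Preadditive D] (A P : C ⥤ D) [A.Additive] {n : ℕ} (f : Fin n → C)
    [HasBiproduct f] (t : ∀ j, A.obj (f j) ⟶ P.obj (f j)) (j : Fin n) :
    A.map (biproduct.ι f j) ≫ (∑ i, A.map (biproduct.π f i) ≫ t i ≫ P.map (biproduct.ι f i)) =
      t j ≫ P.map (biproduct.ι f j) := by
  rw [Preadditive.comp_sum, Finset.sum_eq_single j]
  · rw [← Functor.map_comp_assoc, biproduct.ι_π_self, A.map_id, Category.id_comp]
  · intro i _ hij
    rw [← Functor.map_comp_assoc, biproduct.ι_π_ne _ hij.symm, A.map_zero, zero_comp]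
  · simp

variable [HasFiniteBiproducts C]
  {n : ℕ} (f : Fin n → EquivariantObject K)

/-- The direct sum of the isomorphisms `θ`. -/
def sumθ : K.A.obj (⨁ fun j => (f j).obj) ≅ K.P.obj (⨁ fun j => (f j).obj) where
  hom := ∑ j, K.A.map (biproduct.π (fun j => (f j).obj) j) ≫ (f j).θ.hom ≫
    K.P.map (biproduct.ι (fun j => (f j).obj) j)
  inv := ∑ j, K.P.map (biproduct.π (fun j => (f j).obj) j) ≫ (f j).θ.inv ≫
    K.A.map (biproduct.ι (fun j => (f j).obj) j)
  hom_inv_id := by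
    apply additive_biproduct_hom_ext
    intro j
    rw [← Category.assoc, map_ι_sum K.A K.P (fun j => (f j).obj) (fun j => (f j).θ.hom),
      Category.assoc, map_ι_sum K.P K.A (fun j => (f j).obj) (fun j => (f j).θ.inv)]
    simp
  inv_hom_id := by
    apply additive_biproduct_hom_ext
    intro j
    rw [← Category.assoc, map_ι_sum K.P K.A (fun j => (f j).obj) (fun j => (f j).θ.inv),
      Category.assoc, map_ι_sum K.A K.P (fun j => (f j).obj) (fun j => (f j).θ.hom)]
    simp

lemma map_ι_sumθ (j : Fin n) :
    K.A.map (biproduct.ι (fun j => (f j).obj) j) ≫ (sumθ f).hom =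
      (f j).θ.hom ≫ K.P.map (biproduct.ι (fun j => (f j).obj) j) :=
  map_ι_sum K.A K.P (fun j => (f j).obj) (fun j => (f j).θ.hom) j

lemma map_ι_sumθ_assoc (j : Fin n) {Z : D} (h : K.P.obj (⨁ fun j => (f j).obj) ⟶ Z) :
    K.A.map (biproduct.ι (fun j => (f j).obj) j) ≫ (sumθ f).hom ≫ h =
      (f j).θ.hom ≫ K.P.map (biproduct.ι (fun j => (f j).obj) j) ≫ h := by
  rw [← Category.assoc, map_ι_sumθ, Category.assoc]

lemma sumθ_map_π (j : Fin n) :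
    K.A.map (biproduct.π (fun j => (f j).obj) j) ≫ (f j).θ.hom =
      (sumθ f).hom ≫ K.P.map (biproduct.π (fun j => (f j).obj) j) := by
  apply additive_biproduct_hom_ext K.A (fun j => (f j).obj)
  intro i
  rw [← Functor.map_comp_assoc, map_ι_sumθ_assoc, ← Functor.map_comp]
  by_cases h : i = j
  · subst h
    simp only [biproduct.ι_π_self, CategoryTheory.Functor.map_id, Category.id_comp, Category.comp_id]
  · rw [biproduct.ι_π_ne (fun j => (f j).obj) h, Functor.map_zero, Functor.map_zero, zero_comp,
      comp_zero]

variable [Preadditive E] [K.Q₁.Additive]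

/-- The direct sum of equivariant objects. -/
@[simps]
def directSum : EquivariantObject K where
  obj := ⨁ fun j => (f j).obj
  θ := sumθ f
  cocycle := by
    apply additive_biproduct_hom_ext (K.A ⋙ K.Q₁)
    intro j
    have h₁ := K.s₁₂.hom.naturality (biproduct.ι (fun j => (f j).obj) j)
    have h₂ := K.s₂₃.hom.naturality (biproduct.ι (fun j => (f j).obj) j)
    have h₃ := K.s₃₁.hom.naturality (biproduct.ι (fun j => (f j).obj) j)
    dsimp only [Functor.comp_map] at h₁ h₂ h₃ ⊢
    rw [← Functor.map_comp, map_ι_sumθ, Functor.map_comp, (f j).cocycle,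
      reassoc_of% h₁, ← Functor.map_comp_assoc, map_ι_sumθ,
      Functor.map_comp_assoc, reassoc_of% h₂, ← Functor.map_comp_assoc,
      map_ι_sumθ, Functor.map_comp_assoc, h₃]
    simp only [Category.assoc]

/-- The direct sum with its inclusions and projections. -/
def bicone : Bicone f where
  pt := directSum f
  π j := ⟨biproduct.π (fun j => (f j).obj) j, sumθ_map_π f j⟩
  ι j := ⟨biproduct.ι (fun j => (f j).obj) j, map_ι_sumθ f j⟩
  ι_π i j := by
    ext1
    by_cases h : i = j
    · subst h
      rw [dif_pos rfl]
      exact biproduct.ι_π_self _ _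
    · rw [dif_neg h]
      exact biproduct.ι_π_ne _ h

instance : HasFiniteBiproducts (EquivariantObject K) where
  out n := ⟨fun f => by
    refine HasBiproduct.mk ⟨bicone f, isBilimitOfTotal _ ?_⟩
    ext1
    change (forget K).map _ = _
    rw [Functor.map_sum]
    exact biproduct.total (f := fun j => (f j).obj)⟩

end Biproduct
end Additive
end EquivariantObject

/-! ### Equivariant sheaves of modules -/

section Equivariant

variable (G : Over SpecC) [GrpObj G]

/-- The action morphism `G × Y ⟶ Y`. -/
abbrev act (Y : Over SpecC) [ModObj G Y] : G ⊗ Y ⟶ Y := ModObj.smul (M := G) (X := Y)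

/-- The canonical isomorphism `f^* g^* ≅ f'^* g'^*` when `g ∘ f = g' ∘ f'`. -/
def pullbackSquare {A B B' C : Over SpecC} (f : A ⟶ B) (g : B ⟶ C) (f' : A ⟶ B') (g' : B' ⟶ C)
    (h : f ≫ g = f' ≫ g') :
    Scheme.Modules.pullback g.left ⋙ Scheme.Modules.pullback f.left ≅
      Scheme.Modules.pullback g'.left ⋙ Scheme.Modules.pullback f'.left :=
  Scheme.Modules.pullbackComp f.left g.left ≪≫
    Scheme.Modules.pullbackCongr (by rw [← Over.comp_left, ← Over.comp_left, h]) ≪≫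
    (Scheme.Modules.pullbackComp f'.left g'.left).symm

/-- The morphism `μ × 1 : G × G × Y ⟶ G × Y`. -/
def mulMap (Y : Over SpecC) : G ⊗ (G ⊗ Y) ⟶ G ⊗ Y := (α_ G G Y).inv ≫ (MonObj.mul (X := G)) ▷ Y

/-- The functors `a^*`, `p^*` from `𝒪_Y`-modules to `𝒪_{G × Y}`-modules and
`(μ × 1)^*`, `(1 × a)^*`, `p₂₃^*` from `𝒪_{G × Y}`-modules to `𝒪_{G × G × Y}`-modules. -/
def actionDatum (Y : Over SpecC) [ModObj G Y] :
    CocycleDatum Y.left.Modules (G ⊗ Y).left.Modules (G ⊗ (G ⊗ Y)).left.Modules where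
  A := Scheme.Modules.pullback (act G Y).left
  P := Scheme.Modules.pullback (snd G Y).left
  Q₁ := Scheme.Modules.pullback (mulMap G Y).left
  Q₂ := Scheme.Modules.pullback (G ◁ act G Y).left
  Q₃ := Scheme.Modules.pullback (snd G (G ⊗ Y)).left
  s₁₂ := pullbackSquare _ _ _ _ (by simp [mulMap])
  s₂₃ := pullbackSquare _ _ _ _ (by simp)
  s₃₁ := pullbackSquare _ _ _ _ (by simp [mulMap])

instance (Y : Over SpecC) [ModObj G Y] : (actionDatum G Y).A.Additive :=
  inferInstanceAs (Scheme.Modules.pullback _).Additive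
instance (Y : Over SpecC) [ModObj G Y] : (actionDatum G Y).P.Additive :=
  inferInstanceAs (Scheme.Modules.pullback _).Additive
instance (Y : Over SpecC) [ModObj G Y] : (actionDatum G Y).Q₁.Additive :=
  inferInstanceAs (Scheme.Modules.pullback _).Additive

instance (Y : Scheme.{0}) : HasFiniteBiproducts Y.Modules := Abelian.hasFiniteBiproducts

/-- `G`-equivariant `𝒪_Y`-modules: `𝒪_Y`-modules `M` with an isomorphism
`θ : a^* M ≅ p^* M` on `G × Y`, where `a` is the action and `p` the projection,
satisfying the cocycle condition `(μ × 1)^* θ = p₂₃^* θ ∘ (1 × a)^* θ` on `G × G × Y`. -/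
abbrev EquivariantModule (Y : Over SpecC) [ModObj G Y] := EquivariantObject (actionDatum G Y)

end Equivariant

/-! ### Set partitions and index trees -/

/-- Set partitions of `[n]` (here `[n] = Fin n`), ordered by refinement: `𝔄 ≤ 𝔅` if `𝔄` is
finer than `𝔅`; the infimum `𝔄 ⊓ 𝔅` consists of the non-empty intersections of parts. -/
abbrev SetPartition (n : ℕ) := Finpartition (Finset.univ : Finset (Fin n))

/-- `a` and `b` lie in the same part of `𝔄`. -/
def SetPartition.Rel {n : ℕ} (𝔄 : SetPartition n) (a b : Fin n) : Prop :=
  ∃ A ∈ 𝔄.parts, a ∈ A ∧ b ∈ A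

/-- The image `σ(A)` of a subset of `[n]`. -/
abbrev permSet {n : ℕ} (σ : Equiv.Perm (Fin n)) (A : Finset (Fin n)) : Finset (Fin n) :=
  A.map σ.toEmbedding

lemma mem_permSet {n : ℕ} (σ : Equiv.Perm (Fin n)) (A : Finset (Fin n)) (a : Fin n) :
    a ∈ permSet σ A ↔ σ⁻¹ a ∈ A := by
  rw [Finset.mem_map_equiv]; rfl

lemma permSet_injective {n : ℕ} (σ : Equiv.Perm (Fin n)) : Function.Injective (permSet σ) :=
  Finset.map_injective _

/-- The image of a family of subsets of `[n]`. -/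
abbrev permFamily {n : ℕ} (σ : Equiv.Perm (Fin n)) (S : Finset (Finset (Fin n))) :
    Finset (Finset (Fin n)) :=
  S.image (permSet σ)

lemma permSet_mul {n : ℕ} (σ τ : Equiv.Perm (Fin n)) (A : Finset (Fin n)) :
    permSet (σ * τ) A = permSet σ (permSet τ A) := by
  ext a; simp only [mem_permSet, mul_inv_rev, Equiv.Perm.mul_apply]

/-- The action of the symmetric group on set partitions: `σ𝔄 = {σ(A) | A ∈ 𝔄}`. -/
def permPartition {n : ℕ} (σ : Equiv.Perm (Fin n)) (𝔄 : SetPartition n) : SetPartition n :=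
  Finpartition.ofExistsUnique (permFamily σ 𝔄.parts) (fun _ _ => Finset.subset_univ _)
    (fun a _ => by
      obtain ⟨A, ⟨hA, haA⟩, hu⟩ := 𝔄.existsUnique_mem (Finset.mem_univ (σ⁻¹ a))
      refine ⟨permSet σ A, ⟨Finset.mem_image_of_mem _ hA, (mem_permSet σ A a).2 haA⟩, ?_⟩
      rintro B ⟨hB, haB⟩
      obtain ⟨B', hB', rfl⟩ := Finset.mem_image.1 hB
      rw [hu B' ⟨hB', (mem_permSet σ B' a).1 haB⟩])
    (fun h => by
      obtain ⟨A, hA, h⟩ := Finset.mem_image.1 h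
      exact 𝔄.ne_empty hA (Finset.map_eq_empty.1 h))

lemma permPartition_mul {n : ℕ} (σ τ : Equiv.Perm (Fin n)) (𝔄 : SetPartition n) :
    permPartition (σ * τ) 𝔄 = permPartition σ (permPartition τ 𝔄) := by
  ext1
  simp only [permPartition, Finpartition.ofExistsUnique, permFamily, Finset.image_image]
  congr 1
  ext1 A
  exact permSet_mul σ τ A

lemma permPartition_mono {n : ℕ} (σ : Equiv.Perm (Fin n)) {𝔄 𝔅 : SetPartition n} (h : 𝔄 ≤ 𝔅) :
    permPartition σ 𝔄 ≤ permPartition σ 𝔅 := by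
  intro A hA
  obtain ⟨A', hA', rfl⟩ := Finset.mem_image.1 hA
  obtain ⟨B, hB, hAB⟩ := h hA'
  exact ⟨permSet σ B, Finset.mem_image_of_mem _ hB, Finset.map_subset_map.2 hAB⟩

/-- The binary total order on subsets of `[n]`: `A < B` iff `∑_{i ∈ A} 2^i < ∑_{i ∈ B} 2^i`. -/
def BinaryLT {n : ℕ} (A B : Finset (Fin n)) : Prop :=
  ∑ i ∈ A, 2 ^ (i : ℕ) < ∑ i ∈ B, 2 ^ (i : ℕ)

/-- An index tree of order `n`: a rooted tree in which every node is a leaf or has at least two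
children, with leaves labelled by the parts of a partition of `[n]`. A node `v` carries the label
`L_v`, the union of the labels of the leaves below it; distinct nodes have distinct labels and `w`
is a descendant of `v` iff `L_w ⊆ L_v`. So a node is identified with its label, and the tree is
encoded by its set of node labels. -/
@[ext]
structure IndexTree (n : ℕ) where
  /-- the set of nodes -/
  nodes : Finset (Finset (Fin n))
  /-- the root -/
  univ_mem : Finset.univ ∈ nodes
  empty_notMem : ∅ ∉ nodes
  laminar : ∀ A ∈ nodes, ∀ B ∈ nodes, Disjoint A B ∨ A ⊆ B ∨ B ⊆ A
  /-- a node is a leaf or the union of its strict descendants -/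
  minimal_or_union : ∀ A ∈ nodes, (∀ B ∈ nodes, ¬ B ⊂ A) ∨ ∀ a ∈ A, ∃ B ∈ nodes, B ⊂ A ∧ a ∈ B

namespace IndexTree

open Classical in
instance (n : ℕ) : Finite (IndexTree n) :=
  Finite.of_injective (fun T => T.nodes) fun _ _ h => IndexTree.ext h

variable {n : ℕ} (T : IndexTree n)

open Classical in
/-- The leaves `𝔄(T)`: the nodes without strict descendants. -/
def leaves : Finset (Finset (Fin n)) := {A ∈ T.nodes | ∀ B ∈ T.nodes, ¬ B ⊂ A}

/-- The non-leaf nodes `P(T)`. -/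
def inner : Finset (Finset (Fin n)) := T.nodes \ T.leaves

open Classical in
/-- The children of a node: the maximal strict descendants. -/
def children (A : Finset (Fin n)) : Finset (Finset (Fin n)) :=
  {B ∈ T.nodes | B ⊂ A ∧ ∀ C ∈ T.nodes, B ⊆ C → C ⊂ A → C = B}

/-- The non-leaf, non-root nodes, at which there is an ordinary contraction. -/
def ordinary : Finset (Finset (Fin n)) := T.inner.erase Finset.univ

open Classical in
/-- The exceptional nodes: the non-leaf nodes all of whose children are leaves. -/
def exceptional : Finset (Finset (Fin n)) := {A ∈ T.inner | T.children A ⊆ T.leaves}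

variable {T}

lemma mem_leaves {A : Finset (Fin n)} :
    A ∈ T.leaves ↔ A ∈ T.nodes ∧ ∀ B ∈ T.nodes, ¬ B ⊂ A := by simp [leaves]

lemma mem_inner {A : Finset (Fin n)} :
    A ∈ T.inner ↔ A ∈ T.nodes ∧ ∃ B ∈ T.nodes, B ⊂ A := by
  simp only [inner, Finset.mem_sdiff, mem_leaves]
  push Not
  constructor
  · rintro ⟨h, h'⟩; exact ⟨h, h' h⟩
  · rintro ⟨h, h'⟩; exact ⟨h, fun _ => h'⟩

lemma exists_mem_of_mem_inner {A : Finset (Fin n)} (hA : A ∈ T.inner) {a : Fin n} (ha : a ∈ A) :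
    ∃ B ∈ T.nodes, B ⊂ A ∧ a ∈ B := by
  obtain ⟨hA, B, hB, hBA⟩ := mem_inner.1 hA
  rcases T.minimal_or_union A hA with h | h
  · exact absurd hBA (h B hB)
  · exact h a ha

lemma exists_leaf {A : Finset (Fin n)} (hA : A ∈ T.nodes) {a : Fin n} (ha : a ∈ A) :
    ∃ B ∈ T.leaves, B ⊆ A ∧ a ∈ B := by
  induction A using Finset.strongInduction with
  | H A ih =>
    by_cases h : A ∈ T.leaves
    · exact ⟨A, h, subset_rfl, ha⟩
    · obtain ⟨B, hB, hBA, haB⟩ := exists_mem_of_mem_inner (T := T) (Finset.mem_sdiff.2 ⟨hA, h⟩) ha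
      obtain ⟨C, hC, hCB, haC⟩ := ih B hBA hB haB
      exact ⟨C, hC, hCB.trans hBA.subset, haC⟩

lemma exists_child {A B : Finset (Fin n)} (hB : B ∈ T.nodes) (hBA : B ⊂ A) :
    ∃ C ∈ T.children A, B ⊆ C := by
  classical
  obtain ⟨C, hBC, hC⟩ := (T.nodes.filter (· ⊂ A)).exists_le_maximal
    (a := B) (by simp [hB, hBA])
  have h := hC.prop
  simp only [Finset.mem_filter] at h
  refine ⟨C, ?_, hBC⟩
  simp only [children, Finset.mem_filter]
  refine ⟨h.1, h.2, fun D hD hCD hDA => ?_⟩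
  exact (hC.eq_of_le (by simp [hD, hDA]) hCD).symm

lemma mem_leaves_of_exceptional {A B : Finset (Fin n)} (hA : A ∈ T.exceptional)
    (hB : B ∈ T.nodes) (hBA : B ⊂ A) : B ∈ T.leaves := by
  obtain ⟨C, hC, hBC⟩ := exists_child hB hBA
  have hC' := (Finset.mem_filter.1 hA).2 hC
  rcases hBC.eq_or_ssubset with rfl | h
  · exact hC'
  · exact absurd h ((mem_leaves.1 hC').2 B hB)

variable (T)

/-- The set partition `𝔄(T)` given by the leaves of `T`. -/
def leafPartition : SetPartition n :=
  Finpartition.ofExistsUnique T.leaves (fun _ _ => Finset.subset_univ _)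
    (fun a _ => by
      obtain ⟨A, hA, -, haA⟩ := exists_leaf T.univ_mem (Finset.mem_univ a)
      refine ⟨A, ⟨hA, haA⟩, ?_⟩
      rintro B ⟨hB, haB⟩
      rw [mem_leaves] at hA hB
      rcases T.laminar A hA.1 B hB.1 with h | h | h
      · exact absurd haB (Finset.disjoint_left.1 h haA)
      · rcases h.eq_or_ssubset with h | h
        · exact h.symm
        · exact absurd h (hB.2 A hA.1)
      · rcases h.eq_or_ssubset with h | h
        · exact h
        · exact absurd h (hA.2 B hB.1))
    (fun h => T.empty_notMem (mem_leaves.1 h).1)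

/-- The ordinary contraction `O(T, v)`: the node `v` is deleted and its children are attached to
its parent. -/
def ordinaryContraction (A : Finset (Fin n)) (hA : A ∈ T.ordinary) : IndexTree n where
  nodes := T.nodes.erase A
  univ_mem := Finset.mem_erase.2 ⟨(Finset.mem_erase.1 hA).1.symm, T.univ_mem⟩
  empty_notMem h := T.empty_notMem (Finset.mem_of_mem_erase h)
  laminar B hB C hC := T.laminar B (Finset.mem_of_mem_erase hB) C (Finset.mem_of_mem_erase hC)
  minimal_or_union B hB := by
    rcases T.minimal_or_union B (Finset.mem_of_mem_erase hB) with h | h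
    · exact Or.inl fun C hC => h C (Finset.mem_of_mem_erase hC)
    · refine Or.inr fun b hb => ?_
      obtain ⟨C, hC, hCB, hbC⟩ := h b hb
      by_cases hCA : C = A
      · subst hCA
        obtain ⟨D, hD, hDC, hbD⟩ := exists_mem_of_mem_inner (Finset.mem_of_mem_erase hA) hbC
        exact ⟨D, Finset.mem_erase.2 ⟨hDC.ne, hD⟩, hDC.trans hCB, hbD⟩
      · exact ⟨C, Finset.mem_erase.2 ⟨hCA, hC⟩, hCB, hbC⟩

open Classical in
/-- The exceptional contraction `E(T, v)`: the children of the exceptional node `v` are deleted.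
(All strict descendants of an exceptional node are children of it.) -/
def exceptionalContraction (A : Finset (Fin n)) (hA : A ∈ T.exceptional) : IndexTree n where
  nodes := T.nodes \ T.children A
  univ_mem := Finset.mem_sdiff.2 ⟨T.univ_mem, fun h => by
    have := (Finset.mem_filter.1 h).2.1
    exact this.not_subset (Finset.subset_univ _)⟩
  empty_notMem h := T.empty_notMem (Finset.mem_sdiff.1 h).1
  laminar B hB C hC := T.laminar B (Finset.mem_sdiff.1 hB).1 C (Finset.mem_sdiff.1 hC).1
  minimal_or_union B hB := by
    have hA' := (mem_inner.1 (Finset.mem_filter.1 hA).1).1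
    rcases T.minimal_or_union B (Finset.mem_sdiff.1 hB).1 with h | h
    · exact Or.inl fun C hC => h C (Finset.mem_sdiff.1 hC).1
    · by_cases hBA : B = A
      · subst hBA
        refine Or.inl fun C hC hCB => (Finset.mem_sdiff.1 hC).2 ?_
        obtain ⟨D, hD, hCD⟩ := exists_child (Finset.mem_sdiff.1 hC).1 hCB
        have hDl := (Finset.mem_filter.1 hA).2 hD
        rcases hCD.eq_or_ssubset with rfl | h
        · exact hD
        · exact absurd h ((mem_leaves.1 hDl).2 C (Finset.mem_sdiff.1 hC).1)
      · refine Or.inr fun b hb => ?_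
        obtain ⟨C, hC, hCB, hbC⟩ := h b hb
        by_cases hCA : C ∈ T.children A
        · have hCA' := (Finset.mem_filter.1 hCA).2.1
          have hAB : A ⊂ B := by
            rcases T.laminar A hA' B (Finset.mem_sdiff.1 hB).1 with h | h | h
            · exact absurd (hCB.subset hbC) (Finset.disjoint_left.1 h (hCA'.subset hbC))
            · exact h.ssubset_of_ne (Ne.symm hBA)
            · have hBA' := h.ssubset_of_ne hBA
              have hBl := mem_leaves_of_exceptional hA (Finset.mem_sdiff.1 hB).1 hBA'
              exact absurd hCB ((mem_leaves.1 hBl).2 C hC)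
          refine ⟨A, Finset.mem_sdiff.2 ⟨hA', fun h => ?_⟩, hAB, hCA'.subset hbC⟩
          exact (Finset.mem_filter.1 h).2.1.ne rfl
        · exact ⟨C, Finset.mem_sdiff.2 ⟨hC, hCA⟩, hCB, hbC⟩

variable {T}

lemma leaves_ordinaryContraction {A : Finset (Fin n)} (hA : A ∈ T.ordinary) :
    (T.ordinaryContraction A hA).leaves = T.leaves := by
  have hA' := Finset.mem_of_mem_erase hA
  ext B
  rw [mem_leaves, mem_leaves]
  simp only [ordinaryContraction, Finset.mem_erase]
  constructor
  · rintro ⟨⟨hBA, hB⟩, h⟩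
    refine ⟨hB, fun C hC hCB => ?_⟩
    by_cases hCA : C = A
    · subst hCA
      obtain ⟨-, D, hD, hDC⟩ := mem_inner.1 hA'
      exact h D ⟨hDC.ne, hD⟩ (hDC.trans hCB)
    · exact h C ⟨hCA, hC⟩ hCB
  · rintro ⟨hB, h⟩
    refine ⟨⟨?_, hB⟩, fun C hC => h C hC.2⟩
    rintro rfl
    obtain ⟨-, D, hD, hDC⟩ := mem_inner.1 hA'
    exact h D hD hDC

lemma leafPartition_ordinaryContraction {A : Finset (Fin n)} (hA : A ∈ T.ordinary) :
    T.leafPartition = (T.ordinaryContraction A hA).leafPartition := by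
  ext1
  exact (leaves_ordinaryContraction hA).symm

lemma inner_ordinaryContraction {A : Finset (Fin n)} (hA : A ∈ T.ordinary) :
    (T.ordinaryContraction A hA).inner = T.inner.erase A := by
  rw [inner, leaves_ordinaryContraction, inner]
  exact Finset.erase_sdiff_comm _ _ _

lemma card_ordinaryContraction {k : ℕ} (hT : T.inner.card = k + 1) {A : Finset (Fin n)}
    (hA : A ∈ T.ordinary) : (T.ordinaryContraction A hA).inner.card = k := by
  rw [inner_ordinaryContraction, Finset.card_erase_of_mem (Finset.mem_of_mem_erase hA), hT]
  rfl

lemma inner_exceptionalContraction {A : Finset (Fin n)} (hA : A ∈ T.exceptional) :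
    (T.exceptionalContraction A hA).inner = T.inner.erase A := by
  have hA' := (mem_inner.1 (Finset.mem_filter.1 hA).1).1
  ext B
  rw [Finset.mem_erase, mem_inner, mem_inner]
  simp only [exceptionalContraction, Finset.mem_sdiff]
  constructor
  · rintro ⟨⟨hB, hBA⟩, C, ⟨hC, hCA⟩, hCB⟩
    refine ⟨?_, hB, C, hC, hCB⟩
    rintro rfl
    obtain ⟨D, hD, hCD⟩ := exists_child hC hCB
    rcases hCD.eq_or_ssubset with rfl | h
    · exact hCA hD
    · exact (mem_leaves.1 ((Finset.mem_filter.1 hA).2 hD)).2 C hC h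
  · rintro ⟨hne, hB, C, hC, hCB⟩
    have hBn : B ∉ T.children A := fun h =>
      (mem_leaves.1 ((Finset.mem_filter.1 hA).2 h)).2 C hC hCB
    refine ⟨⟨hB, hBn⟩, ?_⟩
    by_cases hCA : C ∈ T.children A
    · have hCA' := (Finset.mem_filter.1 hCA).2.1
      refine ⟨A, ⟨hA', fun h => (Finset.mem_filter.1 h).2.1.ne rfl⟩, ?_⟩
      have hCne : C.Nonempty := Finset.nonempty_iff_ne_empty.2 fun h => T.empty_notMem (h ▸ hC)
      obtain ⟨c, hc⟩ := hCne
      rcases T.laminar A hA' B hB with h | h | h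
      · exact absurd (hCB.subset hc) (Finset.disjoint_left.1 h (hCA'.subset hc))
      · exact h.ssubset_of_ne (Ne.symm hne)
      · have hBl := mem_leaves_of_exceptional hA hB (h.ssubset_of_ne hne)
        exact absurd hCB ((mem_leaves.1 hBl).2 C hC)
    · exact ⟨C, ⟨hC, hCA⟩, hCB⟩

lemma card_exceptionalContraction {k : ℕ} (hT : T.inner.card = k + 1) {A : Finset (Fin n)}
    (hA : A ∈ T.exceptional) : (T.exceptionalContraction A hA).inner.card = k := by
  rw [inner_exceptionalContraction, Finset.card_erase_of_mem (Finset.mem_filter.1 hA).1, hT]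
  rfl

lemma leafPartition_le_exceptionalContraction {A : Finset (Fin n)} (hA : A ∈ T.exceptional) :
    T.leafPartition ≤ (T.exceptionalContraction A hA).leafPartition := by
  intro B hB
  change B ∈ T.leaves at hB
  have hne : B.Nonempty := Finset.nonempty_iff_ne_empty.2 fun h =>
    T.empty_notMem (h ▸ (mem_leaves.1 hB).1)
  obtain ⟨b, hb⟩ := hne
  obtain ⟨C, hC, -, hbC⟩ := exists_leaf (T.exceptionalContraction A hA).univ_mem
    (Finset.mem_univ b)
  refine ⟨C, hC, ?_⟩
  have hCT : C ∈ T.nodes := (Finset.mem_sdiff.1 (mem_leaves.1 hC).1).1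
  rcases T.laminar B (mem_leaves.1 hB).1 C hCT with h | h | h
  · exact absurd hbC (Finset.disjoint_left.1 h hb)
  · exact h
  · rcases h.eq_or_ssubset with rfl | h
    · exact le_rfl
    · exact absurd h ((mem_leaves.1 hB).2 C hCT)

/-- The action of the symmetric group on index trees: every label `L_v` is replaced by
`σ(L_v)`. -/
def perm (σ : Equiv.Perm (Fin n)) (T : IndexTree n) : IndexTree n where
  nodes := permFamily σ T.nodes
  univ_mem := Finset.mem_image.2 ⟨_, T.univ_mem, Finset.map_univ_equiv σ⟩
  empty_notMem h := by
    obtain ⟨A, hA, h⟩ := Finset.mem_image.1 h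
    rw [Finset.map_eq_empty] at h
    exact T.empty_notMem (h ▸ hA)
  laminar A hA B hB := by
    obtain ⟨A', hA', rfl⟩ := Finset.mem_image.1 hA
    obtain ⟨B', hB', rfl⟩ := Finset.mem_image.1 hB
    rw [Finset.disjoint_map, Finset.map_subset_map, Finset.map_subset_map]
    exact T.laminar A' hA' B' hB'
  minimal_or_union A hA := by
    obtain ⟨A', hA', rfl⟩ := Finset.mem_image.1 hA
    refine (T.minimal_or_union A' hA').imp (fun h B hB => ?_) fun h a ha => ?_
    · obtain ⟨B', hB', rfl⟩ := Finset.mem_image.1 hB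
      rw [Finset.map_ssubset_map]
      exact h B' hB'
    · obtain ⟨B, hB, hBA, hb⟩ := h _ ((mem_permSet σ A' a).1 ha)
      exact ⟨permSet σ B, Finset.mem_image_of_mem _ hB, Finset.map_ssubset_map.2 hBA,
        (mem_permSet σ B a).2 hb⟩

lemma leaves_perm (σ : Equiv.Perm (Fin n)) (T : IndexTree n) :
    (T.perm σ).leaves = permFamily σ T.leaves := by
  ext A
  simp only [mem_leaves, perm, permFamily, Finset.mem_image]
  constructor
  · rintro ⟨⟨A, hA, rfl⟩, h⟩
    exact ⟨A, ⟨hA, fun B hB hBA => h _ ⟨B, hB, rfl⟩ (Finset.map_ssubset_map.2 hBA)⟩, rfl⟩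
  · rintro ⟨A, ⟨hA, h⟩, rfl⟩
    refine ⟨⟨A, hA, rfl⟩, ?_⟩
    rintro _ ⟨B, hB, rfl⟩ hBA
    exact h B hB (Finset.map_ssubset_map.1 hBA)

lemma leafPartition_perm (σ : Equiv.Perm (Fin n)) (T : IndexTree n) :
    permPartition σ T.leafPartition = (T.perm σ).leafPartition := by
  ext1
  exact (leaves_perm σ T).symm

lemma inner_perm (σ : Equiv.Perm (Fin n)) (T : IndexTree n) :
    (T.perm σ).inner = permFamily σ T.inner := by
  rw [inner, leaves_perm, inner]
  exact (Finset.image_sdiff _ _ (permSet_injective σ)).symm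

lemma card_inner_perm (σ : Equiv.Perm (Fin n)) {T : IndexTree n} {k : ℕ}
    (hT : T.inner.card = k) : (T.perm σ).inner.card = k := by
  rw [inner_perm, Finset.card_image_of_injective _ (permSet_injective σ), hT]

variable (T)

open Classical in
/-- The sign `s(v) = (-1)^l`, where `l` is the number of `L ∈ P(T)` with `L < L_v` in the binary
ordering. -/
def nodeSign (A : Finset (Fin n)) : ℤ :=
  (-1) ^ (T.inner.filter fun L => BinaryLT L A).card

open Classical in
/-- The sign `(-1)^l`, where `l` is the number of pairs `A < B` in `P(T)` with `σ(A) > σ(B)`. -/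
def permSign (σ : Equiv.Perm (Fin n)) : ℤ :=
  (-1) ^ ((T.inner ×ˢ T.inner).filter fun p =>
    BinaryLT p.1 p.2 ∧ BinaryLT (permSet σ p.2) (permSet σ p.1)).card

end IndexTree

/-- The set `𝒯_{n,k}` of index trees of order `n` with `k` non-leaf nodes. -/
abbrev IndexTreeOf (n k : ℕ) := {T : IndexTree n // T.inner.card = k}

/-! ### The power `X^n` and its stratification -/

/-- The power `X^n`. -/
abbrev power (X : Over SpecC) (n : ℕ) : Over SpecC := ∏ᶜ fun _ : Fin n => X

/-- The projection `x ↦ x_a`. -/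
abbrev coord (X : Over SpecC) {n : ℕ} (a : Fin n) : power X n ⟶ X := Pi.π (fun _ : Fin n => X) a

/-- The diagonal action of `G` on `X^n`. -/
instance (G X : Over SpecC) [GrpObj G] [ModObj G X] (n : ℕ) : ModObj G (power X n) where
  smul := Pi.lift fun a => (G ◁ coord X a) ≫ ModObj.smul (M := G) (X := X)
  one_smul := by
    refine Pi.hom_ext _ _ fun a => ?_
    have h : MonObj.one ▷ X ≫ ModObj.smul (M := G) (X := X) = (λ_ X).hom := ModObj.one_smul X
    change (MonObj.one ▷ power X n ≫ Pi.lift _) ≫ coord X a = (λ_ (power X n)).hom ≫ coord X a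
    rw [Category.assoc, Pi.lift_π, ← whisker_exchange_assoc, h, leftUnitor_naturality]
  mul_smul := by
    refine Pi.hom_ext _ _ fun a => ?_
    have h : MonObj.mul ▷ X ≫ ModObj.smul (M := G) (X := X) =
      (α_ G G X).hom ≫ G ◁ ModObj.smul (M := G) (X := X) ≫ ModObj.smul (M := G) (X := X) :=
      ModObj.mul_smul X
    change (MonObj.mul ▷ power X n ≫ Pi.lift _) ≫ coord X a =
      ((α_ G G (power X n)).hom ≫ (G ◁ Pi.lift _) ≫ Pi.lift _) ≫ coord X a
    simp only [Category.assoc, Pi.lift_π]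
    rw [← whisker_exchange_assoc, h, ← MonoidalCategory.whiskerLeft_comp_assoc, Pi.lift_π,
      MonoidalCategory.whiskerLeft_comp_assoc, tensor_whiskerLeft_assoc, Iso.inv_hom_id_assoc]

/-- The morphism `σ_X : X^n ⟶ X^n`, `(x_a)_a ↦ (x_{σ(a)})_a`. The left action of `σ ∈ S_n` on `X^n`
is `σ_X⁻¹`, so `σ_X` is the action of `σ⁻¹`. -/
def permMap (X : Over SpecC) {n : ℕ} (σ : Equiv.Perm (Fin n)) : power X n ⟶ power X n :=
  Pi.lift fun a => coord X (σ a)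

/-- The small diagonal of `X^n`, as a set of points: the image of `X ⟶ X^n`, `x ↦ (x, …, x)`. -/
def smallDiagonal (X : Over SpecC) (n : ℕ) : Set (power X n).left :=
  Set.range (Pi.lift fun _ : Fin n => 𝟙 X : X ⟶ power X n).left

/-- `x_a = x_b` for a point `x` of `X^n`: the residue field valued points `x_a` and `x_b` of `X`
coincide. -/
def Coincide (X : Over SpecC) {n : ℕ} (x : (power X n).left) (a b : Fin n) : Prop :=
  (power X n).left.fromSpecResidueField x ≫ (coord X a).left =
    (power X n).left.fromSpecResidueField x ≫ (coord X b).left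

lemma setOf_coincide (X : Over SpecC) {n : ℕ} (a b : Fin n) :
    {x : (power X n).left | Coincide X x a b} =
      Set.range (equalizer.ι (coord X a) (coord X b)).left := by
  ext x
  constructor
  · intro (h : _ ≫ _ = _ ≫ _)
    let p : Over.mk ((power X n).left.fromSpecResidueField x ≫ (power X n).hom) ⟶ power X n :=
      Over.homMk ((power X n).left.fromSpecResidueField x)
    let q := equalizer.lift (f := coord X a) (g := coord X b) p (by ext1; exact h)
    obtain ⟨y⟩ : Nonempty (Spec ((power X n).left.residueField x)) := inferInstance
    refine ⟨q.left y, ?_⟩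
    have h1 : q.left ≫ (equalizer.ι (coord X a) (coord X b)).left =
        (power X n).left.fromSpecResidueField x := by
      rw [← Over.comp_left, equalizer.lift_ι]; rfl
    rw [← Scheme.Hom.comp_apply, h1]
    have : (power X n).left.fromSpecResidueField x y ∈
      Set.range ((power X n).left.fromSpecResidueField x) := ⟨y, rfl⟩
    rw [Scheme.range_fromSpecResidueField] at this
    exact this
  · rintro ⟨y, rfl⟩
    have e := congrArg (fun f => f.left)
      (equalizer.condition (coord X a) (coord X b))
    simp only [Over.comp_left] at e
    set f := (equalizer.ι (coord X a) (coord X b)).left with hf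
    have hepi : Epi (Spec.map (f.residueFieldMap y)) := by
      have : Surjective (Spec.map (f.residueFieldMap y)) := ⟨fun z => by
        obtain ⟨w⟩ : Nonempty (Spec ((equalizer (coord X a) (coord X b)).left.residueField y)) :=
          inferInstance
        exact ⟨w, Subsingleton.elim _ _⟩⟩
      exact Flat.epi_of_flat_of_surjective _
    rw [Set.mem_ofPred_eq, Coincide, ← cancel_epi (Spec.map (f.residueFieldMap y)),
      Scheme.Hom.SpecMap_residueFieldMap_fromSpecResidueField_assoc,
      Scheme.Hom.SpecMap_residueFieldMap_fromSpecResidueField_assoc, e]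

lemma isClosed_setOf_coincide (X : Over SpecC) [IsSeparated X.hom] {n : ℕ} (a b : Fin n) :
    IsClosed {x : (power X n).left | Coincide X x a b} := by
  rw [setOf_coincide]
  exact (equalizer.ι (coord X a) (coord X b)).left.isClosedEmbedding.isClosed_range

/-- The stratum `(X^n)_𝔄`: the points with `x_a = x_b` iff `a` and `b` lie in the same part. -/
def stratum (X : Over SpecC) {n : ℕ} (𝔄 : SetPartition n) : Set (power X n).left :=
  {x | ∀ a b, Coincide X x a b ↔ 𝔄.Rel a b}

/-- `U_𝔄`, the union of the strata `(X^n)_𝔅` with `𝔅 ≤ 𝔄`. -/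
def openStratum (X : Over SpecC) {n : ℕ} (𝔄 : SetPartition n) : Set (power X n).left :=
  ⋃ 𝔅 ≤ 𝔄, stratum X 𝔅

lemma isOpen_openStratum (X : Over SpecC) [IsSeparated X.hom] {n : ℕ} (𝔄 : SetPartition n) :
    IsOpen (openStratum X 𝔄) := by
  classical
  have key : openStratum X 𝔄 =
      ⋂ (a : Fin n) (b : Fin n) (_ : ¬ 𝔄.Rel a b), {x | Coincide X x a b}ᶜ := by
    ext x
    simp only [openStratum, Set.mem_iUnion, Set.mem_iInter, Set.mem_compl_iff, Set.mem_ofPred_eq]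
    constructor
    · rintro ⟨𝔅, h𝔅, hx⟩ a b hab hc
      obtain ⟨B, hB, ha, hb⟩ := (hx a b).1 hc
      obtain ⟨A, hA, hBA⟩ := h𝔅 hB
      exact hab ⟨A, hA, hBA ha, hBA hb⟩
    · intro h
      let s : Setoid (Fin n) := ⟨Coincide X x, fun _ => rfl, fun h => h.symm, fun h h' => h.trans h'⟩
      have hs : ∀ a b, Coincide X x a b ↔ SetPartition.Rel (Finpartition.ofSetoid s) a b := by
        intro a b
        have h := Finpartition.mem_part_iff_exists (Finpartition.ofSetoid s) (a := a) (b := b)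
        rw [Finpartition.mem_part_ofSetoid_iff_rel] at h
        rw [SetPartition.Rel, ← h]
        exact ⟨fun h => h.symm, fun h => h.symm⟩
      refine ⟨Finpartition.ofSetoid s, ?_, hs⟩
      intro B hB
      obtain ⟨b, hb⟩ := Finpartition.nonempty_of_mem_parts _ hB
      obtain ⟨A, hA, hbA⟩ := 𝔄.exists_mem (Finset.mem_univ b)
      refine ⟨A, hA, fun a ha => ?_⟩
      have : 𝔄.Rel b a := by
        by_contra hn
        exact h b a hn ((hs b a).2 ⟨B, hB, hb, ha⟩)
      obtain ⟨A', hA', hb', ha'⟩ := this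
      rwa [𝔄.eq_of_mem_parts hA hA' hbA hb']
  rw [key]
  exact isOpen_iInter_of_finite fun a => isOpen_iInter_of_finite fun b =>
    isOpen_iInter_of_finite fun _ => (isClosed_setOf_coincide X a b).isOpen_compl

/-- The open set `U_{𝔅,ℭ}`, the union of the `U_𝔄` over all `𝔄` with `𝔅 ∼_𝔄 ℭ`,
i.e. `𝔅 ∩ 𝔄 = ℭ ∩ 𝔄`. -/
def isoLocus (X : Over SpecC) [IsSeparated X.hom] {n : ℕ} (𝔅 ℭ : SetPartition n) :
    (power X n).left.Opens :=
  ⟨⋃ (𝔄 : SetPartition n) (_ : 𝔅 ⊓ 𝔄 = ℭ ⊓ 𝔄), openStratum X 𝔄,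
    isOpen_iUnion fun 𝔄 => isOpen_iUnion fun _ => isOpen_openStratum X 𝔄⟩

/-! ### Strict systems of sheaves on `X^n` -/

section Systems

variable (G : Over SpecC) [GrpObj G]

/-- A sheaf of modules on a (locally Noetherian) scheme is coherent if it is locally of finite
presentation. -/
def IsCoherent {Y : Scheme.{0}} (M : Y.Modules) : Prop :=
  SheafOfModules.IsFinitePresentation (R := Y.ringCatSheaf) M

/-- `G`-equivariant, `ℤ/2`-graded sheaves of modules. -/
abbrev GradedModule (Y : Over SpecC) [ModObj G Y] := GradedObject (ZMod 2) (EquivariantModule G Y)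

/-- For a `G`-equivariant morphism `f : Y ⟶ Z`, a morphism `ρ : f^* M ⟶ N` is `G`-equivariant if
it commutes with the equivariant structures of `f^* M` and `N`. -/
def IsEquivariantAlong {Y Z : Over SpecC} [ModObj G Y] [ModObj G Z] (f : Y ⟶ Z)
    (hf : act G Y ≫ f = G ◁ f ≫ act G Z) {M : EquivariantModule G Z} {N : EquivariantModule G Y}
    (ρ : (Scheme.Modules.pullback f.left).obj M.obj ⟶ N.obj) : Prop :=
  (Scheme.Modules.pullback (act G Y).left).map ρ ≫ N.θ.hom =
    (pullbackSquare (act G Y) f (G ◁ f) (act G Z) hf).hom.app M.obj ≫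
      (Scheme.Modules.pullback (G ◁ f).left).map M.θ.hom ≫
      (pullbackSquare (G ◁ f) (snd G Z) (snd G Y) f (by simp)).hom.app M.obj ≫
      (Scheme.Modules.pullback (snd G Y).left).map ρ

lemma act_permMap (X : Over SpecC) [ModObj G X] {n : ℕ} (σ : Equiv.Perm (Fin n)) :
    act G (power X n) ≫ permMap X σ = G ◁ permMap X σ ≫ act G (power X n) := by
  refine Pi.hom_ext _ _ fun a => ?_
  change (Pi.lift _ ≫ Pi.lift _) ≫ coord X a = (G ◁ Pi.lift _ ≫ Pi.lift _) ≫ coord X a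
  simp only [Category.assoc, Pi.lift_π]
  rw [← MonoidalCategory.whiskerLeft_comp_assoc, Pi.lift_π]

lemma permMap_mul (X : Over SpecC) {n : ℕ} (σ τ : Equiv.Perm (Fin n)) :
    permMap X (σ * τ) = permMap X σ ≫ permMap X τ := by
  refine Pi.hom_ext _ _ fun a => ?_
  simp [permMap]

variable (X : Over SpecC) [ModObj G X] [IsSeparated X.hom]

/-- A strict system of (coherent, `G`-equivariant, `ℤ/2`-graded) sheaves on `X^n`: sheaves `F_𝔄`
indexed by the set partitions of `[n]`, with homomorphisms `φ_{𝔄,𝔅} : F_𝔄 ⟶ F_𝔅` for `𝔄 ≤ 𝔅`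
which are functorial and restrict to isomorphisms on `U_{𝔄,𝔅}`. -/
structure StrictSystem (n : ℕ) where
  /-- the sheaves `F_𝔄` and the homomorphisms `φ_{𝔄,𝔅}` -/
  F : SetPartition n ⥤ GradedModule G (power X n)
  coherent (𝔄 : SetPartition n) (i : ZMod 2) : IsCoherent (F.obj 𝔄 i).obj
  isIso_restrict {𝔄 𝔅 : SetPartition n} (h : 𝔄 ⟶ 𝔅) (i : ZMod 2) :
    IsIso ((Scheme.Modules.restrictFunctor (isoLocus X 𝔄 𝔅).ι).map (F.map h i).hom)

/-- An `S_n`-equivariant strict system: a strict system with `G`-equivariant isomorphisms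
`ρ_{σ,σ𝔄} : (σ⁻¹)^* F_𝔄 ⟶ F_{σ𝔄}`, where `σ⁻¹` acts on `X^n` by `permMap X σ`, that are compatible
with the homomorphisms `φ` and with products of permutations. -/
structure EquivariantStrictSystem (n : ℕ) extends StrictSystem G X n where
  /-- the isomorphism `ρ_{σ,σ𝔄}`, in each degree -/
  ρ (σ : Equiv.Perm (Fin n)) (𝔄 : SetPartition n) (i : ZMod 2) :
    (Scheme.Modules.pullback (permMap X σ).left).obj (F.obj 𝔄 i).obj ≅
      (F.obj (permPartition σ 𝔄) i).obj
  ρ_equivariant (σ : Equiv.Perm (Fin n)) (𝔄 : SetPartition n) (i : ZMod 2) :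
    IsEquivariantAlong G (permMap X σ) (act_permMap G X σ) (ρ σ 𝔄 i).hom
  ρ_naturality (σ : Equiv.Perm (Fin n)) {𝔄 𝔅 : SetPartition n} (h : 𝔄 ≤ 𝔅) (i : ZMod 2) :
    (ρ σ 𝔄 i).hom ≫ (F.map (homOfLE (permPartition_mono σ h)) i).hom =
      (Scheme.Modules.pullback (permMap X σ).left).map (F.map (homOfLE h) i).hom ≫
        (ρ σ 𝔅 i).hom
  ρ_mul (σ τ : Equiv.Perm (Fin n)) (𝔄 : SetPartition n) (i : ZMod 2) :
    (ρ (σ * τ) 𝔄 i).hom ≫ (F.map (eqToHom (permPartition_mul σ τ 𝔄)) i).hom =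
      (Scheme.Modules.pullbackCongr
        (show (permMap X (σ * τ)).left = (permMap X σ).left ≫ (permMap X τ).left by
          rw [permMap_mul, Over.comp_left])).hom.app (F.obj 𝔄 i).obj ≫
      (Scheme.Modules.pullbackComp (permMap X σ).left (permMap X τ).left).inv.app
        (F.obj 𝔄 i).obj ≫
      (Scheme.Modules.pullback (permMap X σ).left).map (ρ τ 𝔄 i).hom ≫
      (ρ σ (permPartition τ 𝔄) i).hom

end Systems

/-! ### The complex `G_n` -/

instance (n k : ℕ) : Fintype (IndexTreeOf n k) := Fintype.ofFinite _

namespace EquivariantStrictSystem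

variable {G : Over SpecC} [GrpObj G] {X : Over SpecC} [ModObj G X] [IsSeparated X.hom] {n : ℕ}
  (S : EquivariantStrictSystem G X n)

/-- The sheaf `F_T = F_{𝔄(T)}`. -/
abbrev treeSheaf (T : IndexTree n) (i : ZMod 2) : EquivariantModule G (power X n) :=
  S.F.obj T.leafPartition i

/-- The ordinary contraction homomorphism `o(T, v) = s(v) id : F_T ⟶ F_{O(T, v)}`. -/
def ordinaryHom (T : IndexTree n) {A : Finset (Fin n)} (hA : A ∈ T.ordinary) (i : ZMod 2) :
    S.treeSheaf T i ⟶ S.treeSheaf (T.ordinaryContraction A hA) i :=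
  T.nodeSign A • eqToHom (by rw [treeSheaf, treeSheaf, IndexTree.leafPartition_ordinaryContraction])

/-- The exceptional contraction homomorphism
`e(T, v) = -s(v) φ_{𝔄(T), 𝔄(E(T, v))} : F_T ⟶ F_{E(T, v)}`. -/
def exceptionalHom (T : IndexTree n) {A : Finset (Fin n)} (hA : A ∈ T.exceptional) (i : ZMod 2) :
    S.treeSheaf T i ⟶ S.treeSheaf (T.exceptionalContraction A hA) i :=
  (-T.nodeSign A) •
    S.F.map (homOfLE (IndexTree.leafPartition_le_exceptionalContraction hA)) i

/-- The sheaf `G_{n,k}`, the direct sum of `F_T` over all index trees `T` with `k` non-leaf nodes. -/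
def Gnk (k : ℕ) (i : ZMod 2) : EquivariantModule G (power X n) :=
  ⨁ fun T : IndexTreeOf n k => S.treeSheaf T.1 i

/-- The inclusion of `F_T` in `G_{n,k}`. -/
def ιTree {k : ℕ} (T : IndexTreeOf n k) (i : ZMod 2) : S.treeSheaf T.1 i ⟶ S.Gnk k i :=
  biproduct.ι (fun T : IndexTreeOf n k => S.treeSheaf T.1 i) T

/-- The projection of `G_{n,k}` to `F_T`. -/
def πTree {k : ℕ} (T : IndexTreeOf n k) (i : ZMod 2) : S.Gnk k i ⟶ S.treeSheaf T.1 i :=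
  biproduct.π (fun T : IndexTreeOf n k => S.treeSheaf T.1 i) T

/-- The homomorphism `d_{n,k+1} : G_{n,k+1} ⟶ G_{n,k}`: the sum over all `T ∈ 𝒯_{n,k+1}` of all
ordinary and exceptional contraction homomorphisms out of `F_T`. -/
def dnk (k : ℕ) (i : ZMod 2) : S.Gnk (k + 1) i ⟶ S.Gnk k i :=
  ∑ T : IndexTreeOf n (k + 1), S.πTree T i ≫
    (∑ A : T.1.ordinary, S.ordinaryHom T.1 A.2 i ≫
        S.ιTree ⟨_, IndexTree.card_ordinaryContraction T.2 A.2⟩ i +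
      ∑ A : T.1.exceptional, S.exceptionalHom T.1 A.2 i ≫
        S.ιTree ⟨_, IndexTree.card_exceptionalContraction T.2 A.2⟩ i)

/-- The degree `i` part of the `ℤ/2`-graded sheaf `G_n = ⨁_{k=0}^{n-1} G_{n,k}[k]`, where
`(E[k])_i = E_{i+k}`. -/
def Gn (i : ZMod 2) : EquivariantModule G (power X n) :=
  ⨁ fun k : Fin n => S.Gnk k (i + (k : ℕ))

/-- The inclusion of `G_{n,k}[k]` in `G_n`. -/
def ιDeg (k : Fin n) (i : ZMod 2) : S.Gnk k (i + (k : ℕ)) ⟶ S.Gn i :=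
  biproduct.ι (fun k : Fin n => S.Gnk k (i + (k : ℕ))) k

/-- The projection of `G_n` to `G_{n,k}[k]`. -/
def πDeg (k : Fin n) (i : ZMod 2) : S.Gn i ⟶ S.Gnk k (i + (k : ℕ)) :=
  biproduct.π (fun k : Fin n => S.Gnk k (i + (k : ℕ))) k

/-- The differential `d_n = ∑_{k=1}^{n-1} d_{n,k} : G_n ⟶ G_n[1]`, in degree `i`. (The summand is
`d_{n,k+1}`, with source `G_{n,k+1}[k+1]` and target `G_{n,k}[k][1]`.) -/
def dn (i : ZMod 2) : S.Gn i ⟶ S.Gn (i + 1) :=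
  ∑ k : Fin (n - 1),
    S.πDeg ⟨k + 1, by omega⟩ i ≫ S.dnk k (i + ((k : ℕ) + 1 : ℕ)) ≫
      eqToHom (congrArg (S.Gnk k) (by push_cast; ring)) ≫ S.ιDeg ⟨k, by omega⟩ (i + 1)

/-- The isomorphism `ρ : (σ⁻¹)^* F_T ⟶ F_{σT}`, twisted by the sign of `σ : P(T) → P(σT)`. -/
def ρTree (σ : Equiv.Perm (Fin n)) (T : IndexTree n) (i : ZMod 2) :
    (Scheme.Modules.pullback (permMap X σ).left).obj (S.treeSheaf T i).obj ⟶
      (S.treeSheaf (T.perm σ) i).obj :=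
  T.permSign σ • ((S.ρ σ T.leafPartition i).hom ≫
    eqToHom (by rw [treeSheaf, IndexTree.leafPartition_perm]))

/-- The `S_n`-equivariant structure `(σ⁻¹)^* G_{n,k} ⟶ G_{n,k}`, the sum of the maps `ρTree`. -/
def ρnk (σ : Equiv.Perm (Fin n)) (k : ℕ) (i : ZMod 2) :
    (Scheme.Modules.pullback (permMap X σ).left).obj (S.Gnk k i).obj ⟶ (S.Gnk k i).obj :=
  ∑ T : IndexTreeOf n k, (Scheme.Modules.pullback (permMap X σ).left).map (S.πTree T i).hom ≫
    S.ρTree σ T.1 i ≫ (S.ιTree ⟨T.1.perm σ, IndexTree.card_inner_perm σ T.2⟩ i).hom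

/-- The `S_n`-equivariant structure `(σ⁻¹)^* G_n ⟶ G_n`. -/
def ρn (σ : Equiv.Perm (Fin n)) (i : ZMod 2) :
    (Scheme.Modules.pullback (permMap X σ).left).obj (S.Gn i).obj ⟶ (S.Gn i).obj :=
  ∑ k : Fin n, (Scheme.Modules.pullback (permMap X σ).left).map (S.πDeg k i).hom ≫
    S.ρnk σ k (i + (k : ℕ)) ≫ (S.ιDeg k i).hom

/-- The cohomology sheaf `H^*(G_n) = ker d_n / im d_n` at `G_n i ⟶ G_n (i + 1) ⟶ G_n (i + 2)`, given
that `d_n` squares to zero. -/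
def cohomology (h : ∀ i, S.dn i ≫ S.dn (i + 1) = 0) (i : ZMod 2) : (power X n).left.Modules :=
  (ShortComplex.mk (S.dn i).hom (S.dn (i + 1)).hom
    (congrArg EquivariantObject.Hom.hom (h i))).homology

end EquivariantStrictSystem

/-- The set-theoretic support of a sheaf of modules: the points with non-zero stalk. -/
def sheafSupport {Y : Scheme.{0}} (M : Y.Modules) : Set Y :=
  {x | Nontrivial (M.presheaf.stalk x)}

end TreeComplex

end

open TreeComplex

noncomputable section

namespace TreeComplex

open Classical

/-! ### The binary order and signs -/

/-! The differential is a matrix indexed by pairs of trees. Its entry at `T`, `T'` is an integer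
`coeff T T'`, equal to `0` or `±1`, times the homomorphism `φ` between the leaf partitions
(`treeMap`). Since `φ` is functorial, both algebraic claims are statements about integers.

For `d ∘ d = 0` one compares the two orders of contracting nodes `A` and `B`. The sign of a node
counts smaller elements of `P(T)`, and removing one of two nodes shifts the position of exactly one
of them, so the two orders have opposite signs (`positionSign_mul_antisymm`). This cancels all pairs
that can be contracted in either order. What remains are nodes `B` that become exceptional only
through the contraction of some `A ⊂ B`. Then `A` admits both an ordinary and an exceptional
contraction, both give the same tree after the contraction of `B`, and the additional minus sign of
exceptional contractions cancels them (`sum_coeff_mul_coeff`).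

For equivariance, `σ` carries contractions of `T` to contractions of `σT`. The signs agree because
removing `A` from `P(T)` removes exactly the inversions of `σ` that involve `A`, and these account
modulo 2 for the change of the position of `A` (`positionSign_perm`).

For the support, let `x` be a point off the small diagonal, `𝔅` its partition of coincidences and
`I` one part of `𝔅`, a non-empty proper subset of `[n]`. Over the neighbourhood `U_𝔅` of `x`, the
map `φ` between two comparable partitions with the same intersection with `𝔅` is an isomorphism. The
complex is shown to be exact there by an acyclic matching of trees, as in discrete Morse theory. Let
the pivot `v` be a minimal node that meets both `I` and its complement. A tree is paired with the
one obtained by adding or removing the node `v ∩ I`; if `v ∩ I` is a leaf, by adding or removing `v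
\ I`; and if this is impossible too, by splitting the leaf `v` into these two sets or merging them.
Every tree lies in exactly one pair (`IsUpper.exists_matched`, `exists_matched_of_not_isUpper`,
`Matched.right_unique`, `Matched.left_unique`), and the two leaf partitions of a pair have the same
intersection with `𝔅` (`Matched.leafPartition_inf_eq`), so the matched entries are invertible.

Acyclicity comes from a rank that never increases under contraction (`rank_le_of_coeff_ne_zero`),
while an entry of equal rank from an upper to a lower tree is always a matched one. Hence the
components of a cycle can be eliminated by descending rank (`exists_rank_lt`, `exists_boundary`).
The elimination is carried out on generalized elements `Z ⟶ G_n`, which suffices for exactness in an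
abelian category. -/

lemma binarySum_injective {n : ℕ} :
    Function.Injective fun A : Finset (Fin n) => ∑ i ∈ A, 2 ^ (i : ℕ) := by
  intro A B h
  apply Finset.map_injective Fin.valEmbedding
  apply Finset.geomSum_injective le_rfl
  simpa using h

lemma binaryLT_or_binaryLT {n : ℕ} {A B : Finset (Fin n)} (h : A ≠ B) :
    BinaryLT A B ∨ BinaryLT B A :=
  lt_or_gt_of_ne (binarySum_injective.ne h)

lemma BinaryLT.asymm {n : ℕ} {A B : Finset (Fin n)} (h : BinaryLT A B) : ¬ BinaryLT B A :=
  Nat.lt_asymm h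

lemma not_binaryLT_self {n : ℕ} (A : Finset (Fin n)) : ¬ BinaryLT A A :=
  Nat.lt_irrefl _

/-- The sign `(-1)^l`, where `l` is the number of `L ∈ P` with `L < A`. -/
def positionSign {n : ℕ} (P : Finset (Finset (Fin n))) (A : Finset (Fin n)) : ℤ :=
  (-1) ^ (P.filter fun L => BinaryLT L A).card

lemma positionSign_erase_of_lt {n : ℕ} {P : Finset (Finset (Fin n))} {A B : Finset (Fin n)}
    (hA : A ∈ P) (h : BinaryLT A B) : positionSign (P.erase A) B = -positionSign P B := by
  have hm : A ∈ P.filter fun L => BinaryLT L B := by simp [hA, h]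
  rw [positionSign, positionSign, Finset.filter_erase, ← Finset.card_erase_add_one hm, pow_succ]
  ring

lemma positionSign_erase_of_not_lt {n : ℕ} {P : Finset (Finset (Fin n))} {A B : Finset (Fin n)}
    (h : ¬ BinaryLT A B) : positionSign (P.erase A) B = positionSign P B := by
  rw [positionSign, positionSign, Finset.filter_erase, Finset.erase_eq_of_notMem]
  simp [h]

/-- Removing the smaller of the two sets lowers the position of the larger one by one, while
removing the larger one does not affect the smaller. So exactly one of the two orders of removal
acquires a sign. -/
lemma positionSign_mul_antisymm {n : ℕ} {P : Finset (Finset (Fin n))} {A B : Finset (Fin n)}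
    (hA : A ∈ P) (hB : B ∈ P) (h : A ≠ B) :
    positionSign P A * positionSign (P.erase A) B =
      -(positionSign P B * positionSign (P.erase B) A) := by
  rcases binaryLT_or_binaryLT h with h | h
  · rw [positionSign_erase_of_lt hA h, positionSign_erase_of_not_lt h.asymm]; ring
  · rw [positionSign_erase_of_lt hB h, positionSign_erase_of_not_lt h.asymm]; ring

namespace IndexTree

variable {n : ℕ} {T : IndexTree n}

lemma nodeSign_eq (A : Finset (Fin n)) : T.nodeSign A = positionSign T.inner A := rfl

/-! ### Contractions -/

lemma nonempty_of_mem_nodes {A : Finset (Fin n)} (hA : A ∈ T.nodes) : A.Nonempty :=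
  Finset.nonempty_iff_ne_empty.2 fun h => T.empty_notMem (h ▸ hA)

lemma mem_nodes_of_mem_inner {A : Finset (Fin n)} (hA : A ∈ T.inner) : A ∈ T.nodes :=
  (mem_inner.1 hA).1

lemma mem_nodes_of_mem_leaves {A : Finset (Fin n)} (hA : A ∈ T.leaves) : A ∈ T.nodes :=
  (mem_leaves.1 hA).1

lemma mem_inner_iff_notMem_leaves {A : Finset (Fin n)} (hA : A ∈ T.nodes) :
    A ∈ T.inner ↔ A ∉ T.leaves := by
  simp [inner, hA]

lemma mem_inner_of_mem_exceptional {A : Finset (Fin n)} (hA : A ∈ T.exceptional) : A ∈ T.inner :=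
  (Finset.mem_filter.1 hA).1

lemma mem_inner_of_mem_ordinary {A : Finset (Fin n)} (hA : A ∈ T.ordinary) : A ∈ T.inner :=
  Finset.mem_of_mem_erase hA

/-- Exceptional nodes are the minimal elements of `P(T)`. They are thus determined by `P(T)` alone,
which makes them easy to follow through contractions. -/
lemma mem_exceptional_iff {A : Finset (Fin n)} :
    A ∈ T.exceptional ↔ A ∈ T.inner ∧ ∀ B ∈ T.inner, ¬ B ⊂ A := by
  constructor
  · refine fun hA => ⟨mem_inner_of_mem_exceptional hA, fun B hB hBA => ?_⟩
    exact (Finset.mem_sdiff.1 hB).2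
      (mem_leaves_of_exceptional hA (mem_nodes_of_mem_inner hB) hBA)
  · rintro ⟨hA, h⟩
    refine Finset.mem_filter.2 ⟨hA, fun B hB => ?_⟩
    have hB' := Finset.mem_filter.1 hB
    by_contra hn
    exact h B ((mem_inner_iff_notMem_leaves hB'.1).2 hn) hB'.2.1

/-- The children of an exceptional node are leaves, so it has no deeper descendants. -/
lemma mem_children_of_exceptional {A B : Finset (Fin n)} (hA : A ∈ T.exceptional) :
    B ∈ T.children A ↔ B ∈ T.nodes ∧ B ⊂ A := by
  constructor
  · intro h
    have h := Finset.mem_filter.1 h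
    exact ⟨h.1, h.2.1⟩
  · rintro ⟨hB, hBA⟩
    obtain ⟨C, hC, hBC⟩ := exists_child hB hBA
    have hCl := (Finset.mem_filter.1 hA).2 hC
    rcases hBC.eq_or_ssubset with rfl | h
    · exact hC
    · exact absurd h ((mem_leaves.1 hCl).2 B hB)

lemma mem_nodes_exceptionalContraction {A B : Finset (Fin n)} (hA : A ∈ T.exceptional) :
    B ∈ (T.exceptionalContraction A hA).nodes ↔ B ∈ T.nodes ∧ ¬ B ⊂ A := by
  simp only [exceptionalContraction, Finset.mem_sdiff, mem_children_of_exceptional hA]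
  tauto

variable (T) in
/-- The ordinary contraction, extended by `T` to all sets `A`. -/
def contractOrd (A : Finset (Fin n)) : IndexTree n :=
  if hA : A ∈ T.ordinary then T.ordinaryContraction A hA else T

variable (T) in
/-- The exceptional contraction, extended by `T` to all sets `A`. -/
def contractExc (A : Finset (Fin n)) : IndexTree n :=
  if hA : A ∈ T.exceptional then T.exceptionalContraction A hA else T

lemma contractOrd_eq {A : Finset (Fin n)} (hA : A ∈ T.ordinary) :
    T.contractOrd A = T.ordinaryContraction A hA := dif_pos hA

lemma contractExc_eq {A : Finset (Fin n)} (hA : A ∈ T.exceptional) :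
    T.contractExc A = T.exceptionalContraction A hA := dif_pos hA

lemma mem_nodes_contractOrd {A B : Finset (Fin n)} (hA : A ∈ T.ordinary) :
    B ∈ (T.contractOrd A).nodes ↔ B ≠ A ∧ B ∈ T.nodes := by
  rw [contractOrd_eq hA]; exact Finset.mem_erase

lemma mem_nodes_contractExc {A B : Finset (Fin n)} (hA : A ∈ T.exceptional) :
    B ∈ (T.contractExc A).nodes ↔ B ∈ T.nodes ∧ ¬ B ⊂ A := by
  rw [contractExc_eq hA, mem_nodes_exceptionalContraction]

lemma inner_contractOrd {A : Finset (Fin n)} (hA : A ∈ T.ordinary) :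
    (T.contractOrd A).inner = T.inner.erase A := by
  rw [contractOrd_eq hA, inner_ordinaryContraction]

lemma inner_contractExc {A : Finset (Fin n)} (hA : A ∈ T.exceptional) :
    (T.contractExc A).inner = T.inner.erase A := by
  rw [contractExc_eq hA, inner_exceptionalContraction]

lemma ordinary_contractOrd {A : Finset (Fin n)} (hA : A ∈ T.ordinary) :
    (T.contractOrd A).ordinary = T.ordinary.erase A := by
  rw [ordinary, inner_contractOrd hA, ordinary, Finset.erase_right_comm]

lemma ordinary_contractExc {A : Finset (Fin n)} (hA : A ∈ T.exceptional) :
    (T.contractExc A).ordinary = T.ordinary.erase A := by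
  rw [ordinary, inner_contractExc hA, ordinary, Finset.erase_right_comm]

variable (T) in
/-- The minimal elements of `P(T) \ {A}`. -/
def exceptionalErase (A : Finset (Fin n)) : Finset (Finset (Fin n)) :=
  (T.inner.erase A).filter fun B => ∀ C ∈ T.inner.erase A, ¬ C ⊂ B

/-- Both kinds of contraction at `A` have the same effect on `P(T)`, the removal of `A`, and hence
produce the same exceptional nodes. -/
lemma exceptional_contractOrd {A : Finset (Fin n)} (hA : A ∈ T.ordinary) :
    (T.contractOrd A).exceptional = T.exceptionalErase A := by
  ext B
  rw [mem_exceptional_iff, inner_contractOrd hA, exceptionalErase, Finset.mem_filter]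

lemma exceptional_contractExc {A : Finset (Fin n)} (hA : A ∈ T.exceptional) :
    (T.contractExc A).exceptional = T.exceptionalErase A := by
  ext B
  rw [mem_exceptional_iff, inner_contractExc hA, exceptionalErase, Finset.mem_filter]

lemma exceptional_erase_subset (A : Finset (Fin n)) :
    T.exceptional.erase A ⊆ T.exceptionalErase A := by
  intro B hB
  obtain ⟨hBA, hB⟩ := Finset.mem_erase.1 hB
  obtain ⟨hB, h⟩ := mem_exceptional_iff.1 hB
  exact Finset.mem_filter.2 ⟨Finset.mem_erase.2 ⟨hBA, hB⟩, fun C hC => h C (Finset.mem_of_mem_erase hC)⟩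

/-- A node which becomes exceptional by the removal of `A` contains `A`, and `A` is exceptional. -/
lemma of_mem_exceptionalErase {A B : Finset (Fin n)} (hA : A ∈ T.inner)
    (hB : B ∈ T.exceptionalErase A \ T.exceptional.erase A) :
    A ⊂ B ∧ A ∈ T.exceptional ∧ A ∈ T.ordinary := by
  simp only [exceptionalErase, Finset.mem_sdiff, Finset.mem_filter, Finset.mem_erase,
    mem_exceptional_iff] at hB
  obtain ⟨⟨⟨hBA, hB⟩, h⟩, hn⟩ := hB
  have hAB : A ⊂ B := by
    by_contra hAB
    refine hn ⟨hBA, hB, fun C hC hCB => ?_⟩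
    by_cases hCA : C = A
    · exact hAB (hCA ▸ hCB)
    · exact h C ⟨hCA, hC⟩ hCB
  refine ⟨hAB, mem_exceptional_iff.2 ⟨hA, fun C hC hCA => ?_⟩, Finset.mem_erase.2 ⟨?_, hA⟩⟩
  · exact h C ⟨hCA.ne, hC⟩ (hCA.trans hAB)
  · rintro rfl
    exact hAB.not_subset (Finset.subset_univ _)

lemma contractOrd_contractOrd {A B : Finset (Fin n)} (hA : A ∈ T.ordinary) (hB : B ∈ T.ordinary)
    (h : A ≠ B) : (T.contractOrd A).contractOrd B = (T.contractOrd B).contractOrd A := by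
  have h1 : B ∈ (T.contractOrd A).ordinary := by
    rw [ordinary_contractOrd hA]; exact Finset.mem_erase.2 ⟨h.symm, hB⟩
  have h2 : A ∈ (T.contractOrd B).ordinary := by
    rw [ordinary_contractOrd hB]; exact Finset.mem_erase.2 ⟨h, hA⟩
  ext C
  rw [mem_nodes_contractOrd h1, mem_nodes_contractOrd h2, mem_nodes_contractOrd hA,
    mem_nodes_contractOrd hB]
  tauto

lemma contractExc_contractOrd {A B : Finset (Fin n)} (hA : A ∈ T.ordinary)
    (hB : B ∈ T.exceptional) (h : A ≠ B) :
    (T.contractOrd A).contractExc B = (T.contractExc B).contractOrd A := by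
  have h1 : B ∈ (T.contractOrd A).exceptional := by
    rw [exceptional_contractOrd hA]
    exact exceptional_erase_subset A (Finset.mem_erase.2 ⟨h.symm, hB⟩)
  have h2 : A ∈ (T.contractExc B).ordinary := by
    rw [ordinary_contractExc hB]; exact Finset.mem_erase.2 ⟨h, hA⟩
  ext C
  rw [mem_nodes_contractExc h1, mem_nodes_contractOrd h2, mem_nodes_contractOrd hA,
    mem_nodes_contractExc hB]
  tauto

lemma contractExc_contractExc {A B : Finset (Fin n)} (hA : A ∈ T.exceptional)
    (hB : B ∈ T.exceptional) (h : A ≠ B) :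
    (T.contractExc A).contractExc B = (T.contractExc B).contractExc A := by
  have h1 : B ∈ (T.contractExc A).exceptional := by
    rw [exceptional_contractExc hA]
    exact exceptional_erase_subset A (Finset.mem_erase.2 ⟨h.symm, hB⟩)
  have h2 : A ∈ (T.contractExc B).exceptional := by
    rw [exceptional_contractExc hB]
    exact exceptional_erase_subset B (Finset.mem_erase.2 ⟨h, hA⟩)
  ext C
  rw [mem_nodes_contractExc h1, mem_nodes_contractExc h2, mem_nodes_contractExc hA,
    mem_nodes_contractExc hB]
  tauto

/-- The two contractions of `A` differ only in whether `A` or the nodes below `A` survive. All of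
these lie strictly below `B` and are deleted by the contraction of `B`. -/
lemma contractExc_contractOrd_nested {A B : Finset (Fin n)} (hA : A ∈ T.inner)
    (hB : B ∈ T.exceptionalErase A \ T.exceptional.erase A) :
    (T.contractOrd A).contractExc B = (T.contractExc A).contractExc B := by
  obtain ⟨hAB, hA1, hA2⟩ := of_mem_exceptionalErase hA hB
  have hB := (Finset.mem_sdiff.1 hB).1
  have h1 : B ∈ (T.contractOrd A).exceptional := by rwa [exceptional_contractOrd hA2]
  have h2 : B ∈ (T.contractExc A).exceptional := by rwa [exceptional_contractExc hA1]
  ext C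
  rw [mem_nodes_contractExc h1, mem_nodes_contractExc h2, mem_nodes_contractOrd hA2,
    mem_nodes_contractExc hA1]
  constructor
  · rintro ⟨⟨-, hC⟩, h⟩
    exact ⟨⟨hC, fun h' => h (h'.trans hAB)⟩, h⟩
  · rintro ⟨⟨hC, -⟩, h⟩
    exact ⟨⟨fun h' => h (h' ▸ hAB), hC⟩, h⟩

/-! ### The coefficients of the differential -/

/-- The coefficient of the differential at `T`, `T'`: the sum of the signs of the contractions
of `T` with result `T'`. -/
def coeff (T T' : IndexTree n) : ℤ :=
  ∑ A ∈ T.ordinary, (if T.contractOrd A = T' then T.nodeSign A else 0) -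
    ∑ A ∈ T.exceptional, if T.contractExc A = T' then T.nodeSign A else 0

/-- This replaces a sum over target trees by one over contracted nodes, where cancellations can be
organized. -/
lemma sum_coeff_mul (T : IndexTree n) [Fintype (IndexTree n)] (f : IndexTree n → ℤ) :
    ∑ T', T.coeff T' * f T' =
      ∑ A ∈ T.ordinary, T.nodeSign A * f (T.contractOrd A) -
        ∑ A ∈ T.exceptional, T.nodeSign A * f (T.contractExc A) := by
  simp only [coeff, sub_mul, Finset.sum_mul, Finset.sum_sub_distrib, ite_mul, zero_mul]
  congr 1 <;>
  · rw [Finset.sum_comm]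
    exact Finset.sum_congr rfl fun A _ => by simp

/-- The sum of an antisymmetric function over the pairs of distinct elements vanishes. -/
lemma sum_sum_erase_eq_zero {α : Type*} [DecidableEq α] (R : Finset α) (g : α → α → ℤ)
    (hg : ∀ a ∈ R, ∀ b ∈ R, a ≠ b → g a b = -g b a) : ∑ a ∈ R, ∑ b ∈ R.erase a, g a b = 0 := by
  have h : ∑ a ∈ R, ∑ b ∈ R.erase a, g a b = ∑ b ∈ R, ∑ a ∈ R.erase b, g a b :=
    Finset.sum_comm' (by simp only [Finset.mem_erase]; tauto)
  have h' : ∑ b ∈ R, ∑ a ∈ R.erase b, g a b = -∑ b ∈ R, ∑ a ∈ R.erase b, g b a := by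
    rw [← Finset.sum_neg_distrib]
    refine Finset.sum_congr rfl fun b hb => ?_
    rw [← Finset.sum_neg_distrib]
    refine Finset.sum_congr rfl fun a ha => ?_
    exact hg a (Finset.mem_of_mem_erase ha) b hb (Finset.ne_of_mem_erase ha)
  linarith

/-- The identity `d ∘ d = 0` with the sheaves removed: only the signs of the two-step contractions
from `T` to `T''` are left. -/
lemma sum_coeff_mul_coeff (T T'' : IndexTree n) [Fintype (IndexTree n)] :
    ∑ T', T.coeff T' * T'.coeff T'' = 0 := by
  rw [sum_coeff_mul]
  -- The sign of contracting `A` first and `B` second, before the minus signs of exceptional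
  -- contractions. It is the same for all four combinations of types, because `P(T)` always loses
  -- just `A`.
  let s (A B : Finset (Fin n)) : ℤ := positionSign T.inner A * positionSign (T.inner.erase A) B
  have hs : ∀ A ∈ T.inner, ∀ B ∈ T.inner, A ≠ B → s A B = -s B A :=
    fun A hA B hB h => positionSign_mul_antisymm hA hB h
  let oo (A B : Finset (Fin n)) : ℤ := if (T.contractOrd A).contractOrd B = T'' then s A B else 0
  let oe (A B : Finset (Fin n)) : ℤ := if (T.contractOrd A).contractExc B = T'' then s A B else 0
  let eo (A B : Finset (Fin n)) : ℤ := if (T.contractExc A).contractOrd B = T'' then s A B else 0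
  let ee (A B : Finset (Fin n)) : ℤ := if (T.contractExc A).contractExc B = T'' then s A B else 0
  have h1 : ∑ A ∈ T.ordinary, T.nodeSign A * (T.contractOrd A).coeff T'' =
      ∑ A ∈ T.ordinary, ∑ B ∈ T.ordinary.erase A, oo A B -
        ∑ A ∈ T.ordinary, ∑ B ∈ T.exceptionalErase A, oe A B := by
    rw [← Finset.sum_sub_distrib]
    refine Finset.sum_congr rfl fun A hA => ?_
    rw [coeff, ordinary_contractOrd hA, exceptional_contractOrd hA, mul_sub, Finset.mul_sum,
      Finset.mul_sum]
    simp only [nodeSign_eq, inner_contractOrd hA, mul_ite, mul_zero, oo, oe, s]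
  have h2 : ∑ A ∈ T.exceptional, T.nodeSign A * (T.contractExc A).coeff T'' =
      ∑ A ∈ T.exceptional, ∑ B ∈ T.ordinary.erase A, eo A B -
        ∑ A ∈ T.exceptional, ∑ B ∈ T.exceptionalErase A, ee A B := by
    rw [← Finset.sum_sub_distrib]
    refine Finset.sum_congr rfl fun A hA => ?_
    rw [coeff, ordinary_contractExc hA, exceptional_contractExc hA, mul_sub, Finset.mul_sum,
      Finset.mul_sum]
    simp only [nodeSign_eq, inner_contractExc hA, mul_ite, mul_zero, eo, ee, s]
  have hoo : ∑ A ∈ T.ordinary, ∑ B ∈ T.ordinary.erase A, oo A B = 0 := by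
    refine sum_sum_erase_eq_zero _ _ fun A hA B hB h => ?_
    simp only [oo]
    rw [contractOrd_contractOrd hA hB h, hs A (mem_inner_of_mem_ordinary hA) B
      (mem_inner_of_mem_ordinary hB) h]
    split_ifs <;> simp
  have hee : ∑ A ∈ T.exceptional, ∑ B ∈ T.exceptional.erase A, ee A B = 0 := by
    refine sum_sum_erase_eq_zero _ _ fun A hA B hB h => ?_
    simp only [ee]
    rw [contractExc_contractExc hA hB h, hs A (mem_inner_of_mem_exceptional hA) B
      (mem_inner_of_mem_exceptional hB) h]
    split_ifs <;> simp
  -- After the contraction of `A`, the exceptional nodes are either newly exceptional or were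
  -- exceptional before.
  have split (R : Finset (Finset (Fin n))) (g : Finset (Fin n) → Finset (Fin n) → ℤ) :
      ∑ A ∈ R, ∑ B ∈ T.exceptionalErase A, g A B =
        ∑ A ∈ R, ∑ B ∈ T.exceptionalErase A \ T.exceptional.erase A, g A B +
          ∑ A ∈ R, ∑ B ∈ T.exceptional.erase A, g A B := by
    rw [← Finset.sum_add_distrib]
    exact Finset.sum_congr rfl fun A _ => (Finset.sum_sdiff (exceptional_erase_subset A)).symm
  have hcomm : ∑ A ∈ T.exceptional, ∑ B ∈ T.ordinary.erase A, eo A B =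
      -∑ A ∈ T.ordinary, ∑ B ∈ T.exceptional.erase A, oe A B := by
    rw [Finset.sum_comm' (t' := T.ordinary) (s' := fun B => T.exceptional.erase B)
      (by simp only [Finset.mem_erase]; tauto), ← Finset.sum_neg_distrib]
    refine Finset.sum_congr rfl fun A hA => ?_
    rw [← Finset.sum_neg_distrib]
    refine Finset.sum_congr rfl fun B hB => ?_
    obtain ⟨hBA, hB⟩ := Finset.mem_erase.1 hB
    simp only [eo, oe]
    rw [contractExc_contractOrd hA hB hBA.symm, hs A (mem_inner_of_mem_ordinary hA) B
      (mem_inner_of_mem_exceptional hB) hBA.symm]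
    split_ifs <;> simp
  have hnest : ∑ A ∈ T.ordinary, ∑ B ∈ T.exceptionalErase A \ T.exceptional.erase A, oe A B =
      ∑ A ∈ T.exceptional, ∑ B ∈ T.exceptionalErase A \ T.exceptional.erase A, ee A B := by
    -- A newly exceptional `B` exists only if `A` is both ordinary and exceptional, so both sums may
    -- be extended to all of `P(T)` and compared term by term.
    have hl : ∑ A ∈ T.ordinary, ∑ B ∈ T.exceptionalErase A \ T.exceptional.erase A, oe A B =
        ∑ A ∈ T.inner, ∑ B ∈ T.exceptionalErase A \ T.exceptional.erase A, oe A B := by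
      refine Finset.sum_subset (Finset.erase_subset _ _) fun A hA hA' => ?_
      exact Finset.sum_eq_zero fun B hB => absurd (of_mem_exceptionalErase hA hB).2.2 hA'
    have hr : ∑ A ∈ T.exceptional, ∑ B ∈ T.exceptionalErase A \ T.exceptional.erase A, ee A B =
        ∑ A ∈ T.inner, ∑ B ∈ T.exceptionalErase A \ T.exceptional.erase A, ee A B := by
      refine Finset.sum_subset (Finset.filter_subset _ _) fun A hA hA' => ?_
      exact Finset.sum_eq_zero fun B hB => absurd (of_mem_exceptionalErase hA hB).2.1 hA'
    rw [hl, hr]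
    refine Finset.sum_congr rfl fun A hA => Finset.sum_congr rfl fun B hB => ?_
    simp only [oe, ee]
    rw [contractExc_contractOrd_nested hA hB]
  rw [h1, h2, hoo, split T.ordinary, split T.exceptional, hee, hcomm, hnest]
  ring

/-- A non-zero coefficient comes from an ordinary or an exceptional contraction. -/
lemma exists_of_coeff_ne_zero {T T' : IndexTree n} (h : T.coeff T' ≠ 0) :
    (∃ A ∈ T.ordinary, T.contractOrd A = T') ∨ ∃ A ∈ T.exceptional, T.contractExc A = T' := by
  by_contra! hn
  refine h ?_
  rw [coeff, Finset.sum_eq_zero, Finset.sum_eq_zero, sub_zero]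
  · exact fun A hA => if_neg (hn.2 A hA)
  · exact fun A hA => if_neg (hn.1 A hA)

lemma leafPartition_le_of_coeff_ne_zero {T T' : IndexTree n} (h : T.coeff T' ≠ 0) :
    T.leafPartition ≤ T'.leafPartition := by
  rcases exists_of_coeff_ne_zero h with ⟨A, hA, rfl⟩ | ⟨A, hA, rfl⟩
  · rw [contractOrd_eq hA]; exact (leafPartition_ordinaryContraction hA).le
  · rw [contractExc_eq hA]; exact leafPartition_le_exceptionalContraction hA

lemma card_inner_of_coeff_ne_zero {T T' : IndexTree n} (h : T.coeff T' ≠ 0) :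
    T.inner.card = T'.inner.card + 1 := by
  rcases exists_of_coeff_ne_zero h with ⟨A, hA, rfl⟩ | ⟨A, hA, rfl⟩
  · rw [inner_contractOrd hA, Finset.card_erase_add_one (mem_inner_of_mem_ordinary hA)]
  · rw [inner_contractExc hA, Finset.card_erase_add_one (mem_inner_of_mem_exceptional hA)]

/-! ### Contractions are determined by their results. -/

lemma leaves_contractOrd {A : Finset (Fin n)} (hA : A ∈ T.ordinary) :
    (T.contractOrd A).leaves = T.leaves := by
  rw [contractOrd_eq hA, leaves_ordinaryContraction]

lemma mem_leaves_contractExc {A B : Finset (Fin n)} (hA : A ∈ T.exceptional) :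
    B ∈ (T.contractExc A).leaves ↔ B = A ∨ (B ∈ T.leaves ∧ ¬ B ⊂ A) := by
  by_cases hB : B ∈ (T.contractExc A).nodes
  · rw [← not_iff_not, ← mem_inner_iff_notMem_leaves hB, inner_contractExc hA, Finset.mem_erase]
    rw [mem_nodes_contractExc hA] at hB
    rw [mem_inner_iff_notMem_leaves hB.1]
    tauto
  · refine iff_of_false (fun h => hB (mem_nodes_of_mem_leaves h)) ?_
    rw [mem_nodes_contractExc hA] at hB
    rintro (rfl | h)
    · exact hB ⟨mem_nodes_of_mem_inner (mem_inner_of_mem_exceptional hA), fun h => h.ne rfl⟩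
    · exact hB ⟨mem_nodes_of_mem_leaves h.1, h.2⟩

/-- The node at which a contraction takes place is determined by the result. -/
lemma eq_of_erase_inner_eq {A B : Finset (Fin n)} (hA : A ∈ T.inner)
    (h : T.inner.erase A = T.inner.erase B) : A = B := by
  by_contra hn
  exact Finset.notMem_erase A T.inner (h ▸ Finset.mem_erase.2 ⟨hn, hA⟩)

/-- An exceptional contraction creates a new leaf, an ordinary one leaves the set of leaves
unchanged. -/
lemma contractOrd_ne_contractExc {A B : Finset (Fin n)} (hA : A ∈ T.ordinary)
    (hB : B ∈ T.exceptional) : T.contractOrd A ≠ T.contractExc B := by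
  intro h
  have hB' := mem_inner_of_mem_exceptional hB
  have h2 : B ∈ (T.contractOrd A).leaves := by
    rw [h, mem_leaves_contractExc hB]; exact Or.inl rfl
  rw [leaves_contractOrd hA] at h2
  exact (mem_inner_iff_notMem_leaves (mem_nodes_of_mem_inner hB')).1 hB' h2

/-- The result determines the type and the node of a contraction, so only one term of `coeff`
survives. The same applies to `coeff_contractExc`. -/
lemma coeff_contractOrd {A : Finset (Fin n)} (hA : A ∈ T.ordinary) :
    T.coeff (T.contractOrd A) = T.nodeSign A := by
  rw [coeff, Finset.sum_eq_single_of_mem A hA, if_pos rfl, Finset.sum_eq_zero, sub_zero]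
  · exact fun B hB => if_neg (contractOrd_ne_contractExc hA hB).symm
  · refine fun B hB hBA => if_neg fun h => hBA ?_
    apply eq_of_erase_inner_eq (mem_inner_of_mem_ordinary hB)
    rw [← inner_contractOrd hA, ← inner_contractOrd hB, h]

lemma coeff_contractExc {A : Finset (Fin n)} (hA : A ∈ T.exceptional) :
    T.coeff (T.contractExc A) = -T.nodeSign A := by
  rw [coeff, Finset.sum_eq_single_of_mem (s := T.exceptional) A hA, if_pos rfl,
    Finset.sum_eq_zero, zero_sub]
  · exact fun B hB => if_neg (contractOrd_ne_contractExc hB hA)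
  · refine fun B hB hBA => if_neg fun h => hBA ?_
    apply eq_of_erase_inner_eq (mem_inner_of_mem_exceptional hB)
    rw [← inner_contractExc hA, ← inner_contractExc hB, h]

/-- The coefficients are `0` and `±1`. -/
lemma coeff_mul_self {T T' : IndexTree n} (h : T.coeff T' ≠ 0) : T.coeff T' * T.coeff T' = 1 := by
  have key : ∀ m : ℕ, (-1 : ℤ) ^ m * (-1) ^ m = 1 := fun m => by
    rw [← mul_pow]; norm_num
  rcases exists_of_coeff_ne_zero h with ⟨A, hA, rfl⟩ | ⟨A, hA, rfl⟩
  · rw [coeff_contractOrd hA]; exact key _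
  · rw [coeff_contractExc hA, neg_mul_neg]; exact key _

/-! ### The action of the symmetric group -/

lemma perm_injective (σ : Equiv.Perm (Fin n)) : Function.Injective (perm σ) := fun _ _ h =>
  IndexTree.ext (Finset.image_injective (permSet_injective σ) (congrArg nodes h))

lemma mem_permFamily {σ : Equiv.Perm (Fin n)} {S : Finset (Finset (Fin n))}
    {A : Finset (Fin n)} : permSet σ A ∈ permFamily σ S ↔ A ∈ S :=
  (permSet_injective σ).mem_finset_image

lemma ordinary_perm (σ : Equiv.Perm (Fin n)) (T : IndexTree n) :
    (T.perm σ).ordinary = permFamily σ T.ordinary := by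
  rw [ordinary, inner_perm, ordinary, permFamily]
  have h := Finset.image_erase (permSet_injective σ) T.inner Finset.univ
  rw [show permSet σ Finset.univ = Finset.univ from Finset.map_univ_equiv σ] at h
  convert h.symm

lemma exceptional_perm (σ : Equiv.Perm (Fin n)) (T : IndexTree n) :
    (T.perm σ).exceptional = permFamily σ T.exceptional := by
  ext A
  simp only [mem_exceptional_iff, inner_perm, permFamily, Finset.mem_image]
  constructor
  · rintro ⟨⟨A, hA, rfl⟩, h⟩
    exact ⟨A, ⟨hA, fun B hB hBA => h _ ⟨B, hB, rfl⟩ (Finset.map_ssubset_map.2 hBA)⟩, rfl⟩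
  · rintro ⟨A, ⟨hA, h⟩, rfl⟩
    refine ⟨⟨A, hA, rfl⟩, ?_⟩
    rintro _ ⟨B, hB, rfl⟩ hBA
    exact h B hB (Finset.map_ssubset_map.1 hBA)

lemma contractOrd_perm (σ : Equiv.Perm (Fin n)) {A : Finset (Fin n)} (hA : A ∈ T.ordinary) :
    (T.perm σ).contractOrd (permSet σ A) = (T.contractOrd A).perm σ := by
  have hA' : permSet σ A ∈ (T.perm σ).ordinary := by rwa [ordinary_perm, mem_permFamily]
  rw [contractOrd_eq hA, contractOrd_eq hA']
  ext1
  exact (Finset.image_erase (permSet_injective σ) _ _).symm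

lemma contractExc_perm (σ : Equiv.Perm (Fin n)) {A : Finset (Fin n)} (hA : A ∈ T.exceptional) :
    (T.perm σ).contractExc (permSet σ A) = (T.contractExc A).perm σ := by
  have hA' : permSet σ A ∈ (T.perm σ).exceptional := by rwa [exceptional_perm, mem_permFamily]
  ext B
  obtain ⟨B, rfl⟩ : ∃ B', permSet σ B' = B :=
    Finite.surjective_of_injective (permSet_injective σ) B
  rw [mem_nodes_contractExc hA']
  change _ ↔ _ ∈ permFamily σ _
  rw [mem_permFamily, mem_nodes_contractExc hA, Finset.map_ssubset_map]
  exact and_congr_left' mem_permFamily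

/-- The sign `(-1)^l`, where `l` is the number of `L ∈ P` whose position relative to `A` is changed
by `σ`. -/
lemma positionSign_perm (σ : Equiv.Perm (Fin n)) {P : Finset (Finset (Fin n))}
    {A : Finset (Fin n)} (hA : A ∈ P) :
    (-1 : ℤ) ^ ((P ×ˢ P).filter fun p =>
        BinaryLT p.1 p.2 ∧ BinaryLT (permSet σ p.2) (permSet σ p.1)).card *
      positionSign (permFamily σ P) (permSet σ A) =
    positionSign P A * (-1) ^ (((P.erase A) ×ˢ (P.erase A)).filter fun p =>
        BinaryLT p.1 p.2 ∧ BinaryLT (permSet σ p.2) (permSet σ p.1)).card := by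
  set inv : Finset (Fin n) × Finset (Fin n) → Prop := fun p =>
    BinaryLT p.1 p.2 ∧ BinaryLT (permSet σ p.2) (permSet σ p.1) with hinv
  -- The sets `L` are sorted by their position relative to `A` before and after `σ`: `a` passes from
  -- below to above, `b` from above to below, and `c` stays below.
  set a := P.filter fun L => BinaryLT L A ∧ BinaryLT (permSet σ A) (permSet σ L) with ha
  set b := P.filter fun L => BinaryLT A L ∧ BinaryLT (permSet σ L) (permSet σ A) with hb
  set c := P.filter fun L => BinaryLT L A ∧ BinaryLT (permSet σ L) (permSet σ A) with hc
  -- The inversions involving `A` are the pairs `(L, A)` with `L` in `a` and `(A, L)` with `L` in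
  -- `b`.
  have h1 : ((P ×ˢ P).filter inv).card =
      (((P.erase A) ×ˢ (P.erase A)).filter inv).card + (a.card + b.card) := by
    have e : (P ×ˢ P).filter inv = ((P.erase A) ×ˢ (P.erase A)).filter inv ∪
        (a.map ⟨fun L => (L, A), fun _ _ h => (Prod.ext_iff.1 h).1⟩ ∪
          b.map ⟨fun L => (A, L), fun _ _ h => (Prod.ext_iff.1 h).2⟩) := by
      ext ⟨L, M⟩
      simp only [Finset.mem_filter, Finset.mem_product, Finset.mem_union, Finset.mem_erase,
        Finset.mem_map, ha, hb, hinv]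
      constructor
      · rintro ⟨⟨hL, hM⟩, h⟩
        by_cases hMA : M = A
        · subst hMA
          exact Or.inr (Or.inl ⟨L, ⟨hL, h⟩, rfl⟩)
        · by_cases hLA : L = A
          · subst hLA
            exact Or.inr (Or.inr ⟨M, ⟨hM, h⟩, rfl⟩)
          · exact Or.inl ⟨⟨⟨hLA, hL⟩, hMA, hM⟩, h⟩
      · rintro (⟨⟨⟨-, hL⟩, -, hM⟩, h⟩ | ⟨L', ⟨hL, h⟩, ⟨⟩⟩ | ⟨L', ⟨hL, h⟩, ⟨⟩⟩)
        · exact ⟨⟨hL, hM⟩, h⟩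
        · exact ⟨⟨hL, hA⟩, h⟩
        · exact ⟨⟨hA, hL⟩, h⟩
    rw [e, Finset.card_union_of_disjoint, Finset.card_union_of_disjoint, Finset.card_map,
      Finset.card_map]
    · rw [Finset.disjoint_left]
      rintro ⟨L, M⟩ h h'
      simp only [Finset.mem_map] at h h'
      obtain ⟨L', hL', ⟨⟩⟩ := h
      obtain ⟨M', hM', ⟨⟩⟩ := h'
      exact not_binaryLT_self _ (Finset.mem_filter.1 hL').2.1
    · rw [Finset.disjoint_left]
      rintro ⟨L, M⟩ h h'
      simp only [Finset.mem_filter, Finset.mem_product, Finset.mem_erase] at h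
      simp only [Finset.mem_union, Finset.mem_map] at h'
      rcases h' with ⟨L', -, ⟨⟩⟩ | ⟨L', -, ⟨⟩⟩
      · exact h.1.2.1 rfl
      · exact h.1.1.1 rfl
  have h2 : (P.filter fun L => BinaryLT L A).card = a.card + c.card := by
    rw [← Finset.card_union_of_disjoint]
    · congr 1
      ext L
      simp only [ha, hc, Finset.mem_union, Finset.mem_filter]
      constructor
      · rintro ⟨hL, h⟩
        have hne : permSet σ A ≠ permSet σ L := fun h' =>
          not_binaryLT_self A (by rw [← permSet_injective σ h'] at h; exact h)
        rcases binaryLT_or_binaryLT hne with h' | h'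
        · exact Or.inl ⟨hL, h, h'⟩
        · exact Or.inr ⟨hL, h, h'⟩
      · rintro (h | h)
        · exact ⟨h.1, h.2.1⟩
        · exact ⟨h.1, h.2.1⟩
    · rw [Finset.disjoint_left]
      intro L h h'
      exact (Finset.mem_filter.1 h).2.2.asymm (Finset.mem_filter.1 h').2.2
  have h3 : ((permFamily σ P).filter fun L => BinaryLT L (permSet σ A)).card =
      b.card + c.card := by
    rw [permFamily, Finset.filter_image,
      Finset.card_image_of_injective _ (permSet_injective σ), ← Finset.card_union_of_disjoint]
    · congr 1
      ext L
      simp only [hb, hc, Finset.mem_union, Finset.mem_filter]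
      constructor
      · rintro ⟨hL, h⟩
        have hne : A ≠ L := fun h' => not_binaryLT_self _ (by rw [h'] at h; exact h)
        rcases binaryLT_or_binaryLT hne with h' | h'
        · exact Or.inl ⟨hL, h', h⟩
        · exact Or.inr ⟨hL, h', h⟩
      · rintro (h | h)
        · exact ⟨h.1, h.2.2⟩
        · exact ⟨h.1, h.2.2⟩
    · rw [Finset.disjoint_left]
      intro L h h'
      exact (Finset.mem_filter.1 h).2.1.asymm (Finset.mem_filter.1 h').2.1
  rw [positionSign, positionSign, h1, h2, h3]
  -- Apart from the inversions not involving `A`, the exponents are `(a + b) + (b + c)` on the left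
  -- and `a + c` on the right; they differ by `2b`.
  have hbb : (-1 : ℤ) ^ b.card * (-1) ^ b.card = 1 := by rw [← mul_pow]; norm_num
  simp only [pow_add]
  linear_combination ((-1 : ℤ) ^ (((P.erase A) ×ˢ (P.erase A)).filter inv).card *
    (-1) ^ a.card * (-1) ^ c.card) * hbb

/-- The map `σ` is a bijection between the contractions from `T` to `T'` and those from `σT` to
`σT'`. As `P(T')` is `P(T)` without the contracted node, the comparison of signs is
`positionSign_perm`. -/
lemma permSign_mul_coeff_perm (σ : Equiv.Perm (Fin n)) (T T' : IndexTree n) :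
    T.permSign σ * (T.perm σ).coeff (T'.perm σ) = T.coeff T' * T'.permSign σ := by
  rw [coeff, coeff, ordinary_perm, exceptional_perm, permFamily,
    Finset.sum_image (permSet_injective σ).injOn, Finset.sum_image (permSet_injective σ).injOn,
    mul_sub, sub_mul, Finset.mul_sum, Finset.mul_sum, Finset.sum_mul, Finset.sum_mul]
  congr 1
  · refine Finset.sum_congr rfl fun A hA => ?_
    rw [contractOrd_perm σ hA, (perm_injective σ).eq_iff]
    split_ifs with h
    · subst h
      rw [nodeSign_eq, nodeSign_eq, permSign, permSign, inner_contractOrd hA, inner_perm]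
      convert positionSign_perm σ (mem_inner_of_mem_ordinary hA)
    · simp
  · refine Finset.sum_congr rfl fun A hA => ?_
    rw [contractExc_perm σ hA, (perm_injective σ).eq_iff]
    split_ifs with h
    · subst h
      rw [nodeSign_eq, nodeSign_eq, permSign, permSign, inner_contractExc hA, inner_perm]
      convert positionSign_perm σ (mem_inner_of_mem_exceptional hA)
    · simp

/-! ### The number of non-leaf nodes -/

lemma exists_exceptional (h : T.inner.Nonempty) : ∃ A, A ∈ T.exceptional := by
  obtain ⟨A, hA⟩ := T.inner.exists_minimal h
  exact ⟨A, mem_exceptional_iff.2 ⟨hA.prop, fun B hB hBA => hBA.not_subset (hA.2 hB hBA.subset)⟩⟩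

/-- Induction by exceptional contractions: each removes one non-leaf node and lowers the number of
leaves by at least one. At the end there is at least one leaf, as `n ≥ 1`. -/
lemma card_inner_lt_card_leaves (T : IndexTree n) (hn : 1 ≤ n) :
    T.inner.card < T.leaves.card := by
  induction h : T.inner.card generalizing T with
  | zero =>
    obtain ⟨B, hB, -⟩ := exists_leaf T.univ_mem (Finset.mem_univ (⟨0, hn⟩ : Fin n))
    exact Finset.card_pos.2 ⟨B, hB⟩
  | succ k ih =>
    obtain ⟨A, hA⟩ := exists_exceptional (T := T) (Finset.card_pos.1 (by omega))
    have hAi := mem_inner_of_mem_exceptional hA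
    have hAn := mem_nodes_of_mem_inner hAi
    have hAl := (mem_inner_iff_notMem_leaves hAn).1 hAi
    have hk : (T.contractExc A).inner.card = k := by
      rw [inner_contractExc hA, Finset.card_erase_of_mem hAi, h]; rfl
    have := ih _ hk
    -- At least two distinct leaves `B` and `C` lie below `A`, and the single new leaf `A` replaces
    -- them.
    have hle : (T.contractExc A).leaves.card + 1 ≤ T.leaves.card := by
      obtain ⟨a, ha⟩ := nonempty_of_mem_nodes hAn
      obtain ⟨B, hB, hBA, haB⟩ := exists_leaf hAn ha
      have hBA' : B ⊂ A := hBA.ssubset_of_ne fun h => hAl (h ▸ hB)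
      obtain ⟨b, hb, hbB⟩ := Finset.exists_of_ssubset hBA'
      obtain ⟨C, hC, hCA, hbC⟩ := exists_leaf hAn hb
      have hCA' : C ⊂ A := hCA.ssubset_of_ne fun h => hAl (h ▸ hC)
      have hCB : C ≠ B := fun h => hbB (h ▸ hbC)
      have hsub : (T.contractExc A).leaves ⊆ insert A ((T.leaves.erase B).erase C) := by
        intro L hL
        rw [mem_leaves_contractExc hA] at hL
        simp only [Finset.mem_insert, Finset.mem_erase]
        rcases hL with rfl | ⟨hL, hLA⟩
        · exact Or.inl rfl
        · exact Or.inr ⟨fun h => hLA (h ▸ hCA'), fun h => hLA (h ▸ hBA'), hL⟩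
      have h1 := (Finset.card_le_card hsub).trans (Finset.card_insert_le _ _)
      have h2 := Finset.card_erase_add_one (s := T.leaves.erase B) (a := C)
        (Finset.mem_erase.2 ⟨hCB, hC⟩)
      have h3 := Finset.card_erase_add_one hB
      omega
    omega

/-- Hence `G_{n,k}` vanishes for `k ≥ n`, and the bound `k ≤ n - 1` in the definition of `G_n` omits
nothing. -/
lemma card_inner_lt (T : IndexTree n) (hn : 1 ≤ n) : T.inner.card < n := by
  refine (card_inner_lt_card_leaves T hn).trans_le ?_
  have h := T.leafPartition.card_parts_le_card
  rwa [Finset.card_univ, Fintype.card_fin] at h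

end IndexTree

/-! ### Relations and partitions -/

namespace SetPartition

variable {n : ℕ}

lemma Rel.mono {𝔄 𝔅 : SetPartition n} (h : 𝔄 ≤ 𝔅) {a b : Fin n} (hab : 𝔄.Rel a b) : 𝔅.Rel a b := by
  obtain ⟨A, hA, ha, hb⟩ := hab
  obtain ⟨B, hB, hAB⟩ := h hA
  exact ⟨B, hB, hAB ha, hAB hb⟩

lemma le_of_rel {𝔄 𝔅 : SetPartition n} (h : ∀ a b, 𝔄.Rel a b → 𝔅.Rel a b) : 𝔄 ≤ 𝔅 := by
  intro A hA
  obtain ⟨a, ha⟩ := 𝔄.nonempty_of_mem_parts hA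
  obtain ⟨B, hB, haB⟩ := 𝔅.exists_mem (Finset.mem_univ a)
  refine ⟨B, hB, fun b hb => ?_⟩
  obtain ⟨C, hC, haC, hbC⟩ := h a b ⟨A, hA, ha, hb⟩
  rwa [𝔅.eq_of_mem_parts hB hC haB haC]

end SetPartition

/-! ### Sets that are cut by a subset `I` of `[n]`. -/

/-- `A` meets both `I` and its complement. -/
def IsMixed {n : ℕ} (I A : Finset (Fin n)) : Prop := (A ∩ I).Nonempty ∧ (A \ I).Nonempty

lemma IsMixed.inter_ssubset {n : ℕ} {I A : Finset (Fin n)} (h : IsMixed I A) : A ∩ I ⊂ A := by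
  refine Finset.inter_subset_left.ssubset_of_ne fun h' => ?_
  obtain ⟨a, ha⟩ := h.2
  rw [Finset.mem_sdiff, ← h'] at ha
  exact ha.2 (Finset.mem_inter.1 ha.1).2

lemma IsMixed.sdiff_ssubset {n : ℕ} {I A : Finset (Fin n)} (h : IsMixed I A) : A \ I ⊂ A := by
  refine Finset.sdiff_subset.ssubset_of_ne fun h' => ?_
  obtain ⟨a, ha⟩ := h.1
  rw [Finset.mem_inter, ← h'] at ha
  exact (Finset.mem_sdiff.1 ha.1).2 ha.2

lemma not_isMixed_inter {n : ℕ} (I A : Finset (Fin n)) : ¬ IsMixed I (A ∩ I) := by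
  rintro ⟨-, a, ha⟩
  exact (Finset.mem_sdiff.1 ha).2 (Finset.mem_inter.1 (Finset.mem_sdiff.1 ha).1).2

lemma not_isMixed_sdiff {n : ℕ} (I A : Finset (Fin n)) : ¬ IsMixed I (A \ I) := by
  rintro ⟨⟨a, ha⟩, -⟩
  exact (Finset.mem_sdiff.1 (Finset.mem_inter.1 ha).1).2 (Finset.mem_inter.1 ha).2

lemma subset_or_subset_of_not_isMixed {n : ℕ} {I A B : Finset (Fin n)} (h : ¬ IsMixed I B)
    (hBA : B ⊆ A) : B ⊆ A ∩ I ∨ B ⊆ A \ I := by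
  by_contra! hn
  obtain ⟨a, ha, haI⟩ := Finset.not_subset.1 hn.1
  obtain ⟨b, hb, hbI⟩ := Finset.not_subset.1 hn.2
  refine h ⟨⟨b, ?_⟩, a, ?_⟩
  · have := hBA hb
    simp_all
  · have := hBA ha
    simp_all

/-- A minimal element of a non-empty family of sets. -/
def minimalElement {n : ℕ} (S : Finset (Finset (Fin n))) : Finset (Fin n) :=
  if h : S.Nonempty then (S.exists_minimal h).choose else ∅

lemma minimal_minimalElement {n : ℕ} {S : Finset (Finset (Fin n))} (h : S.Nonempty) :
    Minimal (· ∈ S) (minimalElement S) := by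
  rw [minimalElement, dif_pos h]
  exact (S.exists_minimal h).choose_spec

namespace IndexTree

variable {n : ℕ} {T T' : IndexTree n} {I : Finset (Fin n)}

/-! ### Expanding trees -/

variable (T) in
/-- The tree obtained by inserting a node `C` between `A` and the children of `A` which are
contained in `C`. -/
@[simps]
def insertNode (A C : Finset (Fin n)) (hA : A ∈ T.inner) (hCA : C ⊂ A) (hne : C.Nonempty)
    (hC : C ∉ T.nodes) (hd : ∀ B ∈ T.nodes, B ⊂ A → B ⊆ C ∨ Disjoint B C) : IndexTree n where
  nodes := insert C T.nodes
  univ_mem := Finset.mem_insert_of_mem T.univ_mem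
  empty_notMem h := by
    rcases Finset.mem_insert.1 h with h | h
    · exact hne.ne_empty h.symm
    · exact T.empty_notMem h
  laminar := by
    -- Outside the subtree below `A`, the set `C` inherits its position from `A`; strictly below `A`
    -- the hypothesis `hd` applies.
    have key : ∀ B ∈ T.nodes, Disjoint B C ∨ B ⊆ C ∨ C ⊆ B := fun B hB => by
      rcases T.laminar B hB A (mem_nodes_of_mem_inner hA) with h | h | h
      · exact Or.inl (h.mono_right hCA.subset)
      · rcases h.eq_or_ssubset with rfl | h
        · exact Or.inr (Or.inr hCA.subset)
        · exact (hd B hB h).symm.imp_right Or.inl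
      · exact Or.inr (Or.inr (hCA.subset.trans h))
    intro B hB D hD
    rcases Finset.mem_insert.1 hB with rfl | hB'
    · rcases Finset.mem_insert.1 hD with rfl | hD'
      · exact Or.inr (Or.inl subset_rfl)
      · exact (key D hD').imp (fun h => h.symm) Or.symm
    · rcases Finset.mem_insert.1 hD with rfl | hD'
      · exact key B hB'
      · exact T.laminar B hB' D hD'
  minimal_or_union := by
    intro B hB
    rcases Finset.mem_insert.1 hB with rfl | hBn
    · refine Or.inr fun a ha => ?_
      obtain ⟨D, hD, hDA, haD⟩ := exists_mem_of_mem_inner hA (hCA.subset ha)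
      rcases hd D hD hDA with h | h
      · exact ⟨D, Finset.mem_insert_of_mem hD, h.ssubset_of_ne fun h => hC (h ▸ hD), haD⟩
      · exact absurd ha (Finset.disjoint_left.1 h haD)
    · by_cases hBi : B ∈ T.inner
      · refine Or.inr fun a ha => ?_
        obtain ⟨D, hD, hDA, haD⟩ := exists_mem_of_mem_inner hBi ha
        exact ⟨D, Finset.mem_insert_of_mem hD, hDA, haD⟩
      · have hBl : B ∈ T.leaves := by
          by_contra h
          exact hBi ((mem_inner_iff_notMem_leaves hBn).2 h)
        -- A leaf of `T` stays a leaf. If it contained `C` properly, it would meet `A`; it is not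
        -- `A`, and it can neither lie strictly below `A`, by `hd`, nor strictly above `A`, being a
        -- leaf.
        refine Or.inl fun D hD hDB => ?_
        rcases Finset.mem_insert.1 hD with rfl | hDn
        · obtain ⟨c, hc⟩ := hne
          rcases T.laminar B hBn A (mem_nodes_of_mem_inner hA) with h | h | h
          · exact Finset.disjoint_left.1 h (hDB.subset hc) (hCA.subset hc)
          · rcases h.eq_or_ssubset with rfl | h
            · exact hBi hA
            · rcases hd B hBn h with h | h
              · exact hDB.not_subset h
              · exact Finset.disjoint_left.1 h (hDB.subset hc) hc
          · rcases h.eq_or_ssubset with rfl | h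
            · exact hBi hA
            · exact (mem_leaves.1 hBl).2 A (mem_nodes_of_mem_inner hA) h
        · exact (mem_leaves.1 hBl).2 D hDn hDB

lemma mem_ordinary_insertNode {A C : Finset (Fin n)} (hA : A ∈ T.inner) (hCA : C ⊂ A)
    (hne : C.Nonempty) (hC : C ∉ T.nodes) (hd : ∀ B ∈ T.nodes, B ⊂ A → B ⊆ C ∨ Disjoint B C) :
    C ∈ (T.insertNode A C hA hCA hne hC hd).ordinary := by
  refine Finset.mem_erase.2 ⟨?_, mem_inner.2 ⟨Finset.mem_insert_self _ _, ?_⟩⟩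
  · rintro rfl
    exact hCA.not_subset (Finset.subset_univ _)
  · obtain ⟨c, hc⟩ := hne
    obtain ⟨D, hD, hDA, hcD⟩ := exists_mem_of_mem_inner hA (hCA.subset hc)
    rcases hd D hD hDA with h | h
    · exact ⟨D, Finset.mem_insert_of_mem hD, h.ssubset_of_ne fun h => hC (h ▸ hD)⟩
    · exact absurd hc (Finset.disjoint_left.1 h hcD)

lemma contractOrd_insertNode {A C : Finset (Fin n)} (hA : A ∈ T.inner) (hCA : C ⊂ A)
    (hne : C.Nonempty) (hC : C ∉ T.nodes) (hd : ∀ B ∈ T.nodes, B ⊂ A → B ⊆ C ∨ Disjoint B C) :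
    (T.insertNode A C hA hCA hne hC hd).contractOrd C = T := by
  ext B
  rw [mem_nodes_contractOrd (mem_ordinary_insertNode hA hCA hne hC hd), insertNode_nodes,
    Finset.mem_insert]
  constructor
  · tauto
  · exact fun hB => ⟨fun h => hC (h ▸ hB), Or.inr hB⟩

lemma subset_or_disjoint_of_mem_leaves {A B : Finset (Fin n)} (hA : A ∈ T.leaves)
    (hB : B ∈ T.nodes) : Disjoint B A ∨ A ⊆ B := by
  rcases T.laminar B hB A (mem_nodes_of_mem_leaves hA) with h | h | h
  · exact Or.inl h
  · rcases h.eq_or_ssubset with rfl | h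
    · exact Or.inr subset_rfl
    · exact absurd h ((mem_leaves.1 hA).2 B hB)
  · exact Or.inr h

variable (T) in
/-- The tree obtained by attaching two children `A ∩ I` and `A \ I` to the leaf `A`. -/
@[simps]
def splitLeaf (A I : Finset (Fin n)) (hA : A ∈ T.leaves) (hI : IsMixed I A) : IndexTree n where
  nodes := insert (A ∩ I) (insert (A \ I) T.nodes)
  univ_mem := Finset.mem_insert_of_mem (Finset.mem_insert_of_mem T.univ_mem)
  empty_notMem h := by
    rcases Finset.mem_insert.1 h with h | h
    · exact hI.1.ne_empty h.symm
    · rcases Finset.mem_insert.1 h with h | h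
      · exact hI.2.ne_empty h.symm
      · exact T.empty_notMem h
  laminar := by
    have h1 : ∀ B ∈ T.nodes, ∀ C ⊆ A, Disjoint B C ∨ C ⊆ B := fun B hB C hC =>
      (subset_or_disjoint_of_mem_leaves hA hB).imp (fun h => h.mono_right hC) hC.trans
    have h2 : Disjoint (A ∩ I) (A \ I) := (Finset.disjoint_sdiff_inter A I).symm
    intro B hB D hD
    simp only [Finset.mem_insert] at hB hD
    rcases hB with rfl | rfl | hB <;> rcases hD with rfl | rfl | hD
    · exact Or.inr (Or.inl subset_rfl)
    · exact Or.inl h2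
    · exact (h1 D hD _ Finset.inter_subset_left).imp (fun h => h.symm) Or.inl
    · exact Or.inl h2.symm
    · exact Or.inr (Or.inl subset_rfl)
    · exact (h1 D hD _ Finset.sdiff_subset).imp (fun h => h.symm) Or.inl
    · exact (h1 B hB _ Finset.inter_subset_left).imp_right Or.inr
    · exact (h1 B hB _ Finset.sdiff_subset).imp_right Or.inr
    · exact T.laminar B hB D hD
  minimal_or_union := by
    have h0 : ∀ B ∈ T.nodes, ¬ B ⊂ A := (mem_leaves.1 hA).2
    have hsub : ∀ B ∈ insert (A ∩ I) (insert (A \ I) T.nodes), ∀ C ⊂ A, B ⊂ C →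
        B = A ∩ I ∨ B = A \ I := by
      intro B hB C hCA hBC
      simp only [Finset.mem_insert] at hB
      rcases hB with rfl | rfl | hB
      · exact Or.inl rfl
      · exact Or.inr rfl
      · exact absurd (hBC.trans hCA) (h0 B hB)
    have hdis : Disjoint (A ∩ I) (A \ I) := (Finset.disjoint_sdiff_inter A I).symm
    intro B hB
    simp only [Finset.mem_insert] at hB
    rcases hB with rfl | rfl | hB
    · refine Or.inl fun C hC hCB => ?_
      rcases hsub C hC _ hI.inter_ssubset hCB with rfl | rfl
      · exact hCB.ne rfl
      · exact hI.2.ne_empty (Finset.disjoint_self_iff_empty _ |>.1 (hdis.mono_left hCB.subset))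
    · refine Or.inl fun C hC hCB => ?_
      rcases hsub C hC _ hI.sdiff_ssubset hCB with rfl | rfl
      · exact hI.1.ne_empty (Finset.disjoint_self_iff_empty _ |>.1 (hdis.mono_right hCB.subset))
      · exact hCB.ne rfl
    · by_cases hBA : B = A
      · subst hBA
        refine Or.inr fun a ha => ?_
        by_cases haI : a ∈ I
        · exact ⟨B ∩ I, by simp, hI.inter_ssubset, by simp [ha, haI]⟩
        · exact ⟨B \ I, by simp, hI.sdiff_ssubset, by simp [ha, haI]⟩
      · rcases T.minimal_or_union B hB with h | h
        · refine Or.inl fun C hC hCB => ?_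
          have hCA : C.Nonempty → C ⊆ A → False := fun ⟨c, hc⟩ hCA => by
            rcases subset_or_disjoint_of_mem_leaves hA hB with h' | h'
            · exact Finset.disjoint_left.1 h' (hCB.subset hc) (hCA hc)
            · exact h A (mem_nodes_of_mem_leaves hA) (h'.ssubset_of_ne (Ne.symm hBA))
          simp only [Finset.mem_insert] at hC
          rcases hC with rfl | rfl | hC
          · exact hCA hI.1 Finset.inter_subset_left
          · exact hCA hI.2 Finset.sdiff_subset
          · exact h C hC hCB
        · refine Or.inr fun a ha => ?_
          obtain ⟨C, hC, h⟩ := h a ha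
          exact ⟨C, by simp [hC], h⟩

/-- The right-hand side is the description of an exceptional contraction at `A`, so that contraction
undoes the splitting. -/
lemma mem_nodes_splitLeaf_iff {A B : Finset (Fin n)} (hA : A ∈ T.leaves) (hI : IsMixed I A) :
    B ∈ T.nodes ↔ B ∈ (T.splitLeaf A I hA hI).nodes ∧ ¬ B ⊂ A := by
  simp only [splitLeaf_nodes, Finset.mem_insert]
  constructor
  · exact fun hB => ⟨Or.inr (Or.inr hB), (mem_leaves.1 hA).2 B hB⟩
  · rintro ⟨rfl | rfl | hB, h⟩
    · exact absurd hI.inter_ssubset h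
    · exact absurd hI.sdiff_ssubset h
    · exact hB

lemma mem_leaves_splitLeaf {A B : Finset (Fin n)} (hA : A ∈ T.leaves) (hI : IsMixed I A)
    (hB : B = A ∩ I ∨ B = A \ I) : B ∈ (T.splitLeaf A I hA hI).leaves := by
  have hdis : Disjoint (A ∩ I) (A \ I) := (Finset.disjoint_sdiff_inter A I).symm
  refine mem_leaves.2 ⟨by simp only [splitLeaf_nodes, Finset.mem_insert]; tauto, ?_⟩
  intro C hC hCB
  simp only [splitLeaf_nodes, Finset.mem_insert] at hC
  rcases hC with rfl | rfl | hC
  · rcases hB with rfl | rfl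
    · exact hCB.ne rfl
    · exact hI.1.ne_empty (Finset.disjoint_self_iff_empty _ |>.1 (hdis.mono_right hCB.subset))
  · rcases hB with rfl | rfl
    · exact hI.2.ne_empty (Finset.disjoint_self_iff_empty _ |>.1 (hdis.mono_left hCB.subset))
    · exact hCB.ne rfl
  · refine (mem_leaves.1 hA).2 C hC ?_
    rcases hB with rfl | rfl
    · exact hCB.trans hI.inter_ssubset
    · exact hCB.trans hI.sdiff_ssubset

/-! ### The matching of index trees -/

variable (I T) in
/-- The nodes which meet both `I` and its complement. -/
def mixedNodes : Finset (Finset (Fin n)) := T.nodes.filter (IsMixed I)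

variable (I T) in
/-- A minimal mixed node. -/
def pivot : Finset (Fin n) := minimalElement (T.mixedNodes I)

variable (I T) in
/-- The first of the following conditions which holds at the pivot `v`: the set `v ∩ I` is not a
leaf; the set `v \ I` is not a leaf; `v` has the children `v ∩ I` and `v \ I`, or is a leaf. -/
def stage : ℕ :=
  if T.pivot I ∈ T.leaves then 0 else
    if T.pivot I ∩ I ∉ T.leaves then 2 else if T.pivot I \ I ∉ T.leaves then 1 else 0

variable (I T) in
/-- The rank of a tree, which does not increase under contractions. -/
def rank : ℕ := 3 * (T.mixedNodes I).card + T.stage I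

variable (I T) in
/-- The tree is the larger one of the two members of its matched pair. -/
def IsUpper : Prop :=
  T.pivot I ∉ T.leaves ∧ T.pivot I ∩ I ∈ T.nodes ∧ (T.pivot I ∩ I ∈ T.leaves → T.pivot I \ I ∈ T.nodes)

/-- `T` and its contraction `T'` form a matched pair. -/
structure Matched (I : Finset (Fin n)) (T T' : IndexTree n) : Prop where
  isUpper : T.IsUpper I
  not_isUpper : ¬ T'.IsUpper I
  rank_eq : T.rank I = T'.rank I
  coeff_ne_zero : T.coeff T' ≠ 0

/-- With the factor `3` in `rank`, this makes the comparison of ranks lexicographic: the number of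
mixed nodes counts before the stage. -/
lemma stage_le : T.stage I ≤ 2 := by
  unfold stage
  split_ifs <;> omega

lemma minimal_pivot (hI : IsMixed I Finset.univ) : Minimal (· ∈ T.mixedNodes I) (T.pivot I) :=
  minimal_minimalElement ⟨_, Finset.mem_filter.2 ⟨T.univ_mem, hI⟩⟩

lemma pivot_mem (hI : IsMixed I Finset.univ) : T.pivot I ∈ T.nodes :=
  (Finset.mem_filter.1 (minimal_pivot hI).prop).1

lemma isMixed_pivot (hI : IsMixed I Finset.univ) : IsMixed I (T.pivot I) :=
  (Finset.mem_filter.1 (minimal_pivot hI).prop).2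

/-- By minimality of the pivot `v`. Consequently every node strictly below `v` lies in `v ∩ I` or in
`v \ I`, which makes it possible to insert these two sets as nodes. -/
lemma not_isMixed_of_ssubset_pivot (hI : IsMixed I Finset.univ) {B : Finset (Fin n)}
    (hB : B ∈ T.nodes) (h : B ⊂ T.pivot I) : ¬ IsMixed I B := fun hB' =>
  h.not_subset ((minimal_pivot hI).2 (Finset.mem_filter.2 ⟨hB, hB'⟩) h.subset)

/-! ### Monotonicity of the rank under contractions. -/

lemma nodes_subset_of_coeff_ne_zero (h : T.coeff T' ≠ 0) : T'.nodes ⊆ T.nodes := by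
  rcases exists_of_coeff_ne_zero h with ⟨A, hA, rfl⟩ | ⟨A, hA, rfl⟩
  · exact fun B hB => ((mem_nodes_contractOrd hA).1 hB).2
  · exact fun B hB => ((mem_nodes_contractExc hA).1 hB).1

lemma mixedNodes_subset_of_coeff_ne_zero (h : T.coeff T' ≠ 0) :
    T'.mixedNodes I ⊆ T.mixedNodes I :=
  Finset.filter_subset_filter _ (nodes_subset_of_coeff_ne_zero h)

/-- The chosen minimal element is a function of the family of mixed nodes alone, so trees with the
same mixed nodes have the same pivot even if there are several minimal ones. -/
lemma pivot_eq (h : T'.mixedNodes I = T.mixedNodes I) : T'.pivot I = T.pivot I := by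
  rw [pivot, pivot, h]

lemma mem_leaves_of_subset (h : T'.nodes ⊆ T.nodes) {B : Finset (Fin n)} (hB : B ∈ T.leaves)
    (hB' : B ∈ T'.nodes) : B ∈ T'.leaves :=
  mem_leaves.2 ⟨hB', fun C hC => (mem_leaves.1 hB).2 C (h hC)⟩

lemma pivot_mem_leaves (hI : IsMixed I Finset.univ) (h : T.coeff T' ≠ 0)
    (hm : T'.mixedNodes I = T.mixedNodes I) (hv : T.pivot I ∈ T.leaves) :
    T'.pivot I ∈ T'.leaves := by
  refine mem_leaves_of_subset (nodes_subset_of_coeff_ne_zero h) ?_ (pivot_mem hI)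
  rwa [pivot_eq hm]

/-- A contraction which preserves the mixed nodes and does not contract the pivot preserves the
leaves below the pivot of the form `v ∩ I` or `v \ I`. -/
lemma mem_leaves_below_pivot (hI : IsMixed I Finset.univ) (h : T.coeff T' ≠ 0)
    (hm : T'.mixedNodes I = T.mixedNodes I) (hv : T'.pivot I ∉ T'.leaves) {C : Finset (Fin n)}
    (hC : C = T.pivot I ∩ I ∨ C = T.pivot I \ I) (hCl : C ∈ T.leaves) : C ∈ T'.leaves := by
  refine mem_leaves_of_subset (nodes_subset_of_coeff_ne_zero h) hCl ?_
  have hCn := mem_nodes_of_mem_leaves hCl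
  rcases exists_of_coeff_ne_zero h with ⟨A, hA, rfl⟩ | ⟨A, hA, rfl⟩
  · rw [← leaves_contractOrd hA] at hCl
    exact mem_nodes_of_mem_leaves hCl
  · rw [mem_nodes_contractExc hA]
    refine ⟨hCn, fun hCA => ?_⟩
    have hAi := mem_inner_of_mem_exceptional hA
    have hAn := mem_nodes_of_mem_inner hAi
    -- An exceptional contraction at the pivot would make it a leaf, contrary to `hv`.
    have hAv : A ≠ T.pivot I := by
      rintro rfl
      rw [pivot_eq hm, mem_leaves_contractExc hA] at hv
      exact hv (Or.inl rfl)
    have hCv : C ⊂ T.pivot I := by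
      rcases hC with rfl | rfl
      · exact (isMixed_pivot hI).inter_ssubset
      · exact (isMixed_pivot hI).sdiff_ssubset
    obtain ⟨c, hc⟩ := nonempty_of_mem_nodes hCn
    rcases T.laminar A hAn _ (pivot_mem hI) with h | h | h
    · exact Finset.disjoint_left.1 h (hCA.subset hc) (hCv.subset hc)
    -- A node strictly below the pivot lies in one of the two halves and cannot properly contain
    -- either half.
    · have hA' := not_isMixed_of_ssubset_pivot hI hAn (h.ssubset_of_ne hAv)
      rcases subset_or_subset_of_not_isMixed hA' h with h' | h' <;> rcases hC with rfl | rfl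
      · exact hCA.not_subset h'
      · have h1 := Finset.mem_inter.1 (h' (hCA.subset hc))
        exact (Finset.mem_sdiff.1 hc).2 h1.2
      · have h1 := Finset.mem_sdiff.1 (h' (hCA.subset hc))
        exact h1.2 (Finset.mem_inter.1 hc).2
      · exact hCA.not_subset h'
    -- An exceptional contraction strictly above the pivot would delete the pivot, a mixed node,
    -- contrary to `hm`.
    · have hvm := (minimal_pivot (T := T) hI).prop
      rw [← hm] at hvm
      have hv' := (Finset.mem_filter.1 hvm).1
      rw [mem_nodes_contractExc hA] at hv'
      exact hv'.2 (h.ssubset_of_ne (Ne.symm hAv))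

/-- A half of the pivot that is a leaf remains one, unless the pivot itself becomes a leaf; in that
case the stage is `0`. -/
lemma stage_le_of_coeff_ne_zero (hI : IsMixed I Finset.univ) (h : T.coeff T' ≠ 0)
    (hm : T'.mixedNodes I = T.mixedNodes I) : T'.stage I ≤ T.stage I := by
  by_cases hv : T'.pivot I ∈ T'.leaves
  · rw [stage, if_pos hv]; exact Nat.zero_le _
  have hv' : T.pivot I ∉ T.leaves := fun h' => hv (pivot_mem_leaves hI h hm h')
  have h1 := mem_leaves_below_pivot hI h hm hv (Or.inl rfl)
  have h2 := mem_leaves_below_pivot hI h hm hv (Or.inr rfl)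
  rw [stage, stage, if_neg hv, if_neg hv', pivot_eq hm]
  by_cases h3 : T.pivot I ∩ I ∈ T.leaves
  · rw [if_neg (not_not.2 h3), if_neg (not_not.2 (h1 h3))]
    by_cases h4 : T.pivot I \ I ∈ T.leaves
    · rw [if_neg (not_not.2 h4), if_neg (not_not.2 (h2 h4))]
    · rw [if_pos h4]; split_ifs <;> omega
  · rw [if_pos h3]; split_ifs <;> omega

/-- The loss of a mixed node lowers the rank by `3`, and the stage can make up for at most `2`. -/
lemma mixedNodes_eq_of_rank_le (h : T.coeff T' ≠ 0) (hr : T.rank I ≤ T'.rank I) :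
    T'.mixedNodes I = T.mixedNodes I := by
  refine Finset.eq_of_subset_of_card_le (mixedNodes_subset_of_coeff_ne_zero h) ?_
  have := stage_le (T := T') (I := I)
  simp only [rank] at hr
  omega

lemma rank_le_of_coeff_ne_zero (hI : IsMixed I Finset.univ) (h : T.coeff T' ≠ 0) :
    T'.rank I ≤ T.rank I := by
  by_contra! hn
  have hm := mixedNodes_eq_of_rank_le h hn.le
  have := stage_le_of_coeff_ne_zero hI h hm
  simp only [rank, hm] at hn
  omega

/-- A contraction which removes a node that is not a leaf is the ordinary contraction of that
node. -/
lemma eq_contractOrd_of_notMem (h : T.coeff T' ≠ 0) {B : Finset (Fin n)} (hB : B ∈ T.nodes)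
    (hBl : B ∉ T.leaves) (hB' : B ∉ T'.nodes) : B ∈ T.ordinary ∧ T' = T.contractOrd B := by
  rcases exists_of_coeff_ne_zero h with ⟨A, hA, rfl⟩ | ⟨A, hA, rfl⟩
  · rw [mem_nodes_contractOrd hA] at hB'
    obtain rfl : B = A := by tauto
    exact ⟨hA, rfl⟩
  · rw [mem_nodes_contractExc hA] at hB'
    exact absurd (mem_leaves_of_exceptional hA hB (by tauto)) hBl

/-- New leaves arise only from exceptional contractions, and only at the contracted node. -/
lemma eq_contractExc_of_mem_leaves (h : T.coeff T' ≠ 0) {B : Finset (Fin n)}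
    (hBl : B ∉ T.leaves) (hB' : B ∈ T'.leaves) : B ∈ T.exceptional ∧ T' = T.contractExc B := by
  rcases exists_of_coeff_ne_zero h with ⟨A, hA, rfl⟩ | ⟨A, hA, rfl⟩
  · rw [leaves_contractOrd hA] at hB'
    exact absurd hB' hBl
  · rw [mem_leaves_contractExc hA] at hB'
    obtain rfl : B = A := by tauto
    exact ⟨hA, rfl⟩

/-! ### The three forms of a matched pair and the uniqueness of partners. -/

namespace Matched

lemma mixedNodes_eq (h : Matched I T T') : T'.mixedNodes I = T.mixedNodes I :=
  mixedNodes_eq_of_rank_le h.coeff_ne_zero h.rank_eq.le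

lemma stage_eq (h : Matched I T T') : T'.stage I = T.stage I := by
  have := h.rank_eq
  simp only [rank, h.mixedNodes_eq] at this
  omega

/-- The possible forms of a matched pair. -/
lemma cases (h : Matched I T T') :
    (T.stage I = 2 ∧ T.pivot I ∩ I ∈ T.ordinary ∧ T' = T.contractOrd (T.pivot I ∩ I)) ∨
    (T.stage I = 1 ∧ T.pivot I \ I ∈ T.ordinary ∧ T' = T.contractOrd (T.pivot I \ I)) ∨
    (T.stage I = 0 ∧ T.pivot I ∈ T.exceptional ∧ T' = T.contractExc (T.pivot I) ∧
      T.pivot I ∩ I ∈ T.leaves ∧ T.pivot I \ I ∈ T.leaves) := by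
  have hm := h.mixedNodes_eq
  have hs := h.stage_eq
  obtain ⟨h1, h2, h3⟩ := h.isUpper
  have hu := h.not_isUpper
  by_cases hv : T'.pivot I ∈ T'.leaves
  -- The pivot has become a leaf, so the common stage is `0`; as the pivot is not a leaf in `T`,
  -- both halves must be leaves there.
  · refine Or.inr (Or.inr ?_)
    have hs0 : T.stage I = 0 := by rw [← hs, stage, if_pos hv]
    rw [pivot_eq hm] at hv
    obtain ⟨h4, h5⟩ := eq_contractExc_of_mem_leaves h.coeff_ne_zero h1 hv
    refine ⟨hs0, h4, h5, ?_⟩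
    rw [stage, if_neg h1] at hs0
    have h6 : T.pivot I ∩ I ∈ T.leaves := by
      by_contra hn
      rw [if_pos hn] at hs0
      omega
    rw [if_neg (not_not.2 h6)] at hs0
    refine ⟨h6, by_contra fun hn => ?_⟩
    rw [if_pos hn] at hs0
    omega
  · by_cases h4 : T.pivot I ∩ I ∈ T'.nodes
    -- The only other way for `T'` not to be upper while containing `v ∩ I`. It forces stage `1`,
    -- and `v \ I` is the contracted node.
    · have h5 : T.pivot I ∩ I ∈ T'.leaves ∧ T.pivot I \ I ∉ T'.nodes := by
        rw [IsUpper, pivot_eq hm] at hu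
        rw [pivot_eq hm] at hv
        by_contra hn
        exact hu ⟨hv, h4, fun h => by_contra fun h' => hn ⟨h, h'⟩⟩
      have h6 : T.pivot I \ I ∉ T'.leaves := fun h => h5.2 (mem_nodes_of_mem_leaves h)
      have hs' : T'.stage I = 1 := by
        rw [stage, if_neg hv, pivot_eq hm, if_neg (not_not.2 h5.1), if_pos h6]
      have hs1 : T.stage I = 1 := hs ▸ hs'
      have h7 : T.pivot I ∩ I ∈ T.leaves ∧ T.pivot I \ I ∉ T.leaves := by
        rw [stage, if_neg h1] at hs1
        have h8 : T.pivot I ∩ I ∈ T.leaves := by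
          by_contra hn
          rw [if_pos hn] at hs1
          omega
        rw [if_neg (not_not.2 h8)] at hs1
        refine ⟨h8, fun hn => ?_⟩
        rw [if_neg (not_not.2 hn)] at hs1
        omega
      exact Or.inr (Or.inl ⟨hs1, eq_contractOrd_of_notMem h.coeff_ne_zero (h3 h7.1) h7.2 h5.2⟩)
    -- Here `v ∩ I` is missing in `T'`. The common stage is `2`, so `v ∩ I` is a non-leaf node of
    -- `T` and was contracted.
    · have h5 : T.pivot I ∩ I ∉ T'.leaves := fun h => h4 (mem_nodes_of_mem_leaves h)
      have hs' : T'.stage I = 2 := by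
        rw [stage, if_neg hv, pivot_eq hm, if_pos h5]
      have hs2 : T.stage I = 2 := hs ▸ hs'
      have h6 : T.pivot I ∩ I ∉ T.leaves := by
        rw [stage, if_neg h1] at hs2
        intro hn
        rw [if_neg (not_not.2 hn)] at hs2
        split_ifs at hs2
        omega
      exact Or.inl ⟨hs2, eq_contractOrd_of_notMem h.coeff_ne_zero h2 h6 h4⟩

/-- The stage of `T` selects one of the three forms, and the contracted node is then determined by
the pivot. -/
lemma right_unique {T'' : IndexTree n} (h : Matched I T T') (h' : Matched I T T'') :
    T' = T'' := by
  rcases h.cases with h | h | h <;> rcases h'.cases with h' | h' | h' <;>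
    first
    | exact h.2.2.trans h'.2.2.symm
    | exact h.2.2.1.trans h'.2.2.1.symm
    | exact absurd (h.1.symm.trans h'.1) (by norm_num)

end Matched

lemma nodes_eq_insert_of_contractOrd_eq {A : Finset (Fin n)} (hA : A ∈ T.ordinary)
    (h : T' = T.contractOrd A) : T.nodes = insert A T'.nodes := by
  ext B
  rw [Finset.mem_insert, h, mem_nodes_contractOrd hA]
  have := mem_nodes_of_mem_inner (mem_inner_of_mem_ordinary hA)
  by_cases hB : B = A
  · subst hB; simp [this]
  · simp [hB]

lemma eq_of_ssubset_pivot (hI : IsMixed I Finset.univ) (h1 : T.pivot I ∩ I ∈ T.leaves)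
    (h2 : T.pivot I \ I ∈ T.leaves) {B : Finset (Fin n)} (hB : B ∈ T.nodes)
    (hBv : B ⊂ T.pivot I) : B = T.pivot I ∩ I ∨ B = T.pivot I \ I := by
  rcases subset_or_subset_of_not_isMixed (not_isMixed_of_ssubset_pivot hI hB hBv) hBv.subset with
    h | h
  · refine Or.inl (by_contra fun hn => ?_)
    exact (mem_leaves.1 h1).2 B hB (h.ssubset_of_ne hn)
  · refine Or.inr (by_contra fun hn => ?_)
    exact (mem_leaves.1 h2).2 B hB (h.ssubset_of_ne hn)

lemma nodes_eq_insert_of_contractExc_eq (hI : IsMixed I Finset.univ)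
    (hA : T.pivot I ∈ T.exceptional) (h1 : T.pivot I ∩ I ∈ T.leaves)
    (h2 : T.pivot I \ I ∈ T.leaves) (h : T' = T.contractExc (T.pivot I)) :
    T.nodes = insert (T.pivot I ∩ I) (insert (T.pivot I \ I) T'.nodes) := by
  ext B
  rw [Finset.mem_insert, Finset.mem_insert, h, mem_nodes_contractExc hA]
  constructor
  · intro hB
    by_cases hBv : B ⊂ T.pivot I
    · exact (eq_of_ssubset_pivot hI h1 h2 hB hBv).imp_right Or.inl
    · exact Or.inr (Or.inr ⟨hB, hBv⟩)
  · rintro (rfl | rfl | h)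
    · exact mem_nodes_of_mem_leaves h1
    · exact mem_nodes_of_mem_leaves h2
    · exact h.1

/-- Matched trees have the same stage and pivot, so `T''` determines which nodes have to be
restored. -/
lemma Matched.left_unique (hI : IsMixed I Finset.univ) {T'' : IndexTree n}
    (h : Matched I T T'') (h' : Matched I T' T'') : T = T' := by
  have hs : T.stage I = T'.stage I := h.stage_eq.symm.trans h'.stage_eq
  have hp : T.pivot I = T'.pivot I :=
    (pivot_eq h.mixedNodes_eq).symm.trans (pivot_eq h'.mixedNodes_eq)
  ext1
  rcases h.cases with ⟨e, h⟩ | ⟨e, h⟩ | ⟨e, h⟩ <;> rcases h'.cases with ⟨e', h'⟩ | ⟨e', h'⟩ | ⟨e', h'⟩ <;>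
    first
    | rw [nodes_eq_insert_of_contractExc_eq hI h.1 h.2.2.1 h.2.2.2 h.2.1,
        nodes_eq_insert_of_contractExc_eq hI h'.1 h'.2.2.1 h'.2.2.2 h'.2.1, hp]
    | (have : T.stage I ≠ T'.stage I := by rw [e, e']; norm_num
       exact absurd hs this)
    | rw [nodes_eq_insert_of_contractOrd_eq h.1 h.2, nodes_eq_insert_of_contractOrd_eq h'.1 h'.2, hp]

/-! ### Existence of partners. -/

lemma coeff_contractOrd_ne_zero {A : Finset (Fin n)} (hA : A ∈ T.ordinary) :
    T.coeff (T.contractOrd A) ≠ 0 := by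
  rw [coeff_contractOrd hA, nodeSign]
  exact pow_ne_zero _ (by norm_num)

lemma coeff_contractExc_ne_zero {A : Finset (Fin n)} (hA : A ∈ T.exceptional) :
    T.coeff (T.contractExc A) ≠ 0 := by
  rw [coeff_contractExc hA, nodeSign]
  exact neg_ne_zero.2 (pow_ne_zero _ (by norm_num))

lemma mixedNodes_contractOrd {A : Finset (Fin n)} (hA : A ∈ T.ordinary) (hI : ¬ IsMixed I A) :
    (T.contractOrd A).mixedNodes I = T.mixedNodes I := by
  ext B
  rw [mixedNodes, mixedNodes, Finset.mem_filter, Finset.mem_filter, mem_nodes_contractOrd hA]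
  constructor
  · tauto
  · exact fun h => ⟨⟨fun h' => hI (h' ▸ h.2), h.1⟩, h.2⟩

lemma pivot_notMem_leaves (hI : IsMixed I Finset.univ) {C : Finset (Fin n)} (hC : C ∈ T.nodes)
    (h : C = T.pivot I ∩ I ∨ C = T.pivot I \ I) : T.pivot I ∉ T.leaves := by
  refine fun hv => (mem_leaves.1 hv).2 C hC ?_
  rcases h with rfl | rfl
  · exact (isMixed_pivot hI).inter_ssubset
  · exact (isMixed_pivot hI).sdiff_ssubset

lemma stage_contractOrd {A : Finset (Fin n)} (hA : A ∈ T.ordinary) (hI : ¬ IsMixed I A) :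
    (T.contractOrd A).stage I = T.stage I := by
  rw [stage, stage, leaves_contractOrd hA, pivot_eq (mixedNodes_contractOrd hA hI)]

/-- The contracted node is not mixed and the leaves do not change, so mixed nodes, pivot and stage
are preserved. The result is not upper because it lacks `v ∩ I`. -/
lemma matched_contractOrd_inter (hI : IsMixed I Finset.univ) (h : T.pivot I ∩ I ∈ T.ordinary) :
    Matched I T (T.contractOrd (T.pivot I ∩ I)) := by
  have hi := mem_inner_of_mem_ordinary h
  have hn := mem_nodes_of_mem_inner hi
  have hm := not_isMixed_inter I (T.pivot I)
  refine ⟨⟨pivot_notMem_leaves hI hn (Or.inl rfl), hn, fun h' => ?_⟩, fun h' => ?_, ?_,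
    coeff_contractOrd_ne_zero h⟩
  · exact absurd h' ((mem_inner_iff_notMem_leaves hn).1 hi)
  · have h2 := h'.2.1
    rw [pivot_eq (mixedNodes_contractOrd h hm), mem_nodes_contractOrd h] at h2
    exact h2.1 rfl
  · rw [rank, rank, stage_contractOrd h hm, mixedNodes_contractOrd h hm]

lemma matched_contractOrd_sdiff (hI : IsMixed I Finset.univ) (hl : T.pivot I ∩ I ∈ T.leaves)
    (h : T.pivot I \ I ∈ T.ordinary) : Matched I T (T.contractOrd (T.pivot I \ I)) := by
  have hi := mem_inner_of_mem_ordinary h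
  have hn := mem_nodes_of_mem_inner hi
  have hm := not_isMixed_sdiff I (T.pivot I)
  refine ⟨⟨pivot_notMem_leaves hI hn (Or.inr rfl), mem_nodes_of_mem_leaves hl, fun _ => hn⟩,
    fun h' => ?_, ?_, coeff_contractOrd_ne_zero h⟩
  · have h2 := h'.2.2
    rw [pivot_eq (mixedNodes_contractOrd h hm), mem_nodes_contractOrd h,
      leaves_contractOrd h] at h2
    exact (h2 hl).1 rfl
  · rw [rank, rank, stage_contractOrd h hm, mixedNodes_contractOrd h hm]

lemma pivot_mem_exceptional (hI : IsMixed I Finset.univ) (h1 : T.pivot I ∩ I ∈ T.leaves)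
    (h2 : T.pivot I \ I ∈ T.leaves) : T.pivot I ∈ T.exceptional := by
  have hv := pivot_notMem_leaves hI (mem_nodes_of_mem_leaves h1) (Or.inl rfl)
  refine mem_exceptional_iff.2 ⟨(mem_inner_iff_notMem_leaves (pivot_mem hI)).2 hv, ?_⟩
  intro B hB hBv
  have hBn := mem_nodes_of_mem_inner hB
  refine (mem_inner_iff_notMem_leaves hBn).1 hB ?_
  rcases eq_of_ssubset_pivot hI h1 h2 hBn hBv with rfl | rfl
  · exact h1
  · exact h2

/-- Only the two unmixed halves are deleted. The stage is `0` before, as both halves are leaves, and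
`0` after, as the pivot is a leaf. -/
lemma matched_contractExc (hI : IsMixed I Finset.univ) (h1 : T.pivot I ∩ I ∈ T.leaves)
    (h2 : T.pivot I \ I ∈ T.leaves) : Matched I T (T.contractExc (T.pivot I)) := by
  have hv := pivot_notMem_leaves hI (mem_nodes_of_mem_leaves h1) (Or.inl rfl)
  have he := pivot_mem_exceptional hI h1 h2
  have hm : (T.contractExc (T.pivot I)).mixedNodes I = T.mixedNodes I := by
    ext B
    rw [mixedNodes, mixedNodes, Finset.mem_filter, Finset.mem_filter, mem_nodes_contractExc he]
    constructor
    · tauto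
    · exact fun h => ⟨⟨h.1, fun h' => not_isMixed_of_ssubset_pivot hI h.1 h' h.2⟩, h.2⟩
  have hv' : (T.contractExc (T.pivot I)).pivot I ∈ (T.contractExc (T.pivot I)).leaves := by
    rw [pivot_eq hm, mem_leaves_contractExc he]; exact Or.inl rfl
  refine ⟨⟨hv, mem_nodes_of_mem_leaves h1, fun _ => mem_nodes_of_mem_leaves h2⟩,
    fun h => h.1 hv', ?_, coeff_contractExc_ne_zero he⟩
  rw [rank, rank, hm, stage, stage, if_pos hv', if_neg hv, if_neg (not_not.2 h1),
    if_neg (not_not.2 h2)]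

lemma mem_ordinary_of_ssubset {A B : Finset (Fin n)} (hA : A ∈ T.nodes) (hAl : A ∉ T.leaves)
    (hAB : A ⊂ B) : A ∈ T.ordinary := by
  refine Finset.mem_erase.2 ⟨?_, (mem_inner_iff_notMem_leaves hA).2 hAl⟩
  rintro rfl
  exact hAB.not_subset (Finset.subset_univ _)

lemma IsUpper.exists_matched (hI : IsMixed I Finset.univ) (h : T.IsUpper I) :
    ∃ T', Matched I T T' := by
  obtain ⟨-, h2, h3⟩ := h
  by_cases h4 : T.pivot I ∩ I ∈ T.leaves
  · by_cases h5 : T.pivot I \ I ∈ T.leaves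
    · exact ⟨_, matched_contractExc hI h4 h5⟩
    · exact ⟨_, matched_contractOrd_sdiff hI h4
        (mem_ordinary_of_ssubset (h3 h4) h5 (isMixed_pivot hI).sdiff_ssubset)⟩
  · exact ⟨_, matched_contractOrd_inter hI
      (mem_ordinary_of_ssubset h2 h4 (isMixed_pivot hI).inter_ssubset)⟩

/-- The three matched contractions are inverted: depending on why `T'` is not upper, the pivot is
split, or `v \ I` or `v ∩ I` is inserted below it. -/
lemma exists_matched_of_not_isUpper (hI : IsMixed I Finset.univ) (h : ¬ T'.IsUpper I) :
    ∃ T, Matched I T T' := by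
  have hmix := isMixed_pivot (T := T') hI
  have hp := pivot_mem (T := T') hI
  by_cases hv : T'.pivot I ∈ T'.leaves
  · let T := T'.splitLeaf (T'.pivot I) I hv hmix
    have hm : T.mixedNodes I = T'.mixedNodes I := by
      ext B
      simp only [mixedNodes, Finset.mem_filter, T, splitLeaf_nodes, Finset.mem_insert]
      constructor
      · rintro ⟨rfl | rfl | hB, h⟩
        · exact absurd h (not_isMixed_inter _ _)
        · exact absurd h (not_isMixed_sdiff _ _)
        · exact ⟨hB, h⟩
      · tauto
    have hpe : T.pivot I = T'.pivot I := pivot_eq hm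
    have h1 : T.pivot I ∩ I ∈ T.leaves := mem_leaves_splitLeaf hv hmix (Or.inl (by rw [hpe]))
    have h2 : T.pivot I \ I ∈ T.leaves := mem_leaves_splitLeaf hv hmix (Or.inr (by rw [hpe]))
    refine ⟨T, ?_⟩
    have he : T.contractExc (T.pivot I) = T' := by
      ext B
      rw [mem_nodes_contractExc (pivot_mem_exceptional hI h1 h2), hpe,
        mem_nodes_splitLeaf_iff hv hmix]
    have := matched_contractExc hI h1 h2
    rwa [he] at this
  · have hvi := (mem_inner_iff_notMem_leaves hp).2 hv
    have hdis : Disjoint (T'.pivot I ∩ I) (T'.pivot I \ I) :=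
      (Finset.disjoint_sdiff_inter _ I).symm
    -- Inserting an unmixed node does not move the pivot.
    have hmi {C : Finset (Fin n)} (hC : ¬ IsMixed I C) {T : IndexTree n}
        (hT : T.nodes = insert C T'.nodes) : T.pivot I = T'.pivot I := by
      apply pivot_eq
      ext B
      simp only [mixedNodes, Finset.mem_filter, hT, Finset.mem_insert]
      constructor
      · rintro ⟨rfl | hB, h⟩
        · exact absurd h hC
        · exact ⟨hB, h⟩
      · tauto
    by_cases h1 : T'.pivot I ∩ I ∈ T'.nodes
    · have h2 : T'.pivot I ∩ I ∈ T'.leaves ∧ T'.pivot I \ I ∉ T'.nodes := by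
        rw [IsUpper] at h
        tauto
      have hd : ∀ B ∈ T'.nodes, B ⊂ T'.pivot I →
          B ⊆ T'.pivot I \ I ∨ Disjoint B (T'.pivot I \ I) := fun B hB hBv =>
        (subset_or_subset_of_not_isMixed (not_isMixed_of_ssubset_pivot hI hB hBv)
          hBv.subset).symm.imp_right hdis.mono_left
      let T := T'.insertNode _ _ hvi hmix.sdiff_ssubset hmix.2 h2.2 hd
      have hpe : T.pivot I = T'.pivot I := hmi (not_isMixed_sdiff _ _) rfl
      have ho : T.pivot I \ I ∈ T.ordinary := by
        rw [hpe]; exact mem_ordinary_insertNode _ _ _ _ _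
      have he : T.contractOrd (T.pivot I \ I) = T' := by
        rw [hpe]; exact contractOrd_insertNode _ _ _ _ _
      have hl : T.pivot I ∩ I ∈ T.leaves := by
        rw [← leaves_contractOrd ho, he, hpe]; exact h2.1
      have := matched_contractOrd_sdiff hI hl ho
      rw [he] at this
      exact ⟨T, this⟩
    · have hd : ∀ B ∈ T'.nodes, B ⊂ T'.pivot I →
          B ⊆ T'.pivot I ∩ I ∨ Disjoint B (T'.pivot I ∩ I) := fun B hB hBv =>
        (subset_or_subset_of_not_isMixed (not_isMixed_of_ssubset_pivot hI hB hBv)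
          hBv.subset).imp_right hdis.symm.mono_left
      let T := T'.insertNode _ _ hvi hmix.inter_ssubset hmix.1 h1 hd
      have hpe : T.pivot I = T'.pivot I := hmi (not_isMixed_inter _ _) rfl
      have ho : T.pivot I ∩ I ∈ T.ordinary := by
        rw [hpe]; exact mem_ordinary_insertNode _ _ _ _ _
      have he : T.contractOrd (T.pivot I ∩ I) = T' := by
        rw [hpe]; exact contractOrd_insertNode _ _ _ _ _
      have := matched_contractOrd_inter hI ho
      rw [he] at this
      exact ⟨T, this⟩

/-- The leaf partitions of a matched pair agree on each partition which is finer than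
`{I, [n] \ I}`. -/
lemma Matched.leafPartition_inf_eq (h : Matched I T T') {𝔇 : SetPartition n}
    (h𝔇 : ∀ a b, 𝔇.Rel a b → (a ∈ I ↔ b ∈ I)) :
    T.leafPartition ⊓ 𝔇 = T'.leafPartition ⊓ 𝔇 := by
  refine le_antisymm (inf_le_inf_right _ (leafPartition_le_of_coeff_ne_zero h.coeff_ne_zero))
    (le_inf (SetPartition.le_of_rel fun a b hab => ?_) inf_le_right)
  have hD := h𝔇 a b (SetPartition.Rel.mono inf_le_right hab)
  obtain ⟨A, hA, ha, hb⟩ := SetPartition.Rel.mono inf_le_left hab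
  change A ∈ T'.leaves at hA
  rcases h.cases with ⟨-, hv, rfl⟩ | ⟨-, hv, rfl⟩ | ⟨-, hv, rfl, h1, h2⟩
  · rw [leaves_contractOrd hv] at hA
    exact ⟨A, hA, ha, hb⟩
  · rw [leaves_contractOrd hv] at hA
    exact ⟨A, hA, ha, hb⟩
  · rw [mem_leaves_contractExc hv] at hA
    rcases hA with rfl | hA
    -- The merged leaf is the pivot. As `a` and `b` lie on the same side of `I`, they are already in
    -- the same half, which is a leaf of `T`.
    · by_cases haI : a ∈ I
      · exact ⟨_, h1, Finset.mem_inter.2 ⟨ha, haI⟩, Finset.mem_inter.2 ⟨hb, hD.1 haI⟩⟩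
      · exact ⟨_, h2, Finset.mem_sdiff.2 ⟨ha, haI⟩,
          Finset.mem_sdiff.2 ⟨hb, fun h => haI (hD.2 h)⟩⟩
    · exact ⟨A, hA.1, ha, hb⟩

end IndexTree

/-! ### The differential as a matrix -/

instance (n : ℕ) : Fintype (IndexTree n) := Fintype.ofFinite _

section TreeMap

variable {n : ℕ} {𝒞 : Type*} [Category 𝒞] [Preadditive 𝒞] (P : SetPartition n ⥤ 𝒞)

/-- The homomorphism `P(𝔄) ⟶ P(𝔅)`, extended by `0` to all pairs of partitions. -/
def extendedMap (𝔄 𝔅 : SetPartition n) : P.obj 𝔄 ⟶ P.obj 𝔅 :=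
  if h : 𝔄 ≤ 𝔅 then P.map (homOfLE h) else 0

lemma extendedMap_eq {𝔄 𝔅 : SetPartition n} (h : 𝔄 ≤ 𝔅) :
    extendedMap P 𝔄 𝔅 = P.map (homOfLE h) := dif_pos h

/-- The component of the differential of the tree complex at the trees `T` and `T'`. -/
def treeMap (T T' : IndexTree n) : P.obj T.leafPartition ⟶ P.obj T'.leafPartition :=
  T.coeff T' • extendedMap P T.leafPartition T'.leafPartition

lemma coeff_ne_zero_of_treeMap_ne_zero {T T' : IndexTree n} (h : treeMap P T T' ≠ 0) :
    T.coeff T' ≠ 0 := fun h' => h (by rw [treeMap, h', zero_smul])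

lemma treeMap_eq_zero_of_card_ne {T T' : IndexTree n} (h : T.inner.card ≠ T'.inner.card + 1) :
    treeMap P T T' = 0 := by
  by_contra hn
  exact h (IndexTree.card_inner_of_coeff_ne_zero (coeff_ne_zero_of_treeMap_ne_zero P hn))

lemma treeMap_comp_functor {𝒟 : Type*} [Category 𝒟] [Preadditive 𝒟] (Φ : 𝒞 ⥤ 𝒟) [Φ.Additive]
    (T T' : IndexTree n) : treeMap (P ⋙ Φ) T T' = Φ.map (treeMap P T T') := by
  rw [treeMap, treeMap, Functor.map_zsmul, extendedMap, extendedMap]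
  congr 1
  split_ifs
  · rfl
  · exact (Φ.map_zero _ _).symm

/-- By functoriality all intermediate trees contribute multiples of one and the same homomorphism,
whose coefficients add up to zero. -/
lemma sum_treeMap_comp_treeMap (T T'' : IndexTree n) :
    ∑ T', treeMap P T T' ≫ treeMap P T' T'' = 0 := by
  have h (T' : IndexTree n) : treeMap P T T' ≫ treeMap P T' T'' =
      (T.coeff T' * T'.coeff T'') • extendedMap P T.leafPartition T''.leafPartition := by
    -- Zero coefficients are treated apart: with its default value `0`, `extendedMap` is not
    -- compatible with composition through incomparable partitions.
    by_cases h1 : T.coeff T' = 0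
    · simp [treeMap, h1]
    by_cases h2 : T'.coeff T'' = 0
    · simp [treeMap, h2]
    have l1 := IndexTree.leafPartition_le_of_coeff_ne_zero h1
    have l2 := IndexTree.leafPartition_le_of_coeff_ne_zero h2
    rw [treeMap, treeMap, extendedMap_eq P l1, extendedMap_eq P l2, extendedMap_eq P (l1.trans l2),
      Preadditive.zsmul_comp, Preadditive.comp_zsmul, smul_smul, ← P.map_comp]
    rfl
  rw [Finset.sum_congr rfl fun T' _ => h T', ← Finset.sum_smul, IndexTree.sum_coeff_mul_coeff,
    zero_smul]

/-- A non-zero coefficient is `±1` and is its own inverse. -/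
lemma isIso_treeMap {T T' : IndexTree n} (h : T.coeff T' ≠ 0)
    (hP : IsIso (P.map (homOfLE (IndexTree.leafPartition_le_of_coeff_ne_zero h)))) :
    IsIso (treeMap P T T') := by
  have h1 := IndexTree.coeff_mul_self h
  have h2 := extendedMap_eq P (IndexTree.leafPartition_le_of_coeff_ne_zero h)
  refine ⟨T.coeff T' • inv (P.map (homOfLE (IndexTree.leafPartition_le_of_coeff_ne_zero h))),
    ?_, ?_⟩
  · rw [treeMap, h2, Preadditive.zsmul_comp, Preadditive.comp_zsmul, smul_smul, h1, one_smul,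
      IsIso.hom_inv_id]
  · rw [treeMap, h2, Preadditive.zsmul_comp, Preadditive.comp_zsmul, smul_smul, h1, one_smul,
      IsIso.inv_hom_id]

/-! ### Exactness -/

variable {P} {I : Finset (Fin n)} {Z : 𝒞}

open IndexTree in
/-- One step of the elimination of generalized elements, from the rank `≤ m` to the rank `< m`. -/
lemma exists_rank_lt (hI : IsMixed I Finset.univ)
    (hP : ∀ T T' : IndexTree n, Matched I T T' → IsIso (treeMap P T T')) (m : ℕ)
    (z : ∀ T : IndexTree n, Z ⟶ P.obj T.leafPartition)
    (hm : ∀ T, z T ≠ 0 → T.rank I ≤ m) (hz : ∀ T', ∑ T, z T ≫ treeMap P T T' = 0) :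
    ∃ w : ∀ T : IndexTree n, Z ⟶ P.obj T.leafPartition,
      ∀ T', z T' - ∑ T, w T ≫ treeMap P T T' ≠ 0 → T'.rank I < m := by
  choose! f hf using fun (T : IndexTree n) (h : ∃ T', Matched I T T') => h
  -- On an upper tree of rank `m`, the component of `z` at its partner is pulled back along the
  -- matched isomorphism; all other components are zero.
  let w (T : IndexTree n) : Z ⟶ P.obj T.leafPartition :=
    if h : (∃ T', Matched I T T') ∧ T.rank I = m then
      z (f T) ≫ (have := hP T (f T) (hf T h.1); inv (treeMap P T (f T))) else 0
  have hw {T T' : IndexTree n} (h : Matched I T T') (hr : T.rank I = m) :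
      w T ≫ treeMap P T T' = z T' := by
    obtain rfl : f T = T' := (hf T ⟨T', h⟩).right_unique h
    simp only [w]
    rw [dif_pos ⟨⟨_, h⟩, hr⟩, Category.assoc, IsIso.inv_hom_id, Category.comp_id]
  have hw' {T : IndexTree n} (h : w T ≠ 0) : T.IsUpper I ∧ T.rank I = m := by
    by_cases h' : (∃ T', Matched I T T') ∧ T.rank I = m
    · exact ⟨(hf T h'.1).isUpper, h'.2⟩
    · exact absurd (dif_neg h') h
  let z' (T' : IndexTree n) := z T' - ∑ T, w T ≫ treeMap P T T'
  have hz' (T'' : IndexTree n) : ∑ T', z' T' ≫ treeMap P T' T'' = 0 := by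
    simp only [z', Preadditive.sub_comp, Finset.sum_sub_distrib, hz, Preadditive.sum_comp,
      Category.assoc]
    rw [Finset.sum_comm, zero_sub, neg_eq_zero]
    refine Finset.sum_eq_zero fun T _ => ?_
    rw [← Preadditive.comp_sum, sum_treeMap_comp_treeMap, comp_zero]
  have h1 (T' : IndexTree n) (h : z' T' ≠ 0) : T'.rank I ≤ m := by
    by_contra! hn
    refine h ?_
    have e : z T' = 0 := by
      by_contra h
      exact absurd (hm T' h) (by omega)
    simp only [z', e, zero_sub, neg_eq_zero]
    refine Finset.sum_eq_zero fun T _ => ?_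
    by_contra h
    have hT : w T ≠ 0 := fun h' => h (by rw [h', zero_comp])
    have hc : treeMap P T T' ≠ 0 := fun h' => h (by rw [h', comp_zero])
    have := rank_le_of_coeff_ne_zero hI (coeff_ne_zero_of_treeMap_ne_zero P hc)
    have := (hw' hT).2
    omega
  -- At a lower tree of rank `m`, every contributing tree is upper of the same rank, hence is the
  -- partner. So the boundary of `w` has exactly the component `z T'`.
  have h2 (T' : IndexTree n) (hr : T'.rank I = m) (hu : ¬ T'.IsUpper I) : z' T' = 0 := by
    obtain ⟨T₀, h₀⟩ := exists_matched_of_not_isUpper hI hu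
    simp only [z']
    rw [Finset.sum_eq_single T₀, hw h₀ (h₀.rank_eq.trans hr), sub_self]
    · intro T _ hT
      by_contra h
      have hT' : w T ≠ 0 := fun h' => h (by rw [h', zero_comp])
      have hc : treeMap P T T' ≠ 0 := fun h' => h (by rw [h', comp_zero])
      exact hT (Matched.left_unique hI ⟨(hw' hT').1, hu, (hw' hT').2.trans hr.symm,
        coeff_ne_zero_of_treeMap_ne_zero P hc⟩ h₀)
    · exact fun h => absurd (Finset.mem_univ _) h
  refine ⟨w, fun T' hT' => (h1 T' hT').lt_of_ne fun hr => hT' ?_⟩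
  by_cases hu : T'.IsUpper I
  swap
  · exact h2 T' hr hu
  -- At an upper tree no correction is needed: the cycle condition at its partner `T''` contains
  -- only the term of `T'`, and the matched isomorphism can be cancelled.
  obtain ⟨T'', h''⟩ := hu.exists_matched hI
  have := hz' T''
  rw [Finset.sum_eq_single T'] at this
  · have hiso := hP T' T'' h''
    exact (cancel_mono (treeMap P T' T'')).1 (this.trans zero_comp.symm)
  · intro T _ hT
    by_contra h
    have hT' : z' T ≠ 0 := fun h' => h (by rw [h', zero_comp])
    have hc := coeff_ne_zero_of_treeMap_ne_zero P fun h' => h (by rw [h', comp_zero])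
    -- Another tree `T` contributing at `T''` has rank at most `m` and at least that of `T''`, which
    -- is `m`. It is upper by `h2`, hence a second partner of `T''`.
    have l1 := h1 T hT'
    have l2 := rank_le_of_coeff_ne_zero hI hc
    have l3 := h''.rank_eq
    have hr' : T.rank I = m := by omega
    have hu' : T.IsUpper I := by
      by_contra hu'
      exact hT' (h2 T hr' hu')
    exact hT (Matched.left_unique hI ⟨hu', h''.not_isUpper, by omega, hc⟩ h'')
  · exact fun h => absurd (Finset.mem_univ _) h

open IndexTree in
/-- A generalized cycle of the tree complex is a boundary if `P` inverts the homomorphisms of the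
matched pairs. -/
lemma exists_boundary (hI : IsMixed I Finset.univ)
    (hP : ∀ T T' : IndexTree n, Matched I T T' → IsIso (treeMap P T T'))
    (z : ∀ T : IndexTree n, Z ⟶ P.obj T.leafPartition)
    (hz : ∀ T', ∑ T, z T ≫ treeMap P T T' = 0) :
    ∃ w : ∀ T : IndexTree n, Z ⟶ P.obj T.leafPartition,
      ∀ T', ∑ T, w T ≫ treeMap P T T' = z T' := by
  -- Any bound for the finitely many ranks will do; the sum of all of them plus one is convenient.
  obtain ⟨m, hm⟩ : ∃ m, ∀ T, z T ≠ 0 → T.rank I < m :=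
    ⟨∑ T : IndexTree n, T.rank I + 1, fun T _ => Nat.lt_succ_of_le
      (Finset.single_le_sum (f := fun T : IndexTree n => T.rank I) (fun _ _ => Nat.zero_le _)
        (Finset.mem_univ T))⟩
  induction m generalizing z with
  | zero =>
    refine ⟨fun _ => 0, fun T' => ?_⟩
    simp only [zero_comp, Finset.sum_const_zero]
    by_contra h
    exact absurd (hm T' (Ne.symm h)) (Nat.not_lt_zero _)
  | succ m ih =>
    obtain ⟨w, hw⟩ := exists_rank_lt hI hP m z (fun T h => Nat.le_of_lt_succ (hm T h)) hz
    obtain ⟨w', hw'⟩ := ih (fun T' => z T' - ∑ T, w T ≫ treeMap P T T') (fun T'' => by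
      simp only [Preadditive.sub_comp, Finset.sum_sub_distrib, hz, Preadditive.sum_comp,
        Category.assoc]
      rw [Finset.sum_comm, zero_sub, neg_eq_zero]
      refine Finset.sum_eq_zero fun T _ => ?_
      rw [← Preadditive.comp_sum, sum_treeMap_comp_treeMap, comp_zero]) hw
    refine ⟨fun T => w T + w' T, fun T' => ?_⟩
    simp only [Preadditive.add_comp, Finset.sum_add_distrib]
    rw [hw' T']
    abel

end TreeMap

namespace EquivariantStrictSystem

variable {G : Over SpecC} [GrpObj G] {X : Over SpecC} [ModObj G X] [IsSeparated X.hom] {n : ℕ}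
  (S : EquivariantStrictSystem G X n)

/-! ### The components of `G_{n,k}` -/

/-- The degree `i` part of the system, as a functor on set partitions. -/
abbrev sheafFunctor (i : ZMod 2) : SetPartition n ⥤ EquivariantModule G (power X n) where
  obj 𝔄 := S.F.obj 𝔄 i
  map f := S.F.map f i
  map_id 𝔄 := congrFun (S.F.map_id 𝔄) i
  map_comp f g := congrFun (S.F.map_comp f g) i

lemma ιTree_πTree_self {k : ℕ} (T : IndexTreeOf n k) (i : ZMod 2) :
    S.ιTree T i ≫ S.πTree T i = 𝟙 _ :=
  biproduct.ι_π_self _ T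

lemma ιTree_πTree_ne {k : ℕ} {T T' : IndexTreeOf n k} (h : T ≠ T') (i : ZMod 2) :
    S.ιTree T i ≫ S.πTree T' i = 0 :=
  biproduct.ι_π_ne _ h

lemma sum_πTree_ιTree (k : ℕ) (i : ZMod 2) :
    ∑ T : IndexTreeOf n k, S.πTree T i ≫ S.ιTree T i = 𝟙 (S.Gnk k i) :=
  biproduct.total

lemma Gnk_hom_ext {k : ℕ} {i : ZMod 2} {Z : EquivariantModule G (power X n)}
    {f g : S.Gnk k i ⟶ Z} (h : ∀ T, S.ιTree T i ≫ f = S.ιTree T i ≫ g) : f = g :=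
  biproduct.hom_ext' _ _ h

/-- Written as a sum over all target trees with a single non-zero term, the contraction can be
summed over `A` first; this yields `coeff`. The exceptional case is analogous. -/
lemma ordinaryHom_ιTree {k : ℕ} (T : IndexTreeOf n (k + 1)) {A : Finset (Fin n)}
    (hA : A ∈ T.1.ordinary) (i : ZMod 2) :
    S.ordinaryHom T.1 hA i ≫ S.ιTree ⟨_, IndexTree.card_ordinaryContraction T.2 hA⟩ i =
      ∑ T' : IndexTreeOf n k, (if T.1.contractOrd A = T'.1 then T.1.nodeSign A else 0) •
        extendedMap (S.sheafFunctor i) T.1.leafPartition T'.1.leafPartition ≫ S.ιTree T' i := by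
  have h := IndexTree.leafPartition_ordinaryContraction hA
  rw [Finset.sum_eq_single ⟨_, IndexTree.card_ordinaryContraction T.2 hA⟩]
  · rw [if_pos (IndexTree.contractOrd_eq hA), ordinaryHom, Preadditive.zsmul_comp]
    congr 2
    rw [extendedMap_eq _ h.le]
    have : homOfLE h.le = eqToHom h := Subsingleton.elim _ _
    rw [this, eqToHom_map]
  · intro T' _ hT'
    rw [if_neg, zero_smul]
    rw [IndexTree.contractOrd_eq hA]
    exact fun h => hT' (Subtype.ext h.symm)
  · exact fun h => absurd (Finset.mem_univ _) h

lemma exceptionalHom_ιTree {k : ℕ} (T : IndexTreeOf n (k + 1)) {A : Finset (Fin n)}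
    (hA : A ∈ T.1.exceptional) (i : ZMod 2) :
    S.exceptionalHom T.1 hA i ≫ S.ιTree ⟨_, IndexTree.card_exceptionalContraction T.2 hA⟩ i =
      ∑ T' : IndexTreeOf n k, (-(if T.1.contractExc A = T'.1 then T.1.nodeSign A else 0)) •
        extendedMap (S.sheafFunctor i) T.1.leafPartition T'.1.leafPartition ≫ S.ιTree T' i := by
  have h := IndexTree.leafPartition_le_exceptionalContraction hA
  rw [Finset.sum_eq_single ⟨_, IndexTree.card_exceptionalContraction T.2 hA⟩]
  · rw [if_pos (IndexTree.contractExc_eq hA), exceptionalHom, Preadditive.zsmul_comp]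
    congr 2
    rw [extendedMap_eq _ h]
  · intro T' _ hT'
    rw [if_neg, neg_zero, zero_smul]
    rw [IndexTree.contractExc_eq hA]
    exact fun h => hT' (Subtype.ext h.symm)
  · exact fun h => absurd (Finset.mem_univ _) h

/-- The homomorphism `d_{n,k+1}` is given by the matrix of the homomorphisms `treeMap`. -/
lemma ιTree_dnk {k : ℕ} (T : IndexTreeOf n (k + 1)) (i : ZMod 2) :
    S.ιTree T i ≫ S.dnk k i =
      ∑ T' : IndexTreeOf n k, treeMap (S.sheafFunctor i) T.1 T'.1 ≫ S.ιTree T' i := by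
  rw [dnk, Preadditive.comp_sum, Finset.sum_eq_single T]
  · rw [← Category.assoc, ιTree_πTree_self, Category.id_comp]
    simp only [ordinaryHom_ιTree, exceptionalHom_ιTree]
    rw [Finset.sum_comm, Finset.sum_comm (s := (Finset.univ : Finset T.1.exceptional)),
      ← Finset.sum_add_distrib]
    refine Finset.sum_congr rfl fun T' _ => ?_
    rw [← Finset.sum_smul, ← Finset.sum_smul, ← add_smul, treeMap, IndexTree.coeff,
      Preadditive.zsmul_comp, sub_eq_add_neg, ← Finset.sum_neg_distrib]
    congr 2
    · exact Finset.sum_coe_sort T.1.ordinary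
        fun A => if T.1.contractOrd A = T'.1 then T.1.nodeSign A else 0
    · exact Finset.sum_coe_sort T.1.exceptional
        fun A => -if T.1.contractExc A = T'.1 then T.1.nodeSign A else 0
  · intro T' _ h
    rw [← Category.assoc, ιTree_πTree_ne S h.symm, zero_comp]
  · exact fun h => absurd (Finset.mem_univ _) h

lemma ιTree_dnk_πTree {k : ℕ} (T : IndexTreeOf n (k + 1)) (T' : IndexTreeOf n k) (i : ZMod 2) :
    S.ιTree T i ≫ S.dnk k i ≫ S.πTree T' i = treeMap (S.sheafFunctor i) T.1 T'.1 := by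
  rw [← Category.assoc, ιTree_dnk, Preadditive.sum_comp, Finset.sum_eq_single T']
  · rw [Category.assoc, ιTree_πTree_self]
    exact Category.comp_id _
  · intro T'' _ h
    rw [Category.assoc, ιTree_πTree_ne S h, comp_zero]
  · exact fun h => absurd (Finset.mem_univ _) h

/-- The combinatorial identities run over all trees, the sheaves `G_{n,k}` over trees with a fixed
number of non-leaf nodes; this passes between the two. -/
lemma sum_indexTreeOf {M : Type*} [AddCommMonoid M] (k : ℕ) (g : IndexTree n → M)
    (hg : ∀ T, T.inner.card ≠ k → g T = 0) : ∑ T : IndexTreeOf n k, g T.1 = ∑ T, g T := by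
  rw [← Finset.sum_filter_of_ne (p := fun T : IndexTree n => T.inner.card = k)
    (fun T _ h => by_contra fun h' => h (hg T h'))]
  exact (Finset.sum_subtype _ (by simp) g).symm

lemma dnk_dnk (k : ℕ) (i : ZMod 2) : S.dnk (k + 1) i ≫ S.dnk k i = 0 := by
  refine S.Gnk_hom_ext fun T => ?_
  rw [comp_zero, ← Category.assoc, ιTree_dnk, Preadditive.sum_comp]
  simp only [Category.assoc, ιTree_dnk, Preadditive.comp_sum]
  rw [Finset.sum_comm]
  refine Finset.sum_eq_zero fun T'' _ => ?_
  simp only [← Category.assoc]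
  rw [← Preadditive.sum_comp]
  have h := sum_indexTreeOf (k + 1)
    (fun T' => treeMap (S.sheafFunctor i) T.1 T' ≫ treeMap (S.sheafFunctor i) T' T''.1)
    (fun T' hT' => by
      rw [treeMap_eq_zero_of_card_ne, zero_comp]
      rw [T.2]
      omega)
  rw [h, sum_treeMap_comp_treeMap, zero_comp]

/-! ### The components of `G_n` -/

lemma ιDeg_πDeg_self (k : Fin n) (i : ZMod 2) : S.ιDeg k i ≫ S.πDeg k i = 𝟙 _ :=
  biproduct.ι_π_self _ k

lemma ιDeg_πDeg_ne {k l : Fin n} (h : k ≠ l) (i : ZMod 2) : S.ιDeg k i ≫ S.πDeg l i = 0 :=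
  biproduct.ι_π_ne _ h

lemma sum_πDeg_ιDeg (i : ZMod 2) : ∑ k : Fin n, S.πDeg k i ≫ S.ιDeg k i = 𝟙 (S.Gn i) :=
  biproduct.total

lemma Gn_hom_ext {i : ZMod 2} {Z : EquivariantModule G (power X n)}
    {f g : S.Gn i ⟶ Z} (h : ∀ k, S.ιDeg k i ≫ f = S.ιDeg k i ≫ g) : f = g :=
  biproduct.hom_ext' _ _ h

lemma ιDeg_dn_zero (h : 0 < n) (i : ZMod 2) : S.ιDeg ⟨0, h⟩ i ≫ S.dn i = 0 := by
  rw [dn, Preadditive.comp_sum]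
  refine Finset.sum_eq_zero fun k _ => ?_
  rw [← Category.assoc, ιDeg_πDeg_ne, zero_comp]
  exact fun h => by simp at h

/-- The degrees `i + (k + 1)` and `(i + 1) + k` are equal but not identical expressions, so
identifications of sheaves have to be moved past the differential. -/
lemma eqToHom_dnk (k : ℕ) {i j : ZMod 2} (h : i = j) :
    eqToHom (congrArg (S.Gnk (k + 1)) h) ≫ S.dnk k j =
      S.dnk k i ≫ eqToHom (congrArg (S.Gnk k) h) := by
  subst h
  simp

lemma ιDeg_dn_succ (k : ℕ) (h : k + 1 < n) (i : ZMod 2)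
    (e : i + ((k + 1 : ℕ) : ZMod 2) = i + 1 + (k : ℕ)) :
    S.ιDeg ⟨k + 1, h⟩ i ≫ S.dn i = S.dnk k (i + ((k + 1 : ℕ) : ZMod 2)) ≫
      eqToHom (congrArg (S.Gnk k) e) ≫ S.ιDeg ⟨k, by omega⟩ (i + 1) := by
  rw [dn, Preadditive.comp_sum, Finset.sum_eq_single ⟨k, by omega⟩]
  · rw [← Category.assoc, ιDeg_πDeg_self, Category.id_comp]
  · intro l _ hl
    rw [← Category.assoc, ιDeg_πDeg_ne, zero_comp]
    rintro h
    apply hl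
    ext
    have := congrArg Fin.val h
    simp only at this ⊢
    omega
  · exact fun h => absurd (Finset.mem_univ _) h

lemma dn_dn (i : ZMod 2) : S.dn i ≫ S.dn (i + 1) = 0 := by
  refine S.Gn_hom_ext fun k => ?_
  rw [comp_zero, ← Category.assoc]
  obtain ⟨k, hk⟩ := k
  rcases k with _ | k
  · rw [ιDeg_dn_zero, zero_comp]
  have e (i : ZMod 2) (k : ℕ) : i + ((k + 1 : ℕ) : ZMod 2) = i + 1 + (k : ℕ) := by
    push_cast; ring
  rw [ιDeg_dn_succ S k hk i (e i k), Category.assoc, Category.assoc]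
  rcases k with _ | k
  · rw [ιDeg_dn_zero, comp_zero, comp_zero]
  · rw [ιDeg_dn_succ S k (by omega) (i + 1) (e (i + 1) k), ← Category.assoc (eqToHom _),
      eqToHom_dnk S k (e i (k + 1)), Category.assoc, ← Category.assoc, dnk_dnk, zero_comp]

/-! ### Exactness -/

section Exactness

variable {𝒟 : Type*} [Category 𝒟] [Preadditive 𝒟]
  (Φ : EquivariantModule G (power X n) ⥤ 𝒟) {I : Finset (Fin n)} {Z : 𝒟}

/-- The image of the degree `i` part of the system under `Φ`. -/
abbrev imageFunctor (i : ZMod 2) : SetPartition n ⥤ 𝒟 where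
  obj 𝔄 := Φ.obj (S.F.obj 𝔄 i)
  map f := Φ.map ((S.sheafFunctor i).map f)
  map_id 𝔄 := (congrArg Φ.map ((S.sheafFunctor i).map_id 𝔄)).trans (Φ.map_id _)
  map_comp f g := (congrArg Φ.map ((S.sheafFunctor i).map_comp f g)).trans (Φ.map_comp _ _)

/-- The components of a generalized element of `G_{n,k}`, extended by `0` to all trees. -/
def components {k : ℕ} {i : ZMod 2} (z : Z ⟶ Φ.obj (S.Gnk k i)) (T : IndexTree n) :
    Z ⟶ (S.imageFunctor Φ i).obj T.leafPartition :=
  if h : T.inner.card = k then z ≫ Φ.map (S.πTree ⟨T, h⟩ i) else 0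

lemma components_eq {k : ℕ} {i : ZMod 2} (z : Z ⟶ Φ.obj (S.Gnk k i)) (T : IndexTreeOf n k) :
    S.components Φ z T.1 = z ≫ Φ.map (S.πTree T i) := dif_pos T.2

lemma components_eq_zero {k : ℕ} {i : ZMod 2} (z : Z ⟶ Φ.obj (S.Gnk k i)) {T : IndexTree n}
    (h : T.inner.card ≠ k) : S.components Φ z T = 0 := dif_neg h

variable [Φ.Additive]

lemma treeMap_imageFunctor (i : ZMod 2) (T T' : IndexTree n) :
    treeMap (S.imageFunctor Φ i) T T' = Φ.map (treeMap (S.sheafFunctor i) T T') :=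
  treeMap_comp_functor (S.sheafFunctor i) Φ T T'

lemma sum_comp_πTree_ιTree {k : ℕ} {i : ZMod 2} (z : Z ⟶ Φ.obj (S.Gnk k i)) :
    ∑ T, (z ≫ Φ.map (S.πTree T i)) ≫ Φ.map (S.ιTree T i) = z := by
  simp only [Category.assoc, ← Φ.map_comp]
  rw [← Preadditive.comp_sum, ← Φ.map_sum, sum_πTree_ιTree, Φ.map_id, Category.comp_id]

lemma comp_dnk_πTree {k : ℕ} {i : ZMod 2} (z : Z ⟶ Φ.obj (S.Gnk (k + 1) i))
    (T' : IndexTreeOf n k) :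
    z ≫ Φ.map (S.dnk k i) ≫ Φ.map (S.πTree T' i) =
      ∑ T, (z ≫ Φ.map (S.πTree T i)) ≫ treeMap (S.imageFunctor Φ i) T.1 T'.1 := by
  nth_rw 1 [← S.sum_comp_πTree_ιTree Φ z]
  rw [Preadditive.sum_comp]
  refine Finset.sum_congr rfl fun T _ => ?_
  rw [Category.assoc, ← Φ.map_comp, ← Φ.map_comp, ιTree_dnk_πTree, treeMap_imageFunctor]

lemma comp_πTree_ext {k : ℕ} {i : ZMod 2} {z z' : Z ⟶ Φ.obj (S.Gnk k i)}
    (h : ∀ T, z ≫ Φ.map (S.πTree T i) = z' ≫ Φ.map (S.πTree T i)) : z = z' := by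
  rw [← S.sum_comp_πTree_ιTree Φ z, ← S.sum_comp_πTree_ιTree Φ z']
  exact Finset.sum_congr rfl fun T _ => by rw [h]

/-- A generalized cycle of `G_{n,k}` is a boundary. -/
lemma exists_comp_dnk_eq (hI : IsMixed I Finset.univ) {i : ZMod 2}
    (hP : ∀ T T', IndexTree.Matched I T T' → IsIso (treeMap (S.imageFunctor Φ i) T T'))
    {k : ℕ} (z : Z ⟶ Φ.obj (S.Gnk k i))
    (hz : ∀ T' : IndexTree n, T'.inner.card + 1 = k →
      ∑ T : IndexTreeOf n k,
        (z ≫ Φ.map (S.πTree T i)) ≫ treeMap (S.imageFunctor Φ i) T.1 T' = 0) :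
    ∃ w : Z ⟶ Φ.obj (S.Gnk (k + 1) i), w ≫ Φ.map (S.dnk k i) = z := by
  -- Extended by zero, `z` is a cycle on all trees: targets with a number of non-leaf nodes other
  -- than `k - 1` receive nothing.
  obtain ⟨w, hw⟩ := exists_boundary hI hP (S.components Φ z) (fun T' => by
    by_cases h : T'.inner.card + 1 = k
    · rw [← hz T' h, ← sum_indexTreeOf k (fun T => S.components Φ z T ≫ treeMap _ T T')]
      · simp only [components_eq]
      · intro T hT
        rw [components_eq_zero S Φ z hT, zero_comp]
    · refine Finset.sum_eq_zero fun T _ => ?_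
      by_cases hT : T.inner.card = k
      · rw [treeMap_eq_zero_of_card_ne _ (by omega), comp_zero]
      · rw [components_eq_zero S Φ z hT, zero_comp])
  -- Only the components of `w` with `k + 1` non-leaf nodes are kept. The others do not contribute
  -- to trees with `k` non-leaf nodes.
  let v : Z ⟶ Φ.obj (S.Gnk (k + 1) i) :=
    ∑ T : IndexTreeOf n (k + 1), (w T.1 ≫ Φ.map (S.ιTree T i) : Z ⟶ Φ.obj (S.Gnk (k + 1) i))
  have hv (T : IndexTreeOf n (k + 1)) : v ≫ Φ.map (S.πTree T i) = w T.1 := by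
    simp only [v]
    rw [Preadditive.sum_comp, Finset.sum_eq_single T]
    · rw [Category.assoc, ← Φ.map_comp, ιTree_πTree_self, Φ.map_id]
      exact Category.comp_id _
    · intro T' _ h
      rw [Category.assoc, ← Φ.map_comp, ιTree_πTree_ne S h, Φ.map_zero, comp_zero]
    · exact fun h => absurd (Finset.mem_univ _) h
  refine ⟨v, S.comp_πTree_ext Φ fun T' => ?_⟩
  rw [Category.assoc, comp_dnk_πTree, ← components_eq, ← hw]
  simp only [hv]
  refine sum_indexTreeOf (k + 1) (fun T => w T ≫ treeMap _ T T'.1) fun T hT => ?_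
  rw [treeMap_eq_zero_of_card_ne, comp_zero]
  rw [T'.2]
  exact hT

lemma sum_comp_πDeg_ιDeg {i : ZMod 2} (z : Z ⟶ Φ.obj (S.Gn i)) :
    ∑ k, (z ≫ Φ.map (S.πDeg k i)) ≫ Φ.map (S.ιDeg k i) = z := by
  simp only [Category.assoc, ← Φ.map_comp]
  rw [← Preadditive.comp_sum, ← Φ.map_sum, sum_πDeg_ιDeg, Φ.map_id, Category.comp_id]

lemma comp_πDeg_ext {i : ZMod 2} {z z' : Z ⟶ Φ.obj (S.Gn i)}
    (h : ∀ k, z ≫ Φ.map (S.πDeg k i) = z' ≫ Φ.map (S.πDeg k i)) : z = z' := by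
  rw [← S.sum_comp_πDeg_ιDeg Φ z, ← S.sum_comp_πDeg_ιDeg Φ z']
  exact Finset.sum_congr rfl fun k _ => by rw [h]

lemma dn_πDeg (k : ℕ) (h : k + 1 < n) (i : ZMod 2)
    (e : i + ((k + 1 : ℕ) : ZMod 2) = i + 1 + (k : ℕ)) :
    S.dn i ≫ S.πDeg ⟨k, by omega⟩ (i + 1) = S.πDeg ⟨k + 1, h⟩ i ≫
      S.dnk k (i + ((k + 1 : ℕ) : ZMod 2)) ≫ eqToHom (congrArg (S.Gnk k) e) := by
  rw [dn, Preadditive.sum_comp, Finset.sum_eq_single ⟨k, by omega⟩]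
  · simp only [Category.assoc]
    rw [ιDeg_πDeg_self, Category.comp_id]
  · intro l _ hl
    simp only [Category.assoc]
    rw [ιDeg_πDeg_ne, comp_zero, comp_zero, comp_zero]
    rintro h
    apply hl
    ext
    exact congrArg (fun x : Fin n => (x : ℕ)) h
  · exact fun h => absurd (Finset.mem_univ _) h

lemma dn_πDeg_last (h : 0 < n) (i : ZMod 2) :
    S.dn i ≫ S.πDeg ⟨n - 1, by omega⟩ (i + 1) = 0 := by
  rw [dn, Preadditive.sum_comp]
  refine Finset.sum_eq_zero fun l _ => ?_
  simp only [Category.assoc]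
  rw [ιDeg_πDeg_ne, comp_zero, comp_zero, comp_zero]
  intro h
  have := congrArg Fin.val h
  have := l.2
  simp only at *
  omega

/-- The direct sum is empty by `card_inner_lt`. -/
lemma id_Gnk_eq_zero {k : ℕ} (hn : 1 ≤ n) (hk : n ≤ k) (i : ZMod 2) : 𝟙 (S.Gnk k i) = 0 := by
  refine S.Gnk_hom_ext fun T => ?_
  have := T.1.card_inner_lt hn
  have := T.2
  omega

/-- A generalized cycle of `G_n` is a boundary. -/
lemma exists_comp_dn_eq (hn : 1 ≤ n) (hI : IsMixed I Finset.univ)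
    (hP : ∀ i T T', IndexTree.Matched I T T' → IsIso (treeMap (S.imageFunctor Φ i) T T'))
    {i : ZMod 2} (z : Z ⟶ Φ.obj (S.Gn (i + 1))) (hz : z ≫ Φ.map (S.dn (i + 1)) = 0) :
    ∃ w : Z ⟶ Φ.obj (S.Gn i), w ≫ Φ.map (S.dn i) = z := by
  have e (i : ZMod 2) (k : ℕ) : i + ((k + 1 : ℕ) : ZMod 2) = i + 1 + (k : ℕ) := by
    push_cast; ring
  -- The differential lowers `k` by one, so each component of `z` is separately a cycle and bounds
  -- in `G_{n,k+1}`. For `k = 0` there is no cycle condition.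
  have h (k : Fin n) : ∃ w : Z ⟶ Φ.obj (S.Gnk (k + 1) (i + 1 + (k : ℕ))),
      w ≫ Φ.map (S.dnk k (i + 1 + (k : ℕ))) = z ≫ Φ.map (S.πDeg k (i + 1)) := by
    refine S.exists_comp_dnk_eq Φ hI (hP _) _ ?_
    intro T' hT'
    obtain ⟨k, hk⟩ := k
    rcases k with _ | k
    · simp at hT'
    · have h1 := congrArg (fun f => f ≫ Φ.map (S.πDeg ⟨k, by omega⟩ (i + 1 + 1))) hz
      simp only [Category.assoc, zero_comp, ← Φ.map_comp] at h1
      rw [dn_πDeg S k hk (i + 1) (e (i + 1) k)] at h1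
      have h2 := congrArg (fun f => f ≫ Φ.map (eqToHom (congrArg (S.Gnk k) (e (i + 1) k).symm))) h1
      simp only [Category.assoc, zero_comp, ← Φ.map_comp, eqToHom_trans, eqToHom_refl,
        Category.comp_id] at h2
      have h3 := S.comp_dnk_πTree Φ (z ≫ Φ.map (S.πDeg ⟨k + 1, hk⟩ (i + 1)))
        ⟨T', by simpa using hT'⟩
      refine h3.symm.trans ?_
      rw [← Category.assoc, Category.assoc z, ← Φ.map_comp, h2, zero_comp]
  choose w hw using h
  have l0 (k : Fin (n - 1)) : (k : ℕ) < n := by omega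
  have l1 (k : Fin (n - 1)) : (k : ℕ) + 1 < n := by omega
  -- The chain `w k` goes into the summand `k + 1`. The index `k = n - 1` is left out, as `G_n` has
  -- no summand `G_{n,n}`.
  let v : Z ⟶ Φ.obj (S.Gn i) := ∑ k : Fin (n - 1),
    w ⟨k, l0 k⟩ ≫ Φ.map (eqToHom (congrArg (S.Gnk (k + 1)) (e i k).symm)) ≫
      Φ.map (S.ιDeg ⟨k + 1, l1 k⟩ i)
  have hv (k : Fin (n - 1)) : v ≫ Φ.map (S.πDeg ⟨k + 1, l1 k⟩ i) =
      w ⟨k, l0 k⟩ ≫ Φ.map (eqToHom (congrArg (S.Gnk (k + 1)) (e i k).symm)) := by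
    simp only [v]
    rw [Preadditive.sum_comp, Finset.sum_eq_single k]
    · rw [Category.assoc, Category.assoc, ← Φ.map_comp (S.ιDeg _ _), ιDeg_πDeg_self, Φ.map_id,
        Category.comp_id]
    · intro l _ hl
      rw [Category.assoc, Category.assoc, ← Φ.map_comp (S.ιDeg _ _), ιDeg_πDeg_ne, Φ.map_zero,
        comp_zero, comp_zero]
      intro h
      apply hl
      ext
      have := congrArg Fin.val h
      simp only at this
      omega
    · exact fun h => absurd (Finset.mem_univ _) h
  refine ⟨v, S.comp_πDeg_ext Φ fun k => ?_⟩
  by_cases hk : (k : ℕ) + 1 < n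
  · have h1 := S.dn_πDeg k hk i (e i k)
    rw [Category.assoc, ← Φ.map_comp]
    change v ≫ Φ.map (S.dn i ≫ S.πDeg ⟨k, by omega⟩ (i + 1)) = _
    rw [h1, Φ.map_comp, ← Category.assoc, hv ⟨k, by omega⟩, ← hw k, Category.assoc,
      ← Φ.map_comp, ← Category.assoc, eqToHom_dnk S k (e i k).symm]
    simp
  -- In the top degree `w k` maps to `G_{n,n} = 0`, so this component of `z` vanishes, as does that
  -- of the boundary.
  · have h1 := S.dn_πDeg_last hn i
    have hk' : k = ⟨n - 1, by omega⟩ := Fin.ext (by simp only; omega)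
    rw [← hk'] at h1
    have h2 : w k = 0 := by
      rw [← Category.comp_id (w _), ← Φ.map_id, S.id_Gnk_eq_zero hn (by omega),
        Φ.map_zero, comp_zero]
    rw [Category.assoc, ← Φ.map_comp, h1, ← hw, h2, Φ.map_zero, comp_zero, zero_comp]

end Exactness

end EquivariantStrictSystem

/-! ### Equivariance of the differential -/

lemma EquivariantObject.sum_hom {C D E : Type*} [Category C] [Category D] [Category E]
    {K : CocycleDatum C D E} [Preadditive C] [Preadditive D] [K.A.Additive] [K.P.Additive]
    {M N : EquivariantObject K} {ι : Type*} (s : Finset ι) (f : ι → (M ⟶ N)) :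
    (∑ j ∈ s, f j).hom = ∑ j ∈ s, (f j).hom :=
  (EquivariantObject.forget K).map_sum f s

lemma EquivariantObject.zsmul_hom {C D E : Type*} [Category C] [Category D] [Category E]
    {K : CocycleDatum C D E} [Preadditive C] [Preadditive D] [K.A.Additive] [K.P.Additive]
    {M N : EquivariantObject K} (m : ℤ) (f : M ⟶ N) : (m • f).hom = m • f.hom := rfl

/-- The bijection `T ↦ σT` on the index trees with `k` non-leaf nodes. -/
abbrev permIndexTreeOf {n : ℕ} (σ : Equiv.Perm (Fin n)) (k : ℕ) (T : IndexTreeOf n k) :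
    IndexTreeOf n k :=
  ⟨T.1.perm σ, IndexTree.card_inner_perm σ T.2⟩

lemma permIndexTreeOf_bijective {n : ℕ} (σ : Equiv.Perm (Fin n)) (k : ℕ) :
    Function.Bijective (permIndexTreeOf σ k) :=
  Finite.injective_iff_bijective.1 fun _ _ h =>
    Subtype.ext (IndexTree.perm_injective σ (congrArg Subtype.val h))

namespace EquivariantStrictSystem

variable {G : Over SpecC} [GrpObj G] {X : Over SpecC} [ModObj G X] [IsSeparated X.hom] {n : ℕ}
  (S : EquivariantStrictSystem G X n)

/-- Identifications along equal partitions become instances of `φ`, so functoriality takes care of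
them. -/
lemma eqToHom_eq_map_hom {𝔄 𝔅 : SetPartition n} (h : 𝔄 = 𝔅) (i : ZMod 2) :
    eqToHom (congrArg (fun 𝔄 => (S.F.obj 𝔄 i).obj) h) =
      ((S.sheafFunctor i).map (homOfLE h.le)).hom := by
  subst h
  exact (congrArg EquivariantObject.Hom.hom ((S.sheafFunctor i).map_id 𝔄)).symm

/-- The matrix entry of the equivariance of `d_n`: the naturality of `ρ` with respect to `φ`,
together with the sign identity `permSign_mul_coeff_perm`. -/
lemma ρTree_treeMap (σ : Equiv.Perm (Fin n)) (T T' : IndexTree n) (i : ZMod 2) :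
    S.ρTree σ T i ≫ (treeMap (S.sheafFunctor i) (T.perm σ) (T'.perm σ)).hom =
      (Scheme.Modules.pullback (permMap X σ).left).map (treeMap (S.sheafFunctor i) T T').hom ≫
        S.ρTree σ T' i := by
  by_cases h : T.leafPartition ≤ T'.leafPartition
  swap
  · have h0 : T.coeff T' = 0 := by
      by_contra hn
      exact h (IndexTree.leafPartition_le_of_coeff_ne_zero hn)
    have h1 : T.permSign σ * (T.perm σ).coeff (T'.perm σ) = 0 := by
      rw [IndexTree.permSign_mul_coeff_perm, h0, zero_mul]
    rw [treeMap, treeMap, h0, EquivariantObject.zsmul_hom, EquivariantObject.zsmul_hom, ρTree,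
      Preadditive.comp_zsmul, Preadditive.zsmul_comp, smul_smul, mul_comm, h1, zero_smul, zero_smul,
      Functor.map_zero, zero_comp]
  have h' : (T.perm σ).leafPartition ≤ (T'.perm σ).leafPartition := by
    rw [← IndexTree.leafPartition_perm, ← IndexTree.leafPartition_perm]
    exact permPartition_mono σ h
  have e := IndexTree.leafPartition_perm σ T
  have e' := IndexTree.leafPartition_perm σ T'
  rw [treeMap, treeMap, extendedMap_eq _ h, extendedMap_eq _ h', EquivariantObject.zsmul_hom,
    EquivariantObject.zsmul_hom, ρTree, ρTree, Preadditive.comp_zsmul, Preadditive.zsmul_comp,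
    smul_smul, Functor.map_zsmul, Preadditive.comp_zsmul, Preadditive.zsmul_comp, smul_smul,
    mul_comm ((T.perm σ).coeff _), IndexTree.permSign_mul_coeff_perm, mul_comm (T'.permSign σ)]
  congr 1
  rw [S.eqToHom_eq_map_hom e i, S.eqToHom_eq_map_hom e' i, ← Category.assoc]
  have hn := S.ρ_naturality σ h i
  refine Eq.trans ?_ (congrArg (fun f => f ≫ ((S.sheafFunctor i).map (homOfLE e'.le)).hom) hn)
  rw [Category.assoc, Category.assoc]
  congr 1
  -- Both composites are images of arrows between the same two partitions, and there is only one
  -- such arrow in a partial order.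
  have h1 := (S.sheafFunctor i).map_comp (homOfLE e.le) (homOfLE h')
  have h2 := (S.sheafFunctor i).map_comp (homOfLE (permPartition_mono σ h)) (homOfLE e'.le)
  exact congrArg EquivariantObject.Hom.hom (h1.symm.trans h2)

lemma pullback_ιTree_ρnk (σ : Equiv.Perm (Fin n)) {k : ℕ} (T : IndexTreeOf n k) (i : ZMod 2) :
    (Scheme.Modules.pullback (permMap X σ).left).map (S.ιTree T i).hom ≫ S.ρnk σ k i =
      S.ρTree σ T.1 i ≫ (S.ιTree (permIndexTreeOf σ k T) i).hom := by
  rw [ρnk, Preadditive.comp_sum, Finset.sum_eq_single T]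
  · rw [← Category.assoc, ← Functor.map_comp, ← EquivariantObject.comp_hom, ιTree_πTree_self,
      EquivariantObject.id_hom, CategoryTheory.Functor.map_id, Category.id_comp]
  · intro T' _ h
    rw [← Category.assoc, ← Functor.map_comp, ← EquivariantObject.comp_hom,
      ιTree_πTree_ne S h.symm]
    exact (congrArg (· ≫ _) (Functor.map_zero _ _ _)).trans zero_comp
  · exact fun h => absurd (Finset.mem_univ _) h

/-- Pullback is additive, so it preserves the decomposition of the identity of `G_{n,k}` into
inclusions and projections. -/
lemma pullback_Gnk_hom_ext (σ : Equiv.Perm (Fin n)) {k : ℕ} {i : ZMod 2}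
    {Z : (power X n).left.Modules}
    {f g : (Scheme.Modules.pullback (permMap X σ).left).obj (S.Gnk k i).obj ⟶ Z}
    (h : ∀ T, (Scheme.Modules.pullback (permMap X σ).left).map (S.ιTree T i).hom ≫ f =
      (Scheme.Modules.pullback (permMap X σ).left).map (S.ιTree T i).hom ≫ g) : f = g := by
  have e : 𝟙 ((Scheme.Modules.pullback (permMap X σ).left).obj (S.Gnk k i).obj) =
      ∑ T : IndexTreeOf n k, (Scheme.Modules.pullback (permMap X σ).left).map (S.πTree T i).hom ≫
        (Scheme.Modules.pullback (permMap X σ).left).map (S.ιTree T i).hom := by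
    rw [← CategoryTheory.Functor.map_id, ← EquivariantObject.id_hom, ← sum_πTree_ιTree,
      EquivariantObject.sum_hom, Functor.map_sum]
    simp only [EquivariantObject.comp_hom, Functor.map_comp]
  rw [← Category.id_comp f, ← Category.id_comp g, e, Preadditive.sum_comp, Preadditive.sum_comp]
  exact Finset.sum_congr rfl fun T _ => by rw [Category.assoc, Category.assoc, h]

lemma ρnk_dnk (σ : Equiv.Perm (Fin n)) (k : ℕ) (i : ZMod 2) :
    S.ρnk σ (k + 1) i ≫ (S.dnk k i).hom =
      (Scheme.Modules.pullback (permMap X σ).left).map (S.dnk k i).hom ≫ S.ρnk σ k i := by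
  refine S.pullback_Gnk_hom_ext σ fun T => ?_
  -- Both sides are expanded over target trees; on the left these are reindexed by `T' ↦ σT'`.
  rw [← Category.assoc, pullback_ιTree_ρnk, Category.assoc, ← EquivariantObject.comp_hom,
    ιTree_dnk, ← Category.assoc, ← Functor.map_comp, ← EquivariantObject.comp_hom, ιTree_dnk,
    EquivariantObject.sum_hom, EquivariantObject.sum_hom, Functor.map_sum, Preadditive.sum_comp,
    Preadditive.comp_sum, ← (permIndexTreeOf_bijective σ k).sum_comp]
  refine Finset.sum_congr rfl fun T' _ => ?_
  rw [EquivariantObject.comp_hom, EquivariantObject.comp_hom, Functor.map_comp, Category.assoc,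
    pullback_ιTree_ρnk, ← Category.assoc, ← Category.assoc]
  exact congrArg (fun f => f ≫ (S.ιTree (permIndexTreeOf σ k T') i).hom)
    (S.ρTree_treeMap σ T.1 T'.1 i)

lemma pullback_ιDeg_ρn (σ : Equiv.Perm (Fin n)) (k : Fin n) (i : ZMod 2) :
    (Scheme.Modules.pullback (permMap X σ).left).map (S.ιDeg k i).hom ≫ S.ρn σ i =
      S.ρnk σ k (i + (k : ℕ)) ≫ (S.ιDeg k i).hom := by
  rw [ρn, Preadditive.comp_sum, Finset.sum_eq_single k]
  · rw [← Category.assoc, ← Functor.map_comp, ← EquivariantObject.comp_hom, ιDeg_πDeg_self,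
      EquivariantObject.id_hom, CategoryTheory.Functor.map_id, Category.id_comp]
  · intro l _ h
    rw [← Category.assoc, ← Functor.map_comp, ← EquivariantObject.comp_hom,
      ιDeg_πDeg_ne S h.symm]
    exact (congrArg (· ≫ _) (Functor.map_zero _ _ _)).trans zero_comp
  · exact fun h => absurd (Finset.mem_univ _) h

lemma pullback_Gn_hom_ext (σ : Equiv.Perm (Fin n)) {i : ZMod 2}
    {Z : (power X n).left.Modules}
    {f g : (Scheme.Modules.pullback (permMap X σ).left).obj (S.Gn i).obj ⟶ Z}
    (h : ∀ k, (Scheme.Modules.pullback (permMap X σ).left).map (S.ιDeg k i).hom ≫ f =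
      (Scheme.Modules.pullback (permMap X σ).left).map (S.ιDeg k i).hom ≫ g) : f = g := by
  have e : 𝟙 ((Scheme.Modules.pullback (permMap X σ).left).obj (S.Gn i).obj) =
      ∑ k : Fin n, (Scheme.Modules.pullback (permMap X σ).left).map (S.πDeg k i).hom ≫
        (Scheme.Modules.pullback (permMap X σ).left).map (S.ιDeg k i).hom := by
    rw [← CategoryTheory.Functor.map_id, ← EquivariantObject.id_hom, ← sum_πDeg_ιDeg,
      EquivariantObject.sum_hom, Functor.map_sum]
    simp only [EquivariantObject.comp_hom, Functor.map_comp]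
  rw [← Category.id_comp f, ← Category.id_comp g, e, Preadditive.sum_comp, Preadditive.sum_comp]
  exact Finset.sum_congr rfl fun T _ => by rw [Category.assoc, Category.assoc, h]

lemma ρnk_eqToHom (σ : Equiv.Perm (Fin n)) (k : ℕ) {i j : ZMod 2} (h : i = j) :
    S.ρnk σ k i ≫ (eqToHom (congrArg (S.Gnk k) h)).hom =
      (Scheme.Modules.pullback (permMap X σ).left).map (eqToHom (congrArg (S.Gnk k) h)).hom ≫
        S.ρnk σ k j := by
  subst h
  simp only [eqToHom_refl, EquivariantObject.id_hom, CategoryTheory.Functor.map_id, Category.id_comp,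
    Category.comp_id]

lemma ρn_dn (σ : Equiv.Perm (Fin n)) (i : ZMod 2) :
    S.ρn σ i ≫ (S.dn i).hom =
      (Scheme.Modules.pullback (permMap X σ).left).map (S.dn i).hom ≫ S.ρn σ (i + 1) := by
  refine S.pullback_Gn_hom_ext σ fun k => ?_
  rw [← Category.assoc, pullback_ιDeg_ρn, Category.assoc, ← EquivariantObject.comp_hom,
    ← Category.assoc, ← Functor.map_comp, ← EquivariantObject.comp_hom]
  obtain ⟨k, hk⟩ := k
  rcases k with _ | k
  · rw [ιDeg_dn_zero]
    exact comp_zero.trans ((congrArg (· ≫ _) (Functor.map_zero _ _ _)).trans zero_comp).symm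
  · have e : i + ((k + 1 : ℕ) : ZMod 2) = i + 1 + (k : ℕ) := by push_cast; ring
    rw [ιDeg_dn_succ S k hk i e]
    simp only [EquivariantObject.comp_hom, Functor.map_comp, Category.assoc]
    rw [pullback_ιDeg_ρn, ← Category.assoc, ρnk_dnk, Category.assoc,
      ← Category.assoc (S.ρnk σ k _), ρnk_eqToHom S σ k e, Category.assoc]

end EquivariantStrictSystem

/-! ### Restriction to open subschemes -/

/-- On underlying presheaves, restriction to an open subscheme is precomposition with the image of
open sets and so preserves limits; these are detected on presheaves. It is used to commute
restriction with homology. -/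
instance preservesFiniteLimits_restrictFunctor {Y Z : Scheme.{0}} (f : Y ⟶ Z)
    [IsOpenImmersion f] : PreservesFiniteLimits (Scheme.Modules.restrictFunctor f) where
  preservesFiniteLimits J _ _ := by
    have h' : PreservesLimitsOfShape J
        ((Functor.whiskeringLeft _ _ Ab.{0}).obj f.opensFunctor.op) :=
      whiskeringLeft_preservesLimitsOfShape J f.opensFunctor.op
    have h : PreservesLimitsOfShape J
        (Scheme.Modules.restrictFunctor f ⋙ Scheme.Modules.toPresheaf Y) :=
      @comp_preservesLimitsOfShape _ _ _ _ _ _ _ _ (Scheme.Modules.toPresheaf Z)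
        ((Functor.whiskeringLeft _ _ Ab).obj f.opensFunctor.op) _ h'
    exact preservesLimitsOfShape_of_reflects_of_preserves _ (Scheme.Modules.toPresheaf Y)

instance additive_restrictFunctor {Y Z : Scheme.{0}} (f : Y ⟶ Z)
    [IsOpenImmersion f] : (Scheme.Modules.restrictFunctor f).Additive where
  map_add := rfl

lemma isIso_app_of_isIso_restrict {Y : Scheme.{0}} {M N : Y.Modules} (φ : M ⟶ N) {V : Y.Opens}
    (h : IsIso ((Scheme.Modules.restrictFunctor V.ι).map φ)) {U : Y.Opens} (hU : U ≤ V) :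
    IsIso (φ.app U) := by
  have h1 := Scheme.Modules.Hom.isIso_iff_isIso_app.1 h (V.ι ⁻¹ᵁ U)
  have e : V.ι ''ᵁ (V.ι ⁻¹ᵁ U) = U := by
    rw [Scheme.Hom.image_preimage_eq_opensRange_inf, Scheme.Opens.opensRange_ι]
    exact inf_eq_right.2 hU
  rw [← e]
  exact h1

lemma isIso_restrict_of_le {Y : Scheme.{0}} {M N : Y.Modules} (φ : M ⟶ N) {V W : Y.Opens}
    (h : IsIso ((Scheme.Modules.restrictFunctor V.ι).map φ)) (hWV : W ≤ V) :
    IsIso ((Scheme.Modules.restrictFunctor W.ι).map φ) := by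
  refine Scheme.Modules.Hom.isIso_iff_isIso_app.2 fun U => ?_
  refine isIso_app_of_isIso_restrict φ h (U := W.ι ''ᵁ U) (le_trans ?_ hWV)
  exact (Scheme.Hom.image_le_opensRange W.ι U).trans (Scheme.Opens.opensRange_ι W).le

/-- The points of an open subset over which `M` vanishes are not in the support. -/
lemma notMem_sheafSupport_of_isZero_restrict {Y : Scheme.{0}} {M : Y.Modules} {V : Y.Opens}
    (h : IsZero ((Scheme.Modules.restrictFunctor V.ι).obj M)) {x : Y} (hx : x ∈ V) :
    x ∉ sheafSupport M := by
  intro hn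
  let y : V.toScheme := ⟨x, hx⟩
  have h1 := (Scheme.Modules.toPresheaf _ ⋙ TopCat.Presheaf.stalkFunctor _ y).map_isZero h
  have h2 : IsZero (M.presheaf.stalk x) :=
    h1.of_iso ((Scheme.Modules.restrictStalkNatIso V.ι y).app M).symm
  have : Subsingleton (M.presheaf.stalk x) := AddCommGrpCat.subsingleton_of_isZero h2
  exact not_nontrivial _ (hn : Nontrivial (M.presheaf.stalk x))

/-! ### The stratification of `X^n` -/

/-- If all coordinates of the residue field valued point at `x` agree, that point factors through
the diagonal morphism `X ⟶ X^n`. -/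
lemma mem_smallDiagonal_of_coincide {X : Over SpecC} {n : ℕ} (hn : 1 ≤ n) {x : (power X n).left}
    (h : ∀ a b, Coincide X x a b) : x ∈ smallDiagonal X n := by
  let p : Over.mk ((power X n).left.fromSpecResidueField x ≫ (power X n).hom) ⟶ power X n :=
    Over.homMk ((power X n).left.fromSpecResidueField x)
  let a₀ : Fin n := ⟨0, hn⟩
  have hp : (p ≫ coord X a₀) ≫ (Pi.lift fun _ : Fin n => 𝟙 X) = p := by
    refine Pi.hom_ext _ _ fun a => ?_
    rw [Category.assoc, Pi.lift_π, Category.comp_id]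
    ext1
    exact h a₀ a
  obtain ⟨y⟩ : Nonempty (Spec ((power X n).left.residueField x)) := inferInstance
  refine ⟨(p ≫ coord X a₀).left y, ?_⟩
  rw [← Scheme.Hom.comp_apply, ← Over.comp_left, hp]
  have : (power X n).left.fromSpecResidueField x y ∈
    Set.range ((power X n).left.fromSpecResidueField x) := ⟨y, rfl⟩
  rw [Scheme.range_fromSpecResidueField] at this
  exact this

/-- The partition of `[n]` given by the coincidences of the components of a point. -/
lemma exists_mem_stratum {X : Over SpecC} {n : ℕ} (x : (power X n).left) :
    ∃ 𝔅 : SetPartition n, x ∈ stratum X 𝔅 := by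
  let s : Setoid (Fin n) := ⟨Coincide X x, fun _ => rfl, fun h => h.symm, fun h h' => h.trans h'⟩
  refine ⟨Finpartition.ofSetoid s, fun a b => ?_⟩
  have h := Finpartition.mem_part_iff_exists (Finpartition.ofSetoid s) (a := a) (b := b)
  rw [Finpartition.mem_part_ofSetoid_iff_rel] at h
  rw [SetPartition.Rel, ← h]
  exact ⟨fun h => h.symm, fun h => h.symm⟩

namespace EquivariantStrictSystem

variable {G : Over SpecC} [GrpObj G] {X : Over SpecC} [ModObj G X] [IsSeparated X.hom] {n : ℕ}
  (S : EquivariantStrictSystem G X n)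

/-- The complex `G_n` is exact away from the small diagonal. -/
lemma sheafSupport_cohomology_subset (hn : 1 ≤ n) (h : ∀ i, S.dn i ≫ S.dn (i + 1) = 0)
    (i : ZMod 2) : sheafSupport (S.cohomology h i) ⊆ smallDiagonal X n := by
  intro x hx
  by_contra hd
  obtain ⟨a, b, hab⟩ : ∃ a b, ¬ Coincide X x a b := by
    by_contra! hc
    exact hd (mem_smallDiagonal_of_coincide hn hc)
  obtain ⟨𝔅, h𝔅⟩ := exists_mem_stratum x
  let V : (power X n).left.Opens := ⟨openStratum X 𝔅, isOpen_openStratum X 𝔅⟩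
  have hxV : x ∈ V := Set.mem_iUnion₂.2 ⟨𝔅, le_rfl, h𝔅⟩
  -- The part of `a` in `𝔅`. It contains `a` but not `b`, so `[n]` is mixed, and `𝔅` refines the
  -- partition into `I` and its complement.
  let I : Finset (Fin n) := Finset.univ.filter fun c => Coincide X x a c
  have hI : IsMixed I Finset.univ :=
    ⟨⟨a, Finset.mem_inter.2 ⟨Finset.mem_univ _, Finset.mem_filter.2 ⟨Finset.mem_univ _, rfl⟩⟩⟩,
      ⟨b, Finset.mem_sdiff.2 ⟨Finset.mem_univ _, fun h => hab (Finset.mem_filter.1 h).2⟩⟩⟩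
  have hI' : ∀ c d, 𝔅.Rel c d → (c ∈ I ↔ d ∈ I) := fun c d hcd => by
    have hcd : Coincide X x c d := (h𝔅 c d).2 hcd
    simp only [I, Finset.mem_filter, Finset.mem_univ, true_and]
    exact ⟨fun h => h.trans hcd, fun h => h.trans hcd.symm⟩
  let R := Scheme.Modules.restrictFunctor V.ι
  let Φ : EquivariantModule G (power X n) ⥤ V.toScheme.Modules := EquivariantObject.forget _ ⋙ R
  have hP : ∀ i T T', IndexTree.Matched I T T' → IsIso (treeMap (S.imageFunctor Φ i) T T') := by
    intro i T T' hT
    refine isIso_treeMap _ hT.coeff_ne_zero ?_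
    refine isIso_restrict_of_le _ (S.isIso_restrict _ i) ?_
    -- `U_𝔅` is one of the sets whose union is the locus where `φ` is an isomorphism, because the
    -- leaf partitions of a matched pair agree on `𝔅`.
    exact Set.subset_iUnion₂_of_subset 𝔅 (hT.leafPartition_inf_eq hI') subset_rfl
  let K := ShortComplex.mk (S.dn i).hom (S.dn (i + 1)).hom
    (congrArg EquivariantObject.Hom.hom (h i))
  have hK : (K.map R).Exact := by
    rw [ShortComplex.exact_iff_exact_up_to_refinements]
    intro Z z hz
    obtain ⟨w, hw⟩ := S.exists_comp_dn_eq Φ hn hI hP z hz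
    -- No refinement of `Z` is needed, since the elimination produces the bounding chain on `Z`
    -- itself.
    exact ⟨Z, 𝟙 Z, inferInstance, w, by rw [Category.id_comp]; exact hw.symm⟩
  have hZ : IsZero (R.obj K.homology) :=
    ((K.map R).exact_iff_isZero_homology.1 hK).of_iso (K.mapHomologyIso R).symm
  exact notMem_sheafSupport_of_isZero_restrict hZ hxV hx

end EquivariantStrictSystem

end TreeComplex

end

theorem mainTheorem5 (d : ℕ) (X : Over SpecC) [IsQuasiProjective X] [ModObj (torus d) X]
    (n : ℕ) (hn : 1 ≤ n) (S : EquivariantStrictSystem (torus d) X n) :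
    (∀ (σ : Equiv.Perm (Fin n)) (i : ZMod 2),
      S.ρn σ i ≫ (S.dn i).hom =
        (Scheme.Modules.pullback (permMap X σ).left).map (S.dn i).hom ≫ S.ρn σ (i + 1)) ∧
    ∃ h : ∀ i : ZMod 2, S.dn i ≫ S.dn (i + 1) = 0,
      ∀ i : ZMod 2, sheafSupport (S.cohomology h i) ⊆ smallDiagonal X n :=
  ⟨S.ρn_dn, S.dn_dn, S.sheafSupport_cohomology_subset hn S.dn_dn⟩
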